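/- **Catalogue of genus 1 and genus 2 Belyi pairs.** For a squarefree polynomial $f\in\mathbb{C}[x]$ of degree $2g+1$ or $2g+2$, let $\Sigma$ be the smooth projective complex curve of genus $g$ with function field $\mathbb{C}(x)[y]/(y^2-f(x))$. For a non-constant rational function $\beta(x,y)$ on $\Sigma$, $(\Sigma,\beta)$ is a *Belyi pair* if $\beta:\Sigma\to\mathbb{P}^1$ is unramified outside $\{0,1,\infty\}$; its *passport* $\{r_0;r_1;r_\infty\}$ consists of the three multisets of ramification indices of $\beta$ at the points above $0$, $1$ and $\infty$. Each of the following is a Belyi pair of the stated genus with the stated passport; in particular each right-hand side $f$ is squarefree of degree $2g+1$ or $2g+2$. Where $\xi$ occurs, the assertion holds for every complex root $\xi$ of the given quartic; moreover $\mathbb{Q}(\xi)$ then has degree $4$ over $\mathbb{Q}$, and the curve and $\beta$ are defined over $\mathbb{Q}(\xi)$. Genus 1: 1. $\{3;3;3\}$: $y^2=x^3+1$, $\beta=\frac12(1+y)$. 2. $\{4;4;3,1\}$: $\xi^4-2=0$, $y^2=x^3+\frac{47}{1944}x+\frac{2359}{314928}\xi^2$, $\beta=\dfrac{1}{\frac{467}{972}+\frac{\xi^2}{9}x-6x^2-4\xi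 y}$. 3. $\{4;4;2,2\}$: $y^2=x^3-x$, $\beta=\dfrac{(x+1)^2}{4x}$. 4. $\{5;5;3,1,1\}$: $\xi^4-2\xi^3-6\xi^2-8\xi+16=0$, $y^2=x^3+\frac{25}{324}x+\frac{1}{839808}\left(-1975\xi^3+3950\xi^2+19750\xi+7900\right)$, $$\beta=\frac{-24300}{25\left(-424+3888x^2+9x(2+\xi)(-2+(-4+\xi)\xi)\right)+108y\left(50(-8+\xi(-2+(-2+\xi)\xi))+9x(-32+\xi(-18+\xi(6+\xi)))\right)}.$$ 5. $\{5;5;2,2,1\}$: $\xi^4+10=0$, $y^2=x^3-\frac{5275}{6144}x+\frac{77675}{1769472}\xi^2$, $\beta=\dfrac{1}{\frac{17969}{18432}-\frac{\xi^2}{96}x-x^2-\left(-\frac{\xi}{24}-\frac{4\xi^3}{25}x\right)y}$. 6. $\{4,1;4,1;5\}$: $\xi^4-45=0$, $y^2=x^3+9x+\frac{18}{5}\xi^2$, $\beta=\dfrac{A}{Q}\,y+\dfrac{B}{Q}$ with $A=\frac{16}{3}\xi^3x^3+1680\xi x^2+\frac{9216}{25}\xi^3x-\frac{29376}{5}\xi$,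 $B=4x^5+132\xi^2x^4+10620x^3-2484\xi^2x^2+\frac{603936}{5}x-\frac{3158352}{125}\xi^2$, $Q=x^5-9\xi^2x^4+1458x^3-\frac{13122}{5}\xi^2x^2+\frac{531441}{5}x-\frac{4782969}{125}\xi^2$. 7. $\{3,2;3,2;5\}$: $\xi^4+40=0$, $y^2=x^3+3x+\frac{37}{80}\xi^2$, $\beta=\dfrac{A}{Q}\,y+\dfrac{B}{Q}$ with $A=\frac32\xi^3x^3+\frac{45}{2}\xi x^2+\frac{153}{50}\xi^3x-\frac{69}{5}\xi$, $B=4x^5-\frac{17}{2}\xi^2x^4-10x^3-\frac{173}{8}\xi^2x^2+\frac{679}{5}x+\frac{461}{500}\xi^2$, $Q=x^5+2\xi^2x^4-64x^3-\frac{128}{5}\xi^2x^2+\frac{1024}{5}x+\frac{2048}{125}\xi^2$. 8. $\{6;6;3,1,1,1\}$: $y^2=x^3+1$, $\beta=\dfrac{1}{1-\frac{8+8x^3+x^6}{x^6}-\frac{-8-4x^3}{x^6}y}$. 9. $\{6;6;2,2,1,1\}$: $y^2=x^3+\frac23x-\frac{7}{27}$, $\beta=\dfrac{1}{1+\frac{1}{27}(1-9x+27x^2-27x^3)}$.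 10. $\{3,3;3,3;3,3\}$: $y^2=x^3-\frac{15}{16}x+\frac{11}{32}$, $\beta=\frac12\left(1+\dfrac{x^2-x+\frac{7}{16}}{(x-\frac12)^2}\,y\right)$. 11. $\{3,3;3,3;4,2\}$: there is no Belyi pair $(\Sigma,\beta)$ of genus 1 with this passport, on any curve $y^2=f(x)$ with $f\in\mathbb{C}[x]$ squarefree of degree $3$ or $4$. Genus 2: 12. $\{5;5;5\}$: $y^2=x^5+1$, $\beta=\dfrac{y+1}{2}$. 13. $\{6;6;3,3\}$: $y^2=x^6+3x^3+\frac14$, $\beta=\dfrac{1}{1+\frac12(-1-8x^3-4x^6)-(1+2x^3)y}$. -/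

import Mathlib

open Polynomial IntermediateField

/-! ### Places of a function field

Let `K` be a function field of one variable over `k`. The closed points of the smooth projective
curve with function field `K` (for `k = ℂ`: the points of the compact Riemann surface) are the
discrete valuation rings of `K / k`. -/

/-- A point of the smooth projective curve with function field `K` over `k`: a discrete valuation
ring of `K` which contains `k` and has fraction field `K`. -/
structure CurvePoint (k K : Type*) [Field k] [Field K] [Algebra k K] where
  /-- the local ring of the curve at the point -/
  localRing : ValuationSubring K
  algebraMap_mem : ∀ c : k, algebraMap k K c ∈ localRing
  isDVR : IsDiscreteValuationRing localRing

namespace CurvePoint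

variable {k K : Type*} [Field k] [Field K] [Algebra k K]

instance (P : CurvePoint k K) : IsDiscreteValuationRing P.localRing := P.isDVR

/-- The order of vanishing at `P` of a rational function `z ≠ 0` (negative at a pole): the exponent
of a local coordinate in `z`. The valuation of Mathlib is multiplicative, with value
`exp (-n)` on a function of order `n`. (The value at `z = 0` is the junk value `0`.) -/
noncomputable def ord (P : CurvePoint k K) (z : K) : ℤ :=
  -WithZero.log ((IsDiscreteValuationRing.maximalIdeal P.localRing).valuation K z)

end CurvePoint

/-! ### Belyi maps and passports -/

section Belyi

variable {K : Type*} [Field K] [Algebra ℂ K]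

/-- `β` is a non-constant map to the projective line which is unramified outside `0, 1, ∞`: at a
point `P` with `β(P) = c`, that is, with `ord_P (β - c) > 0`, the ramification index
`ord_P (β - c)` is `1` unless `c ∈ {0, 1}`. -/
def IsBelyiMap (β : K) : Prop :=
  (∀ c : ℂ, β ≠ algebraMap ℂ K c) ∧
  ∀ (c : ℂ), c ≠ 0 → c ≠ 1 → ∀ P : CurvePoint ℂ K, P.ord (β - algebraMap ℂ K c) ≤ 1

/-- The rational function `z` has finitely many zeros, and `r` is the multiset of their orders. -/
def HasZeroOrders (z : K) (r : Multiset ℕ) : Prop :=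
  ∃ s : Finset (CurvePoint ℂ K), (∀ P, P ∈ s ↔ 0 < P.ord z) ∧
    s.val.map (fun P => P.ord z) = r.map (fun n => (n : ℤ))

/-- `β` has passport `{r₀; r₁; r∞}`: these are the multisets of the ramification indices of `β` at
the points above `0`, `1` and `∞`. -/
def HasPassport (β : K) (r₀ r₁ r_inf : Multiset ℕ) : Prop :=
  HasZeroOrders β r₀ ∧ HasZeroOrders (β - 1) r₁ ∧ HasZeroOrders β⁻¹ r_inf

end Belyi

/-! ### (Hyper)elliptic curves -/

/-- A (hyper)elliptic curve `y² = f(x)` of genus `g` over `ℂ`: `f` is a polynomial without multiple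
roots, of degree `2g + 1` or `2g + 2`. -/
structure HyperellipticCurve (g : ℕ) where
  f : ℂ[X]
  squarefree : Squarefree f
  natDegree_eq : f.natDegree = 2 * g + 1 ∨ f.natDegree = 2 * g + 2

namespace HyperellipticCurve

variable {g : ℕ} (S : HyperellipticCurve g)

/-- The polynomial `Y² - f(x)` over the field `ℂ(x)`. -/
noncomputable def equation : (RatFunc ℂ)[X] :=
  X ^ 2 - C (algebraMap ℂ[X] (RatFunc ℂ) S.f)

theorem irreducible_equation : Irreducible S.equation := by
  refine X_pow_sub_C_irreducible_of_prime Nat.prime_two fun b hb => ?_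
  have hint : IsIntegral ℂ[X] b :=
    IsIntegral.of_pow two_pos (hb ▸ isIntegral_algebraMap)
  obtain ⟨p, rfl⟩ := IsIntegrallyClosed.isIntegral_iff.mp hint
  rw [← map_pow] at hb
  have hp : p ^ 2 = S.f := IsFractionRing.injective ℂ[X] (RatFunc ℂ) hb
  have hu : IsUnit p := S.squarefree p ⟨1, by rw [← hp]; ring⟩
  have h0 : S.f.natDegree = 0 := by
    rw [← hp, natDegree_pow, natDegree_eq_zero_of_isUnit hu]
  rcases S.natDegree_eq with h | h <;> omega

instance : Fact (Irreducible S.equation) := ⟨S.irreducible_equation⟩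

/-- The field of rational functions `ℂ(x)[y] / (y² - f(x))` on the curve. -/
def FunctionField : Type := AdjoinRoot S.equation

noncomputable instance : Field S.FunctionField := inferInstanceAs (Field (AdjoinRoot S.equation))

noncomputable instance : Algebra (RatFunc ℂ) S.FunctionField :=
  inferInstanceAs (Algebra (RatFunc ℂ) (AdjoinRoot S.equation))

noncomputable instance : Algebra ℂ S.FunctionField :=
  inferInstanceAs (Algebra ℂ (AdjoinRoot S.equation))

instance : IsScalarTower ℂ (RatFunc ℂ) S.FunctionField :=
  inferInstanceAs (IsScalarTower ℂ (RatFunc ℂ) (AdjoinRoot S.equation))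

/-- The coordinate function `x`. -/
noncomputable def x : S.FunctionField := algebraMap (RatFunc ℂ) S.FunctionField RatFunc.X

/-- The coordinate function `y`. -/
noncomputable def y : S.FunctionField := AdjoinRoot.root S.equation

theorem y_sq : S.y ^ 2 = aeval S.x S.f := by
  have h : AdjoinRoot.mk S.equation (X ^ 2 - C (algebraMap ℂ[X] (RatFunc ℂ) S.f)) = 0 :=
    AdjoinRoot.mk_self
  rw [map_sub, map_pow, AdjoinRoot.mk_X, AdjoinRoot.mk_C, sub_eq_zero] at h
  rw [x, aeval_algebraMap_apply, ← RatFunc.algebraMap_X, aeval_algebraMap_apply,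
    aeval_X_left_apply]
  exact h

/-- `(S, β)` is a Belyi pair with passport `{r₀; r₁; r∞}`. -/
def IsBelyiPair (β : S.FunctionField) (r₀ r₁ r_inf : Multiset ℕ) : Prop :=
  IsBelyiMap β ∧ HasPassport β r₀ r₁ r_inf

/-- The curve and the rational function `β(x, y)` have their coefficients in the subfield `L`
of `ℂ`. -/
def IsDefinedOver (β : S.FunctionField) (L : IntermediateField ℚ ℂ) : Prop :=
  (∀ n, S.f.coeff n ∈ L) ∧
  β ∈ Subfield.closure (algebraMap ℂ S.FunctionField '' (L : Set ℂ) ∪ {S.x, S.y})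

end HyperellipticCurve

/-- The pair of the curve `y² = f(x)` and the function `β(x, y)` (given as an expression in the
coordinate functions of a curve of genus `g`) is a Belyi pair of genus `g` with passport
`{r₀; r₁; r∞}`; in particular `f` defines a curve of genus `g`. -/
def IsBelyiPairOfGenus (g : ℕ) (f : ℂ[X]) (β : (S : HyperellipticCurve g) → S.FunctionField)
    (r₀ r₁ r_inf : Multiset ℕ) : Prop :=
  ∃ S : HyperellipticCurve g, S.f = f ∧ S.IsBelyiPair (β S) r₀ r₁ r_inf

/-- The number field `ℚ(ξ)` is quartic, and the pair of the curve `y² = f(x)` and the function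
`β(x, y)` is a Belyi pair of genus `g` with passport `{r₀; r₁; r∞}` which is defined over
`ℚ(ξ)`. -/
def IsQuarticBelyiPairOfGenus (g : ℕ) (ξ : ℂ) (f : ℂ[X])
    (β : (S : HyperellipticCurve g) → S.FunctionField) (r₀ r₁ r_inf : Multiset ℕ) : Prop :=
  Module.finrank ℚ ℚ⟮ξ⟯ = 4 ∧
  ∃ S : HyperellipticCurve g, S.f = f ∧ S.IsBelyiPair (β S) r₀ r₁ r_inf ∧
    S.IsDefinedOver (β S) ℚ⟮ξ⟯

/-! ### Orders of vanishing -/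

/-! Everything rests on computing orders of functions on a double cover `v² = h(u)` of the line.
Write `p + qv` for `p(u) + q(u)v`. At a smooth point `(a, b)` a local coordinate `t` is `u - a` if
`b ≠ 0` and `v` if `b = 0`. Every nonzero function is `t ^ n * e`, where `e` is a quotient of forms
`p + qv` not vanishing at `(a, b)` (`IsDoubleCover.exists_eq_zpow_mul`). The reason is that `(p +
qv)(p - qv) = p² - q²h` is a polynomial in `u`. Hence a valuation ring centred at `(a, b)` is unique
and discrete. One exists by extending the ideal of functions vanishing at `(a, b)`, and every point
of the curve has a centre either in this chart or in the chart `(1/u, v/u^(g+1))`.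

A Belyi pair is then a set of polynomial identities. The function `β` or `1/β` is brought to the
form `p + qv`, if necessary after a change of coordinates, so that its poles lie over `u = ∞`. Their
orders are read off from degrees. The fibre over `c` is read off from the factorisation of the norm
`(p - c)² - q²h` (`IsDoubleCover.hasZeroOrders_linearForm_sub_of_norm`), or directly when its points
are branch points. The derivation `2v d/du` sends `p + qv` to `(2q'h + qh') + 2p'v`. Where this does
not vanish, `p + qv - c` has order at most one (`IsCenteredAt.ord_linearForm_le_one`), so it
suffices that `p + qv` is `0` or `1` wherever it does vanish.

The excluded passport needs an argument of another kind. A curve of genus one has a derivation `D`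
without zeros or poles. If `β` had passport `{3,3; 3,3; 4,2}`, then `(Dβ)³ / (β²(β - 1)²)` would
have a simple pole at the double pole of `β` and no other pole. No function `z` on the curve has a
single simple pole (`HyperellipticCurve.false_of_simple_pole`): subtracting a suitable `αz² + βz`
from `Dz` leaves a constant, so `Dz = α(z - e)(z - e')`. At a zero of `z - e` the right side
vanishes at least as much as `z - e`, the left side to one order less.

The fields `ℚ(ξ)` have degree four by Eisenstein's criterion. -/

namespace CurvePoint

section

variable {k K : Type*} [Field k] [Field K] [Algebra k K] (P : CurvePoint k K)

theorem ord_zero : P.ord 0 = 0 := by simp [ord]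

theorem ord_mul {z w : K} (hz : z ≠ 0) (hw : w ≠ 0) : P.ord (z * w) = P.ord z + P.ord w := by
  have h1 := ((IsDiscreteValuationRing.maximalIdeal P.localRing).valuation K).ne_zero_iff.mpr hz
  have h2 := ((IsDiscreteValuationRing.maximalIdeal P.localRing).valuation K).ne_zero_iff.mpr hw
  rw [ord, map_mul, WithZero.log_mul h1 h2, ord, ord]
  ring

theorem ord_inv (z : K) : P.ord z⁻¹ = -P.ord z := by
  rw [ord, map_inv₀, WithZero.log_inv, ord]

theorem ord_div {z w : K} (hz : z ≠ 0) (hw : w ≠ 0) : P.ord (z / w) = P.ord z - P.ord w := by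
  rw [div_eq_mul_inv, P.ord_mul hz (inv_ne_zero hw), ord_inv]
  ring

theorem ord_pow (z : K) (n : ℕ) : P.ord (z ^ n) = n * P.ord z := by
  rw [ord, map_pow, WithZero.log_pow, ord]
  simp

theorem ord_zpow (z : K) (n : ℤ) : P.ord (z ^ n) = n * P.ord z := by
  rw [ord, map_zpow₀, WithZero.log_zpow, ord]
  simp

theorem ord_neg (z : K) : P.ord (-z) = P.ord z := by
  rw [ord, Valuation.map_neg, ord]

theorem mem_localRing_iff {z : K} :
    z ∈ P.localRing ↔ (IsDiscreteValuationRing.maximalIdeal P.localRing).valuation K z ≤ 1 := by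
  constructor
  · intro h
    exact IsDedekindDomain.HeightOneSpectrum.valuation_le_one _ (⟨z, h⟩ : P.localRing)
  · intro h
    obtain ⟨⟨a, ha⟩, rfl⟩ := IsDiscreteValuationRing.exists_lift_of_le_one h
    exact ha

theorem ord_nonneg_iff {z : K} (hz : z ≠ 0) : 0 ≤ P.ord z ↔ z ∈ P.localRing := by
  have h1 := ((IsDiscreteValuationRing.maximalIdeal P.localRing).valuation K).ne_zero_iff.mpr hz
  rw [mem_localRing_iff, ord, ← WithZero.log_le_log h1 one_ne_zero]
  simp

theorem ord_nonneg {z : K} (h : z ∈ P.localRing) : 0 ≤ P.ord z := by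
  rcases eq_or_ne z 0 with rfl | hz
  · rw [ord_zero]
  · exact (P.ord_nonneg_iff hz).mpr h

theorem mem_of_ord_nonneg {z : K} (h : 0 ≤ P.ord z) : z ∈ P.localRing := by
  rcases eq_or_ne z 0 with rfl | hz
  · exact zero_mem _
  · exact (P.ord_nonneg_iff hz).mp h

theorem ne_zero_of_ord_ne {z : K} (h : P.ord z ≠ 0) : z ≠ 0 := by
  rintro rfl
  exact h P.ord_zero

theorem ord_pos_iff {z : K} (hz : z ≠ 0) : 0 < P.ord z ↔ z ∈ P.localRing.nonunits := by
  rw [ValuationSubring.mem_nonunits_iff_or, ← P.ord_nonneg_iff (inv_ne_zero hz), ord_inv]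
  simp [hz]

theorem mem_nonunits_of_ord_pos {z : K} (h : 0 < P.ord z) : z ∈ P.localRing.nonunits :=
  (P.ord_pos_iff (P.ne_zero_of_ord_ne h.ne')).mp h

theorem ord_algebraMap (c : k) : P.ord (algebraMap k K c) = 0 := by
  rcases eq_or_ne c 0 with rfl | hc
  · rw [map_zero, ord_zero]
  · have h1 := P.ord_nonneg (P.algebraMap_mem c)
    have h2 := P.ord_nonneg (P.algebraMap_mem c⁻¹)
    rw [map_inv₀, ord_inv] at h2
    omega

/-- The bounds are only required of nonzero summands, because `ord 0` is the junk value `0` and not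
`∞`; the same guard recurs in `ord_add_eq_of_lt`. -/
theorem le_ord_add {z w : K} {n : ℤ} (h : z + w ≠ 0) (hz : z ≠ 0 → n ≤ P.ord z)
    (hw : w ≠ 0 → n ≤ P.ord w) : n ≤ P.ord (z + w) := by
  rcases eq_or_ne z 0 with rfl | hz0
  · rw [zero_add] at h ⊢
    exact hw h
  rcases eq_or_ne w 0 with rfl | hw0
  · rw [add_zero] at h ⊢
    exact hz h
  have h1 := ((IsDiscreteValuationRing.maximalIdeal P.localRing).valuation K).ne_zero_iff.mpr h
  have h2 := ((IsDiscreteValuationRing.maximalIdeal P.localRing).valuation K).ne_zero_iff.mpr hz0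
  have h3 := ((IsDiscreteValuationRing.maximalIdeal P.localRing).valuation K).ne_zero_iff.mpr hw0
  have hz := hz hz0
  have hw := hw hw0
  unfold ord at hz hw ⊢
  rcases le_max_iff.mp
    (((IsDiscreteValuationRing.maximalIdeal P.localRing).valuation K).map_add z w) with h' | h'
  · have := (WithZero.log_le_log h1 h2).mpr h'
    omega
  · have := (WithZero.log_le_log h1 h3).mpr h'
    omega

theorem ord_add_eq_of_lt {z w : K} (hz : z ≠ 0) (h : w ≠ 0 → P.ord z < P.ord w) :
    P.ord (z + w) = P.ord z := by
  rcases eq_or_ne w 0 with rfl | hw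
  · rw [add_zero]
  have h := h hw
  have h0 : z + w ≠ 0 := by
    intro h0
    rw [eq_neg_of_add_eq_zero_left h0, ord_neg] at h
    exact h.false
  refine le_antisymm ?_ (P.le_ord_add h0 (fun _ => le_rfl) (fun _ => h.le))
  by_contra! hlt
  have h3 : z + w + -w ≠ 0 := by simpa using hz
  have := P.le_ord_add (n := P.ord z + 1) h3 (fun _ => hlt) (fun _ => by rw [ord_neg]; exact h)
  rw [add_neg_cancel_right] at this
  omega

theorem ord_eq_one_of_irreducible {t : P.localRing} (ht : Irreducible t) :
    P.ord (t : K) = 1 := by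
  have h := (IsDiscreteValuationRing.maximalIdeal P.localRing).valuation_of_algebraMap (K := K) t
  have h2 := (IsDiscreteValuationRing.maximalIdeal P.localRing).intValuation_singleton ht.ne_zero
    ((IsDiscreteValuationRing.irreducible_iff_uniformizer t).mp ht)
  rw [h2] at h
  rw [ord]
  erw [h]
  simp

end

end CurvePoint

/-! ### Double covers of the line -/

section DoubleCover

variable {K : Type*} [Field K] [Algebra ℂ K]

/-- The function `p(u) + q(u) v`. -/
noncomputable def linearForm (u v : K) (p q : ℂ[X]) : K := aeval u p + aeval u q * v

/-- The functions `u` and `v` generate `K` over `ℂ`, and the only relation between them is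
`v² = h(u)`. -/
structure IsDoubleCover (u v : K) (h : ℂ[X]) : Prop where
  sq : v ^ 2 = aeval u h
  transcendental : Transcendental ℂ u
  exists_eq : ∀ z : K, ∃ p q r : ℂ[X], r ≠ 0 ∧ z = linearForm u v p q / aeval u r
  not_square : ∀ p q : ℂ[X], p ^ 2 = q ^ 2 * h → q = 0

/-- `e` is a quotient of two functions of the form `p(u) + q(u) v` that do not vanish
at `(a, b)`. -/
def IsUnitAt (u v : K) (a b : ℂ) (e : K) : Prop :=
  ∃ p q r s : ℂ[X], p.eval a + q.eval a * b ≠ 0 ∧ r.eval a + s.eval a * b ≠ 0 ∧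
    e = linearForm u v p q / linearForm u v r s

theorem linearForm_zero_right (u v : K) (p : ℂ[X]) : linearForm u v p 0 = aeval u p := by
  simp [linearForm]

theorem linearForm_one (u v : K) : linearForm u v 1 0 = 1 := by
  simp [linearForm]

theorem linearForm_sub_algebraMap (u v : K) (p q : ℂ[X]) (c : ℂ) :
    linearForm u v p q - algebraMap ℂ K c = linearForm u v (p - C c) q := by
  simp only [linearForm, map_sub, aeval_C]
  ring

/-- Taylor expansion to first order. The value of the cofactor at `a` being the derivative is what
turns conditions on derivatives into conditions on units. -/
theorem exists_eq_X_sub_C_mul (p : ℂ[X]) (a : ℂ) : ∃ p₁ : ℂ[X], p = C (p.eval a) + (X - C a) * p₁ ∧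
    p₁.eval a = (derivative p).eval a := by
  obtain ⟨p₁, h⟩ := X_sub_C_dvd_sub_C_eval (a := a) (p := p)
  have h1 : p = C (p.eval a) + (X - C a) * p₁ := by rw [← h]; ring
  refine ⟨p₁, h1, ?_⟩
  conv_rhs => rw [h1]
  simp

theorem exists_eq_X_sub_C_pow_mul {p : ℂ[X]} (hp : p ≠ 0) (a : ℂ) :
    ∃ (n : ℕ) (p₁ : ℂ[X]), p = (X - C a) ^ n * p₁ ∧ p₁.eval a ≠ 0 := by
  obtain ⟨p₁, h1, h2⟩ := exists_eq_pow_rootMultiplicity_mul_and_not_dvd p hp a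
  exact ⟨_, p₁, h1, fun h => h2 (dvd_iff_isRoot.mpr h)⟩

namespace IsUnitAt

variable {u v : K} {a b : ℂ}

theorem inv {e : K} (he : IsUnitAt u v a b e) : IsUnitAt u v a b e⁻¹ := by
  obtain ⟨p, q, r, s, h1, h2, rfl⟩ := he
  exact ⟨r, s, p, q, h2, h1, by rw [inv_div]⟩

theorem of_linearForm {p q : ℂ[X]} (h : p.eval a + q.eval a * b ≠ 0) :
    IsUnitAt u v a b (linearForm u v p q) :=
  ⟨p, q, 1, 0, h, by simp, by rw [linearForm_one, div_one]⟩

theorem of_aeval {p : ℂ[X]} (h : p.eval a ≠ 0) : IsUnitAt u v a b (aeval u p) := by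
  rw [← linearForm_zero_right u v]
  exact of_linearForm (by simpa)

theorem one : IsUnitAt u v a b 1 := by
  simpa using of_aeval (u := u) (v := v) (a := a) (b := b) (p := 1) (by simp)

end IsUnitAt

namespace IsDoubleCover

variable {u v : K} {h : ℂ[X]} (H : IsDoubleCover u v h)
include H

theorem aeval_ne_zero {r : ℂ[X]} (hr : r ≠ 0) : aeval u r ≠ 0 := fun h0 =>
  hr (transcendental_iff.mp H.transcendental r h0)

theorem linearForm_mul (p q r s : ℂ[X]) : linearForm u v p q * linearForm u v r s =
    linearForm u v (p * r + q * s * h) (p * s + q * r) := by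
  simp only [linearForm, map_add, map_mul, ← H.sq]
  ring

theorem linearForm_mul_conj (p q : ℂ[X]) : linearForm u v p q * linearForm u v p (-q) =
    aeval u (p ^ 2 - q ^ 2 * h) := by
  simp only [linearForm, map_sub, map_mul, map_neg, map_pow, ← H.sq]
  ring

theorem norm_ne_zero {p q : ℂ[X]} (hpq : p ≠ 0 ∨ q ≠ 0) : p ^ 2 - q ^ 2 * h ≠ 0 := by
  intro h0
  have hq := H.not_square p q (sub_eq_zero.mp h0)
  subst hq
  simp at h0 hpq
  exact hpq h0

theorem linearForm_ne_zero {p q : ℂ[X]} (hpq : p ≠ 0 ∨ q ≠ 0) : linearForm u v p q ≠ 0 := by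
  intro h0
  have h1 := H.linearForm_mul_conj p q
  rw [h0, zero_mul] at h1
  exact H.aeval_ne_zero (H.norm_ne_zero hpq) h1.symm

theorem linearForm_ne_zero_of_eval {p q : ℂ[X]} {a b : ℂ} (hpq : p.eval a + q.eval a * b ≠ 0) :
    linearForm u v p q ≠ 0 := by
  refine H.linearForm_ne_zero ?_
  by_contra! h0
  rw [h0.1, h0.2] at hpq
  simp at hpq

theorem isUnitAt_ne_zero {a b : ℂ} {e : K} (he : IsUnitAt u v a b e) : e ≠ 0 := by
  obtain ⟨p, q, r, s, h1, h2, rfl⟩ := he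
  exact div_ne_zero (H.linearForm_ne_zero_of_eval h1) (H.linearForm_ne_zero_of_eval h2)

variable {a b : ℂ}

theorem isUnitAt_mul (hb : b ^ 2 = h.eval a) {e e' : K} (he : IsUnitAt u v a b e) (he' : IsUnitAt u v a b e') :
    IsUnitAt u v a b (e * e') := by
  obtain ⟨p, q, r, s, h1, h2, rfl⟩ := he
  obtain ⟨p', q', r', s', h1', h2', rfl⟩ := he'
  refine ⟨_, _, _, _, ?_, ?_, by rw [div_mul_div_comm, H.linearForm_mul, H.linearForm_mul]⟩
  · convert mul_ne_zero h1 h1' using 1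
    simp only [eval_add, eval_mul, ← hb]
    ring
  · convert mul_ne_zero h2 h2' using 1
    simp only [eval_add, eval_mul, ← hb]
    ring

theorem isUnitAt_zpow (hb : b ^ 2 = h.eval a) {e : K} (he : IsUnitAt u v a b e) (n : ℤ) :
    IsUnitAt u v a b (e ^ n) := by
  have key : ∀ m : ℕ, IsUnitAt u v a b (e ^ m) := by
    intro m
    induction m with
    | zero => simpa using IsUnitAt.one
    | succ m ih => rw [pow_succ]; exact H.isUnitAt_mul hb ih he
  cases n with
  | ofNat m => simpa using key m
  | negSucc m => rw [zpow_negSucc]; exact (key _).inv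

/-- Since `(v - b)(v + b) = (u - a)h₁(u)`, multiplying `p + qv` by `v + b` exposes the factor `u -
a`. The cofactor takes at `(a, b)` the value displayed in `hD`, which is `2v d/du` of `p + qv`;
dividing by `v + b` is harmless as `2b ≠ 0`. -/
theorem exists_isUnitAt_of_ne_zero (hb : b ^ 2 = h.eval a) (hb0 : b ≠ 0) {p q : ℂ[X]}
    (h0 : p.eval a + q.eval a * b = 0)
    (hD : 2 * (derivative q).eval a * h.eval a + q.eval a * (derivative h).eval a
      + 2 * (derivative p).eval a * b ≠ 0) :
    ∃ e, IsUnitAt u v a b e ∧ linearForm u v p q = (u - algebraMap ℂ K a) * e := by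
  obtain ⟨p₁, hp, hp1⟩ := exists_eq_X_sub_C_mul p a
  obtain ⟨q₁, hq, hq1⟩ := exists_eq_X_sub_C_mul q a
  obtain ⟨h₁, hh, hh1⟩ := exists_eq_X_sub_C_mul h a
  have hvb : v + algebraMap ℂ K b = linearForm u v (C b) 1 := by
    simp [linearForm, add_comm]
  have hv : v + algebraMap ℂ K b ≠ 0 := by
    rw [hvb]
    exact H.linearForm_ne_zero (Or.inr one_ne_zero)
  have hsq := H.sq
  rw [hh, ← hb] at hsq
  have e1 := congrArg (aeval u) hp
  have e2 := congrArg (aeval u) hq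
  simp only [map_add, map_mul, map_sub, aeval_X, aeval_C, map_pow] at hsq e1 e2
  have h0' : algebraMap ℂ K (p.eval a) + algebraMap ℂ K (q.eval a) * algebraMap ℂ K b = 0 := by
    rw [← map_mul, ← map_add, h0, map_zero]
  refine ⟨linearForm u v (C b * p₁ + q₁ * h + C (q.eval a) * h₁) (p₁ + C b * q₁)
    / linearForm u v (C b) 1, ⟨_, _, _, _, ?_, ?_, rfl⟩, ?_⟩
  · simp only [eval_add, eval_mul, eval_C, hp1, hq1, hh1, ← hb]
    rw [← hb] at hD
    intro h2
    apply hD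
    linear_combination h2
  · simp [hb0]
  · rw [← hvb]
    simp only [linearForm, e1, e2, map_add, map_mul, aeval_C, ← H.sq]
    field_simp
    linear_combination (v + algebraMap ℂ K b) * h0'
      + algebraMap ℂ K (eval a q) * hsq

/-- At a branch point `u - a = v² / h₁(u)` with `h₁(a) = h'(a) ≠ 0`, so `(u - a)p₁ + qv` is `v`
times `q + vp₁/h₁`, which has value `q(a)`. -/
theorem exists_isUnitAt_of_eq_zero (hb : h.eval a = 0) (hh : (derivative h).eval a ≠ 0)
    {p q : ℂ[X]} (hp : p.eval a = 0) (hq : q.eval a ≠ 0) :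
    ∃ e, IsUnitAt u v a 0 e ∧ linearForm u v p q = v * e := by
  obtain ⟨p₁, hp, hp1⟩ := exists_eq_X_sub_C_mul p a
  obtain ⟨h₁, hh', hh1⟩ := exists_eq_X_sub_C_mul h a
  have h0 : aeval u h₁ ≠ 0 := by
    refine H.aeval_ne_zero ?_
    rintro rfl
    simp [← hh1] at hh
  have hsq := H.sq
  rw [hh', hb] at hsq
  have e1 := congrArg (aeval u) hp
  rename_i hp0
  rw [hp0] at e1
  simp only [map_mul, map_sub, aeval_X, aeval_C, map_zero, zero_add] at hsq e1
  refine ⟨linearForm u v (q * h₁) p₁ / linearForm u v h₁ 0, ⟨_, _, _, _, ?_, ?_, rfl⟩, ?_⟩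
  · simpa [hh1] using ⟨hq, hh⟩
  · simpa [hh1] using hh
  · simp only [linearForm, e1, map_mul, map_zero, zero_mul, add_zero]
    field_simp
    linear_combination -aeval u p₁ * hsq

theorem exists_isUnitAt_sub_of_eq_zero (hb : h.eval a = 0) (hh : (derivative h).eval a ≠ 0) :
    ∃ e, IsUnitAt u v a 0 e ∧ u - algebraMap ℂ K a = v ^ 2 * e := by
  obtain ⟨h₁, hh', hh1⟩ := exists_eq_X_sub_C_mul h a
  have h0 : h₁.eval a ≠ 0 := by rwa [hh1]
  refine ⟨(aeval u h₁)⁻¹, (IsUnitAt.of_aeval h0).inv, ?_⟩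
  have h1 : aeval u h₁ ≠ 0 := H.aeval_ne_zero (by rintro rfl; simp at h0)
  rw [H.sq, hh', hb]
  simp only [map_mul, map_sub, aeval_X, aeval_C, map_zero, zero_add]
  field_simp

end IsDoubleCover

/-- The point `(a, b)` of the curve `v² = h(u)` is not singular. -/
structure IsSmoothPoint (h : ℂ[X]) (a b : ℂ) : Prop where
  sq : b ^ 2 = h.eval a
  smooth : b ≠ 0 ∨ (derivative h).eval a ≠ 0

open Classical in
/-- A local coordinate of the curve `v² = h(u)` at a smooth point `(a, b)`. -/
noncomputable def localCoord (u v : K) (a b : ℂ) : K := if b = 0 then v else u - algebraMap ℂ K a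

theorem exists_common_factor {p q : ℂ[X]} (hpq : p ≠ 0 ∨ q ≠ 0) (a : ℂ) :
    ∃ (n : ℕ) (p₁ q₁ : ℂ[X]), p = (X - C a) ^ n * p₁ ∧ q = (X - C a) ^ n * q₁ ∧
      (p₁.eval a ≠ 0 ∨ q₁.eval a ≠ 0) := by
  rcases eq_or_ne p 0 with rfl | hp
  · obtain ⟨n, q₁, h1, h2⟩ := exists_eq_X_sub_C_pow_mul (hpq.resolve_left (by simp)) a
    exact ⟨n, 0, q₁, by simp, h1, Or.inr h2⟩
  rcases eq_or_ne q 0 with rfl | hq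
  · obtain ⟨n, q₁, h1, h2⟩ := exists_eq_X_sub_C_pow_mul hp a
    exact ⟨n, q₁, 0, h1, by simp, Or.inl h2⟩
  obtain ⟨n, p₁, h1, h2⟩ := exists_eq_X_sub_C_pow_mul hp a
  obtain ⟨m, q₁, h3, h4⟩ := exists_eq_X_sub_C_pow_mul hq a
  rcases le_total n m with hnm | hnm
  · refine ⟨n, p₁, (X - C a) ^ (m - n) * q₁, h1, ?_, Or.inl h2⟩
    rw [← mul_assoc, ← pow_add, Nat.add_sub_cancel' hnm, ← h3]
  · refine ⟨m, (X - C a) ^ (n - m) * p₁, q₁, ?_, h3, Or.inr h4⟩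
    rw [← mul_assoc, ← pow_add, Nat.add_sub_cancel' hnm, ← h1]

namespace IsDoubleCover

variable {u v : K} {h : ℂ[X]} (H : IsDoubleCover u v h) {a b : ℂ} (hP : IsSmoothPoint h a b)
include H hP

/-- After the common power of `u - a` is removed, not both coefficients vanish at `a`. At a branch
point one of `p₁(a)`, `q₁(a)` decides between order `0` and order `1` in `v`. Elsewhere at most one
of `p₁ + q₁v` and its conjugate vanishes at `(a, b)`, so the whole order of the norm belongs to that
one. -/
theorem exists_linearForm_eq {p q : ℂ[X]} (hpq : p ≠ 0 ∨ q ≠ 0) :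
    ∃ (n : ℕ) (e : K), IsUnitAt u v a b e ∧ linearForm u v p q = localCoord u v a b ^ n * e := by
  obtain ⟨n, p₁, q₁, rfl, rfl, h1⟩ := exists_common_factor hpq a
  have e1 : linearForm u v ((X - C a) ^ n * p₁) ((X - C a) ^ n * q₁) =
      (u - algebraMap ℂ K a) ^ n * linearForm u v p₁ q₁ := by
    simp only [linearForm, map_mul, map_pow, map_sub, aeval_X, aeval_C]
    ring
  rw [e1]
  have hsq := hP.sq
  rcases eq_or_ne b 0 with rfl | hb
  · have h0 : h.eval a = 0 := by rw [← hP.sq]; simp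
    have hh := hP.smooth.resolve_left (by simp)
    obtain ⟨e, he, h2⟩ := H.exists_isUnitAt_sub_of_eq_zero h0 hh
    have h3 : localCoord u v a 0 = v := by simp [localCoord]
    rw [h2, h3]
    have hen := H.isUnitAt_zpow hsq he n
    rw [zpow_natCast] at hen
    rcases eq_or_ne (p₁.eval a) 0 with hp | hp
    · obtain ⟨e', he', h4⟩ := H.exists_isUnitAt_of_eq_zero h0 hh hp (h1.resolve_left (by simpa))
      refine ⟨2 * n + 1, e ^ n * e', H.isUnitAt_mul hsq hen he', ?_⟩
      rw [h4]
      ring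
    · refine ⟨2 * n, e ^ n * linearForm u v p₁ q₁,
        H.isUnitAt_mul hsq hen (IsUnitAt.of_linearForm (by simpa)), by ring⟩
  · have h3 : localCoord u v a b = u - algebraMap ℂ K a := by simp [localCoord, hb]
    rw [h3]
    by_cases h4 : p₁.eval a + q₁.eval a * b = 0
    -- If the conjugate vanished too, then so would `p₁(a)` and `q₁(a)b`, hence both coefficients.
    · have h5 : p₁.eval a + (-q₁).eval a * b ≠ 0 := by
        intro h5
        rw [eval_neg] at h5
        have h6 : p₁.eval a = 0 := by linear_combination (h4 + h5) / 2
        rw [h6] at h4 h1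
        simp [hb] at h4 h1
        exact h1 h4
      have h6 : p₁ ≠ 0 ∨ q₁ ≠ 0 := by
        by_contra! h6
        simp [h6.1, h6.2] at h1
      obtain ⟨m, N, hN, hN'⟩ := exists_eq_X_sub_C_pow_mul (H.norm_ne_zero h6) a
      refine ⟨n + m, linearForm u v N 0 / linearForm u v p₁ (-q₁),
        ⟨_, _, _, _, by simpa, h5, rfl⟩, ?_⟩
      have h7 := H.linearForm_mul_conj p₁ q₁
      have h8 := H.linearForm_ne_zero_of_eval h5
      rw [hN, map_mul, map_pow, map_sub, aeval_X, aeval_C] at h7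
      rw [linearForm_zero_right, eq_div_of_mul_eq h8 h7]
      ring
    · exact ⟨n, _, IsUnitAt.of_linearForm h4, rfl⟩

omit hP in
theorem localCoord_ne_zero : localCoord u v a b ≠ 0 := by
  unfold localCoord
  split_ifs with hb
  · have := H.linearForm_ne_zero (p := 0) (q := 1) (Or.inr one_ne_zero)
    simpa [linearForm] using this
  · have := H.aeval_ne_zero (X_sub_C_ne_zero a)
    simpa using this

theorem exists_eq_zpow_mul {z : K} (hz : z ≠ 0) :
    ∃ (n : ℤ) (e : K), IsUnitAt u v a b e ∧ z = localCoord u v a b ^ n * e := by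
  obtain ⟨p, q, r, hr, rfl⟩ := H.exists_eq z
  have hpq : p ≠ 0 ∨ q ≠ 0 := by
    by_contra! h0
    simp [h0.1, h0.2, linearForm] at hz
  obtain ⟨n, e, he, h1⟩ := H.exists_linearForm_eq hP hpq
  obtain ⟨m, e', he', h2⟩ := H.exists_linearForm_eq hP (q := 0) (Or.inl hr)
  refine ⟨n - m, e * e'⁻¹, H.isUnitAt_mul hP.sq he he'.inv, ?_⟩
  rw [linearForm_zero_right] at h2
  have := H.localCoord_ne_zero (a := a) (b := b)
  have := H.isUnitAt_ne_zero he'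
  rw [h1, h2, zpow_sub₀ (by assumption)]
  simp only [zpow_natCast]
  field_simp

end IsDoubleCover

end DoubleCover

/-! ### Valuation rings centred at a smooth point of a double cover -/

section Centered

variable {K : Type*} [Field K] [Algebra ℂ K]

/-- The valuation ring `V` contains the constants, and `u` and `v` take the values `a` and `b` at
its maximal ideal. -/
structure IsCenteredAt (V : ValuationSubring K) (u v : K) (a b : ℂ) : Prop where
  algebraMap_mem : ∀ c : ℂ, algebraMap ℂ K c ∈ V
  fst : V.valuation (u - algebraMap ℂ K a) < 1
  snd : V.valuation (v - algebraMap ℂ K b) < 1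

theorem ValuationSubring.valuation_algebraMap_eq_one {V : ValuationSubring K}
    (hV : ∀ c : ℂ, algebraMap ℂ K c ∈ V) {c : ℂ} (hc : c ≠ 0) :
    V.valuation (algebraMap ℂ K c) = 1 := by
  have h1 := (V.valuation_le_one_iff _).mpr (hV c)
  have h2 := (V.valuation_le_one_iff _).mpr (hV c⁻¹)
  refine le_antisymm h1 ?_
  have h3 : V.valuation (algebraMap ℂ K c) * V.valuation (algebraMap ℂ K c⁻¹) = 1 := by
    rw [← map_mul, ← map_mul, mul_inv_cancel₀ hc, map_one, map_one]
  calc 1 = _ := h3.symm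
    _ ≤ V.valuation (algebraMap ℂ K c) * 1 := by gcongr
    _ = _ := mul_one _

theorem ValuationSubring.aeval_mem {V : ValuationSubring K}
    (hV : ∀ c : ℂ, algebraMap ℂ K c ∈ V) {u : K} (hu : u ∈ V) (p : ℂ[X]) : aeval u p ∈ V := by
  induction p using Polynomial.induction_on' with
  | add p q hp hq => rw [map_add]; exact V.add_mem _ _ hp hq
  | monomial n c => rw [aeval_monomial]; exact V.mul_mem _ _ (hV c) (pow_mem hu n)

namespace IsCenteredAt

variable {V : ValuationSubring K} {u v : K} {a b : ℂ} (hV : IsCenteredAt V u v a b)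
include hV

theorem fst_mem : u ∈ V := by
  have h := add_mem (V.mem_of_valuation_le_one _ hV.fst.le) (hV.algebraMap_mem a)
  rwa [sub_add_cancel] at h

theorem snd_mem : v ∈ V := by
  have h := add_mem (V.mem_of_valuation_le_one _ hV.snd.le) (hV.algebraMap_mem b)
  rwa [sub_add_cancel] at h

theorem linearForm_mem (p q : ℂ[X]) : linearForm u v p q ∈ V :=
  add_mem (V.aeval_mem hV.algebraMap_mem hV.fst_mem p)
    (mul_mem (V.aeval_mem hV.algebraMap_mem hV.fst_mem q) hV.snd_mem)

theorem valuation_linearForm_sub_lt (p q : ℂ[X]) :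
    V.valuation (linearForm u v p q - algebraMap ℂ K (p.eval a + q.eval a * b)) < 1 := by
  have key : ∀ p : ℂ[X], V.valuation (aeval u p - algebraMap ℂ K (p.eval a)) < 1 := by
    intro p
    obtain ⟨p₁, hp, -⟩ := exists_eq_X_sub_C_mul p a
    have e1 := congrArg (aeval u) hp
    simp only [map_add, map_mul, map_sub, aeval_X, aeval_C] at e1
    rw [e1, add_sub_cancel_left, map_mul]
    exact mul_lt_one_of_lt_of_le hV.fst
      ((V.valuation_le_one_iff _).mpr (V.aeval_mem hV.algebraMap_mem hV.fst_mem p₁))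
  have e2 : linearForm u v p q - algebraMap ℂ K (p.eval a + q.eval a * b) =
      (aeval u p - algebraMap ℂ K (p.eval a)) +
        ((aeval u q - algebraMap ℂ K (q.eval a)) * v +
          algebraMap ℂ K (q.eval a) * (v - algebraMap ℂ K b)) := by
    simp only [linearForm, map_add, map_mul]
    ring
  rw [e2]
  refine Valuation.map_add_lt _ (key p) (Valuation.map_add_lt _ ?_ ?_)
  · rw [map_mul]
    exact mul_lt_one_of_lt_of_le (key q) ((V.valuation_le_one_iff _).mpr hV.snd_mem)
  · rw [map_mul]
    rw [mul_comm]
    exact mul_lt_one_of_lt_of_le hV.snd ((V.valuation_le_one_iff _).mpr (hV.algebraMap_mem _))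

theorem valuation_linearForm_eq_one {p q : ℂ[X]} (h : p.eval a + q.eval a * b ≠ 0) :
    V.valuation (linearForm u v p q) = 1 := by
  have h1 := hV.valuation_linearForm_sub_lt p q
  have h2 := V.valuation_algebraMap_eq_one hV.algebraMap_mem h
  rw [← h2] at h1
  rw [← h2]
  exact Valuation.map_eq_of_sub_lt _ h1

theorem valuation_linearForm_lt_one {p q : ℂ[X]} (h : p.eval a + q.eval a * b = 0) :
    V.valuation (linearForm u v p q) < 1 := by
  simpa [h] using hV.valuation_linearForm_sub_lt p q

theorem valuation_eq_one_of_isUnitAt {e : K} (he : IsUnitAt u v a b e) : V.valuation e = 1 := by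
  obtain ⟨p, q, r, s, h1, h2, rfl⟩ := he
  rw [map_div₀, hV.valuation_linearForm_eq_one h1, hV.valuation_linearForm_eq_one h2, div_one]

theorem valuation_localCoord_lt_one : V.valuation (localCoord u v a b) < 1 := by
  unfold localCoord
  split_ifs with hb
  · subst hb
    simpa using hV.snd
  · exact hV.fst

theorem localCoord_mem : localCoord u v a b ∈ V :=
  V.mem_of_valuation_le_one _ hV.valuation_localCoord_lt_one.le

variable {h : ℂ[X]} (H : IsDoubleCover u v h)
include H

theorem zpow_mul_mem_iff {n : ℤ} {e : K} (he : IsUnitAt u v a b e) :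
    localCoord u v a b ^ n * e ∈ V ↔ 0 ≤ n := by
  rw [← V.valuation_le_one_iff, map_mul, map_zpow₀, hV.valuation_eq_one_of_isUnitAt he, mul_one]
  exact zpow_le_one_iff_right_of_lt_one₀ (zero_lt_iff.mpr ((Valuation.ne_zero_iff _).mpr H.localCoord_ne_zero))
    hV.valuation_localCoord_lt_one

variable (hP : IsSmoothPoint h a b)
include hP

/-- A function `t ^ n * e` lies in such a ring exactly when `0 ≤ n`, a condition that does not
mention the ring. -/
theorem eq_of_isCenteredAt {V' : ValuationSubring K} (hV' : IsCenteredAt V' u v a b) : V = V' := by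
  ext z
  rcases eq_or_ne z 0 with rfl | hz
  · exact ⟨fun _ => zero_mem _, fun _ => zero_mem _⟩
  obtain ⟨n, e, he, rfl⟩ := H.exists_eq_zpow_mul hP hz
  rw [hV.zpow_mul_mem_iff H he, hV'.zpow_mul_mem_iff H he]

theorem exists_associated {z : V} (hz : z ≠ 0) :
    ∃ n : ℕ, Associated ((⟨localCoord u v a b, hV.localCoord_mem⟩ : V) ^ n) z := by
  have hz' : (z : K) ≠ 0 := by simpa using hz
  obtain ⟨n, e, he, h1⟩ := H.exists_eq_zpow_mul hP hz'
  have h2 : 0 ≤ n := (hV.zpow_mul_mem_iff H he).mp (h1 ▸ z.2)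
  lift n to ℕ using h2
  have hev := hV.valuation_eq_one_of_isUnitAt he
  have hu : IsUnit (⟨e, V.mem_of_valuation_le_one _ hev.le⟩ : V) := (V.valuation_eq_one_iff _).mpr hev
  refine ⟨n, hu.unit, Subtype.ext ?_⟩
  simp [h1]

/-- The local coordinate has the largest value below one; this is what makes it irreducible. -/
theorem isUnit_or_valuation_le {z : V} (hz : z ≠ 0) :
    IsUnit z ∨ V.valuation (z : K) ≤ V.valuation (localCoord u v a b) := by
  have hz' : (z : K) ≠ 0 := by simpa using hz
  obtain ⟨n, e, he, h1⟩ := H.exists_eq_zpow_mul hP hz'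
  have h2 : 0 ≤ n := (hV.zpow_mul_mem_iff H he).mp (h1 ▸ z.2)
  have h3 : V.valuation (z : K) = V.valuation (localCoord u v a b) ^ n := by
    rw [h1, map_mul, map_zpow₀, hV.valuation_eq_one_of_isUnitAt he, mul_one]
  lift n to ℕ using h2
  rw [V.valuation_eq_one_iff, h3]
  rcases n with _ | n
  · simp
  · right
    rw [zpow_natCast, pow_succ]
    exact mul_le_of_le_one_left' (pow_le_one' hV.valuation_localCoord_lt_one.le n)

theorem irreducible_localCoord :
    Irreducible (⟨localCoord u v a b, hV.localCoord_mem⟩ : V) := by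
  have ht := hV.valuation_localCoord_lt_one
  refine ⟨fun hu => ht.ne ((V.valuation_eq_one_iff _).mp hu), fun y z hyz => ?_⟩
  have h1 : localCoord u v a b = y * z := congrArg Subtype.val hyz
  have h0 : (y : K) * z ≠ 0 := h1 ▸ H.localCoord_ne_zero
  have hy : y ≠ 0 := by rintro rfl; simp at h0
  have hz : z ≠ 0 := by rintro rfl; simp at h0
  rcases hV.isUnit_or_valuation_le H hP hy with h2 | h2
  · exact Or.inl h2
  rcases hV.isUnit_or_valuation_le H hP hz with h3 | h3
  · exact Or.inr h3
  exfalso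
  have h4 := congrArg V.valuation h1
  rw [map_mul] at h4
  have h5 : 0 < V.valuation (y : K) := zero_lt_iff.mpr ((Valuation.ne_zero_iff _).mpr (by simpa))
  have h6 : V.valuation (y : K) * V.valuation (z : K) < V.valuation (y : K) * 1 :=
    mul_lt_mul_of_pos_left (h3.trans_lt ht) h5
  rw [← h4, mul_one] at h6
  exact (h2.trans_lt h6).false

theorem isDiscreteValuationRing : IsDiscreteValuationRing V :=
  IsDiscreteValuationRing.ofHasUnitMulPowIrreducibleFactorization
    ⟨_, hV.irreducible_localCoord H hP, fun hz => hV.exists_associated H hP hz⟩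

end IsCenteredAt

end Centered

/-! ### Points of double covers -/

section Places

variable {K : Type*} [Field K] [Algebra ℂ K]

namespace IsDoubleCover

variable {u v : K} {h : ℂ[X]}

theorem eq_top_of_mem (H : IsDoubleCover u v h) {L : IntermediateField ℂ K} (hu : u ∈ L)
    (hv : v ∈ L) : L = ⊤ := by
  have key : ∀ p : ℂ[X], aeval u p ∈ L := fun p => by
    have := (aeval (⟨u, hu⟩ : L) p).2
    simpa only [← IntermediateField.aeval_coe] using this
  refine eq_top_iff.mpr fun z _ => ?_
  obtain ⟨p, q, r, -, rfl⟩ := H.exists_eq z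
  exact div_mem (add_mem (key p) (mul_mem (key q) hv)) (key r)

/-- The quotients `(p + qv)/r` form a field, inverses being obtained by rationalising with the
conjugate. It contains `u` and `v`, so generation of `K` as a field already gives the normal form.
-/
theorem of_forall_eq_top (h1 : v ^ 2 = aeval u h) (h2 : Transcendental ℂ u)
    (h3 : ∀ p q : ℂ[X], p ^ 2 = q ^ 2 * h → q = 0)
    (h4 : ∀ L : IntermediateField ℂ K, u ∈ L → v ∈ L → L = ⊤) : IsDoubleCover u v h := by
  have h0 : ∀ r : ℂ[X], r ≠ 0 → aeval u r ≠ 0 := fun r hr h0 => hr (transcendental_iff.mp h2 r h0)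
  let L : IntermediateField ℂ K :=
    { carrier := {z | ∃ p q r : ℂ[X], r ≠ 0 ∧ z = linearForm u v p q / aeval u r}
      mul_mem' := by
        rintro _ _ ⟨p, q, r, hr, rfl⟩ ⟨p', q', r', hr', rfl⟩
        refine ⟨p * p' + q * q' * h, p * q' + q * p', r * r', mul_ne_zero hr hr', ?_⟩
        rw [div_mul_div_comm]
        simp only [linearForm, map_add, map_mul, ← h1]
        ring
      add_mem' := by
        rintro _ _ ⟨p, q, r, hr, rfl⟩ ⟨p', q', r', hr', rfl⟩
        refine ⟨p * r' + r * p', q * r' + r * q', r * r', mul_ne_zero hr hr', ?_⟩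
        rw [div_add_div _ _ (h0 r hr) (h0 r' hr')]
        simp only [linearForm, map_add, map_mul]
        ring
      algebraMap_mem' := fun c => ⟨C c, 0, 1, one_ne_zero, by simp [linearForm]⟩
      inv_mem' := by
        rintro _ ⟨p, q, r, hr, rfl⟩
        -- A vanishing norm forces `p = q = 0`, and then the inverse of `0` is `0`.
        by_cases hN : p ^ 2 - q ^ 2 * h = 0
        · have hq := h3 p q (sub_eq_zero.mp hN)
          subst hq
          have hp : p = 0 := by simpa using hN
          subst hp
          exact ⟨0, 0, 1, one_ne_zero, by simp [linearForm]⟩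
        · refine ⟨r * p, -(r * q), _, hN, ?_⟩
          have e1 : linearForm u v p q * linearForm u v p (-q) = aeval u (p ^ 2 - q ^ 2 * h) := by
            simp only [linearForm, map_sub, map_mul, map_neg, map_pow, ← h1]
            ring
          have e2 : linearForm u v (r * p) (-(r * q)) = aeval u r * linearForm u v p (-q) := by
            simp only [linearForm, map_mul, map_neg]
            ring
          have h5 := h0 _ hN
          rw [← e1] at h5
          rw [← e1, e2, inv_div, mul_div_mul_right _ _ (right_ne_zero_of_mul h5)] }
  refine ⟨h1, h2, fun z => ?_, h3⟩
  have hL := h4 L ⟨X, 0, 1, one_ne_zero, by simp [linearForm]⟩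
    ⟨0, 1, 1, one_ne_zero, by simp [linearForm]⟩
  have : z ∈ L := hL ▸ IntermediateField.mem_top
  exact this

/-- If `q ≠ 0`, then `q² ∣ p²` gives `q ∣ p`, and `h` would be the square of the quotient. -/
theorem not_square_of_squarefree {h : ℂ[X]} (hs : Squarefree h) (hd : 0 < h.natDegree)
    (p q : ℂ[X]) (hpq : p ^ 2 = q ^ 2 * h) : q = 0 := by
  by_contra hq
  obtain ⟨r, rfl⟩ : q ∣ p := (UniqueFactorizationMonoid.pow_dvd_pow_iff_dvd two_ne_zero).mp ⟨h, hpq⟩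
  rw [mul_pow] at hpq
  have hr := mul_left_cancel₀ (pow_ne_zero 2 hq) hpq
  have hu : IsUnit r := hs r ⟨1, by rw [← hr]; ring⟩
  rw [← hr, natDegree_pow, natDegree_eq_zero_of_isUnit hu] at hd
  simp at hd

theorem aeval_inv_reflect (hu : u ≠ 0) {p : ℂ[X]} {n : ℕ} (hn : p.natDegree ≤ n) :
    aeval u⁻¹ (reflect n p) = aeval u p / u ^ n := by
  let := invertibleOfNonzero hu
  have h1 := eval₂_reflect_mul_pow (algebraMap ℂ K) u n p hn
  rw [invOf_eq_inv] at h1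
  rw [eq_div_iff (pow_ne_zero n hu)]
  exact h1

/-- The chart at infinity: `(v / u ^ n)² = h(u) / u ^ (2n)` is the reversed polynomial in `1/u`. -/
theorem inv (H : IsDoubleCover u v h) {n : ℕ} (hn : h.natDegree ≤ 2 * n) :
    IsDoubleCover u⁻¹ (v / u ^ n) (reflect (2 * n) h) := by
  have hu : u ≠ 0 := by simpa using H.aeval_ne_zero X_ne_zero
  have hsq : (v / u ^ n) ^ 2 = aeval u⁻¹ (reflect (2 * n) h) := by
    rw [aeval_inv_reflect hu hn, div_pow, H.sq]
    ring
  have htr : Transcendental ℂ u⁻¹ := fun h0 => H.transcendental (by simpa using h0.inv)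
  refine of_forall_eq_top hsq htr ?_ ?_
  · intro p q hpq
    by_contra hq
    have e1 := congrArg (aeval u⁻¹) hpq
    have key : ∀ p : ℂ[X], ∃ m : ℕ, aeval u⁻¹ p = aeval u (reflect m p) / u ^ m := by
      intro p
      refine ⟨p.natDegree, ?_⟩
      rw [eq_div_iff (pow_ne_zero _ hu)]
      have h1 := aeval_inv_reflect (inv_ne_zero hu) (le_refl p.natDegree)
      rw [inv_inv] at h1
      rw [h1, inv_pow, div_inv_eq_mul]
    obtain ⟨m, hm⟩ := key p
    obtain ⟨k, hk⟩ := key q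
    rw [map_mul, map_pow, map_pow, ← hsq, hm, hk] at e1
    have hq' : aeval u⁻¹ q ≠ 0 := fun h0 => hq (transcendental_iff.mp htr q h0)
    -- With denominators cleared, a relation in `1/u` becomes one in `u`, to which the hypothesis on
    -- `h` applies.
    have e3 : (aeval u (X ^ (k + n) * reflect m p)) ^ 2
        = (aeval u (X ^ m * reflect k q)) ^ 2 * aeval u h := by
      simp only [map_mul, map_pow, aeval_X, ← H.sq]
      field_simp at e1
      rw [pow_add]
      linear_combination e1
    rw [← map_pow, ← map_pow, ← map_mul, ← sub_eq_zero, ← map_sub] at e3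
    have e4 := H.not_square _ _ (sub_eq_zero.mp (transcendental_iff.mp H.transcendental _ e3))
    rw [hk] at hq'
    have e5 : reflect k q = 0 := by simpa using e4
    rw [e5] at hq'
    simp at hq'
  · intro L h1 h2
    have h3 : u ∈ L := by simpa using L.inv_mem h1
    refine H.eq_top_of_mem h3 ?_
    have := L.mul_mem h2 (pow_mem h3 n)
    rwa [div_mul_cancel₀ _ (pow_ne_zero n hu)] at this

variable (H : IsDoubleCover u v h)
include H

/-- The ring of functions `p(u) + q(u) v`. -/
noncomputable def coordinateSubring : Subring K where
  carrier := {z | ∃ p q : ℂ[X], z = linearForm u v p q}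
  mul_mem' := by
    rintro _ _ ⟨p, q, rfl⟩ ⟨r, s, rfl⟩
    exact ⟨_, _, H.linearForm_mul p q r s⟩
  one_mem' := ⟨1, 0, by simp [linearForm]⟩
  add_mem' := by
    rintro _ _ ⟨p, q, rfl⟩ ⟨r, s, rfl⟩
    refine ⟨p + r, q + s, ?_⟩
    simp only [linearForm, map_add]
    ring
  zero_mem' := ⟨0, 0, by simp [linearForm]⟩
  neg_mem' := by
    rintro _ ⟨p, q, rfl⟩
    refine ⟨-p, -q, ?_⟩
    simp only [linearForm, map_neg]
    ring

/-- The ideal of the functions `p(u) + q(u) v` that vanish at `(a, b)`. -/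
noncomputable def vanishingIdeal {a b : ℂ} (hb : b ^ 2 = h.eval a) : Ideal H.coordinateSubring where
  carrier := {z | ∃ p q : ℂ[X], (z : K) = linearForm u v p q ∧ p.eval a + q.eval a * b = 0}
  add_mem' := by
    rintro x y ⟨p, q, hx, hp⟩ ⟨r, s, hy, hr⟩
    refine ⟨p + r, q + s, ?_, ?_⟩
    · rw [Subring.coe_add, hx, hy]
      simp only [linearForm, map_add]
      ring
    · simp only [eval_add]
      linear_combination hp + hr
  zero_mem' := ⟨0, 0, by simp [linearForm], by simp⟩
  smul_mem' := by
    rintro ⟨_, r, s, rfl⟩ y ⟨p, q, hy, hp⟩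
    refine ⟨r * p + s * q * h, r * q + s * p, ?_, ?_⟩
    · rw [smul_eq_mul, Subring.coe_mul, hy, H.linearForm_mul]
    · simp only [eval_add, eval_mul, ← hb]
      linear_combination (r.eval a + s.eval a * b) * hp

theorem vanishingIdeal_ne_top {a b : ℂ} (hb : b ^ 2 = h.eval a) : H.vanishingIdeal hb ≠ ⊤ := by
  intro h0
  obtain ⟨p, q, h1, h2⟩ : (1 : H.coordinateSubring) ∈ H.vanishingIdeal hb := by
    rw [h0]; exact Submodule.mem_top
  have h3 : linearForm u v (p - 1) q = 0 := by
    have : linearForm u v (p - 1) q = linearForm u v p q - 1 := by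
      simp only [linearForm, map_sub, map_one]
      ring
    rw [this, ← h1]
    simp
  have h4 : ¬ (p - 1 ≠ 0 ∨ q ≠ 0) := fun h => H.linearForm_ne_zero h h3
  push Not at h4
  rw [sub_eq_zero.mp h4.1, h4.2] at h2
  simp at h2

/-- The vanishing ideal of `(a, b)` is proper, and every proper ideal of a subring of a field lies
in the nonunits of some valuation ring containing the subring. -/
theorem exists_isCenteredAt {a b : ℂ} (hb : b ^ 2 = h.eval a) :
    ∃ V : ValuationSubring K, IsCenteredAt V u v a b := by
  obtain ⟨V, h1, h2⟩ :=
    Ideal.image_subset_nonunits_valuationSubring _ (H.vanishingIdeal_ne_top hb)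
  have key : ∀ p q : ℂ[X], p.eval a + q.eval a * b = 0 → V.valuation (linearForm u v p q) < 1 :=
    fun p q hpq => V.mem_nonunits_iff.mp (h2 ⟨⟨_, p, q, rfl⟩, ⟨p, q, rfl, hpq⟩, rfl⟩)
  refine ⟨V, fun c => h1 ⟨C c, 0, by simp [linearForm]⟩, ?_, ?_⟩
  · have e1 : linearForm u v (X - C a) 0 = u - algebraMap ℂ K a := by
      simp only [linearForm, map_sub, aeval_X, aeval_C, map_zero, zero_mul, add_zero]
    exact e1 ▸ key (X - C a) 0 (by simp)
  · have e1 : linearForm u v (-C b) 1 = v - algebraMap ℂ K b := by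
      simp only [linearForm, map_neg, aeval_C, map_one]
      ring
    exact e1 ▸ key (-C b) 1 (by simp)

theorem exists_isCenteredAt_of_mem {V : ValuationSubring K}
    (hc : ∀ c : ℂ, algebraMap ℂ K c ∈ V) (hu : u ∈ V) (hV : V ≠ ⊤) :
    ∃ a b : ℂ, b ^ 2 = h.eval a ∧ IsCenteredAt V u v a b := by
  -- `v` is integral over `ℂ[u]`.
  have hv : v ∈ V := by
    rw [← V.valuation_le_one_iff, ← pow_le_one_iff two_ne_zero, ← map_pow, V.valuation_le_one_iff,
      H.sq]
    exact V.aeval_mem hc hu h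
  -- Otherwise every `u - a` is a unit of `V`. As polynomials over `ℂ` split, so is every nonzero
  -- polynomial in `u`, and `V` is the whole field.
  obtain ⟨a, ha⟩ : ∃ a : ℂ, V.valuation (u - algebraMap ℂ K a) < 1 := by
    by_contra! h0
    have h1 : ∀ r : ℂ[X], r ≠ 0 → V.valuation (aeval u r) = 1 := by
      intro r hr
      have hs := IsAlgClosed.splits r
      rw [hs.eq_prod_roots, map_mul, map_mul, aeval_C, map_multiset_prod, map_multiset_prod,
        V.valuation_algebraMap_eq_one hc (leadingCoeff_ne_zero.mpr hr), one_mul,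
        Multiset.map_map, Multiset.map_map]
      refine Multiset.prod_eq_one fun x hx => ?_
      obtain ⟨a, -, rfl⟩ := Multiset.mem_map.mp hx
      simp only [Function.comp_apply, map_sub, aeval_X, aeval_C]
      exact le_antisymm ((V.valuation_le_one_iff _).mpr (sub_mem hu (hc a))) (h0 a)
    refine hV (eq_top_iff.mpr fun z _ => ?_)
    obtain ⟨p, q, r, hr, rfl⟩ := H.exists_eq z
    rw [← V.valuation_le_one_iff, map_div₀, h1 r hr, div_one, V.valuation_le_one_iff]
    exact add_mem (V.aeval_mem hc hu p) (mul_mem (V.aeval_mem hc hu q) hv)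
  obtain ⟨b, hb⟩ := IsAlgClosed.exists_pow_nat_eq (h.eval a) two_pos
  -- `(v - b)(v + b)` is divisible by `u - a`, so one of the two factors is a nonunit; which one
  -- decides the sign of the second coordinate.
  have h1 : V.valuation ((v - algebraMap ℂ K b) * (v - algebraMap ℂ K (-b))) < 1 := by
    obtain ⟨h₁, hh, -⟩ := exists_eq_X_sub_C_mul h a
    have e1 := congrArg (aeval u) hh
    rw [← H.sq, ← hb] at e1
    simp only [map_add, map_mul, map_sub, aeval_X, aeval_C, map_pow] at e1
    have e2 : (v - algebraMap ℂ K b) * (v - algebraMap ℂ K (-b)) =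
        (u - algebraMap ℂ K a) * aeval u h₁ := by
      rw [map_neg]
      linear_combination e1
    rw [e2, map_mul]
    exact mul_lt_one_of_lt_of_le ha ((V.valuation_le_one_iff _).mpr (V.aeval_mem hc hu h₁))
  by_cases h2 : V.valuation (v - algebraMap ℂ K b) < 1
  · exact ⟨a, b, hb, hc, ha, h2⟩
  · refine ⟨a, -b, by rw [neg_sq, hb], hc, ha, ?_⟩
    by_contra h3
    rw [map_mul] at h1
    exact absurd h1 (not_lt.mpr (one_le_mul (not_lt.mp h2) (not_lt.mp h3)))

end IsDoubleCover

end Places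

/-! ### Points of the curve and their centres; orders at a given centre. -/

section Points

variable {K : Type*} [Field K] [Algebra ℂ K]

theorem CurvePoint.ext_localRing {P Q : CurvePoint ℂ K} (h : P.localRing = Q.localRing) :
    P = Q := by
  cases P; cases Q; simpa using h

/-- A uniformiser has order one, so its inverse is not in the local ring. -/
theorem CurvePoint.localRing_ne_top (P : CurvePoint ℂ K) : P.localRing ≠ ⊤ := by
  intro h
  have key : ∀ z : K, z ∈ P.localRing := fun z => by rw [h]; exact ValuationSubring.mem_top z
  obtain ⟨t, ht⟩ := IsDiscreteValuationRing.exists_irreducible P.localRing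
  have h0 : (t : K) ≠ 0 := by simpa using ht.ne_zero
  have h1 := P.ord_eq_one_of_irreducible ht
  have h2 := P.ord_nonneg (key (t : K)⁻¹)
  rw [P.ord_inv] at h2
  omega

theorem CurvePoint.ord_pos_of_valuation_lt_one (P : CurvePoint ℂ K) {z : K} (hz : z ≠ 0)
    (h : P.localRing.valuation z < 1) : 0 < P.ord z :=
  (P.ord_pos_iff hz).mpr (P.localRing.mem_nonunits_iff.mpr h)

theorem CurvePoint.valuation_lt_one_of_ord_pos (P : CurvePoint ℂ K) {z : K} (h : 0 < P.ord z) :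
    P.localRing.valuation z < 1 :=
  P.localRing.mem_nonunits_iff.mp (P.mem_nonunits_of_ord_pos h)

theorem CurvePoint.ord_eq_zero_of_valuation_eq_one (P : CurvePoint ℂ K) {z : K}
    (h : P.localRing.valuation z = 1) : P.ord z = 0 := by
  have h1 := P.ord_nonneg (P.localRing.mem_of_valuation_le_one z h.le)
  by_contra h2
  exact (P.valuation_lt_one_of_ord_pos (lt_of_le_of_ne h1 (Ne.symm h2))).ne h

theorem IsCenteredAt.eq_and_eq {V : ValuationSubring K} {u v : K} {a b a' b' : ℂ}
    (h : IsCenteredAt V u v a b) (h' : IsCenteredAt V u v a' b') : a = a' ∧ b = b' := by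
  have key : ∀ (w : K) (c c' : ℂ), V.valuation (w - algebraMap ℂ K c) < 1 →
      V.valuation (w - algebraMap ℂ K c') < 1 → c = c' := by
    intro w c c' h1 h2
    by_contra hc
    have h3 := V.valuation_algebraMap_eq_one h.algebraMap_mem (sub_ne_zero.mpr hc)
    have h4 := Valuation.map_sub_lt V.valuation h2 h1
    rw [sub_sub_sub_cancel_left, ← map_sub, h3] at h4
    exact h4.false
  exact ⟨key u a a' h.fst h'.fst, key v b b' h.snd h'.snd⟩

/-- A singular point has `b = 0` and `a` a multiple root of `h`. -/
theorem IsSmoothPoint.of_squarefree {h : ℂ[X]} (hs : Squarefree h) {a b : ℂ}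
    (hb : b ^ 2 = h.eval a) : IsSmoothPoint h a b := by
  refine ⟨hb, ?_⟩
  by_contra! h0
  obtain ⟨h₁, hh, h1⟩ := exists_eq_X_sub_C_mul h a
  rw [← hb, h0.1] at hh
  obtain ⟨h₂, hh2, -⟩ := exists_eq_X_sub_C_mul h₁ a
  rw [h1, h0.2] at hh2
  have h3 : IsUnit (X - C a) := hs _ ⟨h₂, by rw [hh, hh2]; simp; ring⟩
  exact not_isUnit_X_sub_C a h3

namespace IsDoubleCover

variable {u v : K} {h : ℂ[X]} (H : IsDoubleCover u v h) {a b : ℂ}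
include H

theorem exists_point (hP : IsSmoothPoint h a b) :
    ∃ P : CurvePoint ℂ K, IsCenteredAt P.localRing u v a b := by
  obtain ⟨V, hV⟩ := H.exists_isCenteredAt hP.sq
  exact ⟨⟨V, hV.algebraMap_mem, hV.isDiscreteValuationRing H hP⟩, hV⟩

theorem exists_isCenteredAt_of_ord {P : CurvePoint ℂ K} (hu : 0 ≤ P.ord u) :
    ∃ a b : ℂ, b ^ 2 = h.eval a ∧ IsCenteredAt P.localRing u v a b :=
  H.exists_isCenteredAt_of_mem P.algebraMap_mem (P.mem_of_ord_nonneg hu) P.localRing_ne_top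

theorem exists_isCenteredAt_of_ord_neg {P : CurvePoint ℂ K} (hu : P.ord u < 0) {n : ℕ}
    (hn : h.natDegree ≤ 2 * n) :
    ∃ b : ℂ, b ^ 2 = h.coeff (2 * n) ∧ IsCenteredAt P.localRing u⁻¹ (v / u ^ n) 0 b := by
  have hu' : 0 < P.ord u⁻¹ := by rw [P.ord_inv]; omega
  obtain ⟨a, b, hb, hV⟩ := (H.inv hn).exists_isCenteredAt_of_ord hu'.le
  have hV' : IsCenteredAt P.localRing u⁻¹ (v / u ^ n) 0 b :=
    ⟨hV.algebraMap_mem, by simpa using P.valuation_lt_one_of_ord_pos hu', hV.snd⟩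
  -- `1/u` vanishes at `P`, so the first coordinate of the centre is `0`.
  obtain rfl := (hV.eq_and_eq hV').1
  refine ⟨b, ?_, hV⟩
  rw [hb, ← coeff_zero_eq_eval_zero, coeff_reflect, revAt_zero]

theorem fst_ne_zero : u ≠ 0 := by
  simpa using H.aeval_ne_zero X_ne_zero

theorem snd_ne_zero : v ≠ 0 := by
  have := H.linearForm_ne_zero (p := 0) (q := 1) (Or.inr one_ne_zero)
  simpa [linearForm] using this

theorem sub_algebraMap_ne_zero (a : ℂ) : u - algebraMap ℂ K a ≠ 0 := by
  simpa using H.aeval_ne_zero (X_sub_C_ne_zero a)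

end IsDoubleCover

namespace IsCenteredAt

variable {P : CurvePoint ℂ K} {u v : K} {h : ℂ[X]} {a b : ℂ}
  (hC : IsCenteredAt P.localRing u v a b)

include hC

theorem ord_eq_zero {e : K} (he : IsUnitAt u v a b e) : P.ord e = 0 :=
  P.ord_eq_zero_of_valuation_eq_one (hC.valuation_eq_one_of_isUnitAt he)

theorem ord_linearForm_nonneg (p q : ℂ[X]) : 0 ≤ P.ord (linearForm u v p q) :=
  P.ord_nonneg (hC.linearForm_mem p q)

theorem ord_linearForm_eq_zero {p q : ℂ[X]} (h0 : p.eval a + q.eval a * b ≠ 0) :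
    P.ord (linearForm u v p q) = 0 :=
  hC.ord_eq_zero (IsUnitAt.of_linearForm h0)

theorem eval_eq_zero_of_ord_pos {p q : ℂ[X]} (h0 : 0 < P.ord (linearForm u v p q)) :
    p.eval a + q.eval a * b = 0 := by
  by_contra h1
  exact h0.ne' (hC.ord_linearForm_eq_zero h1)

variable (H : IsDoubleCover u v h)
include H

variable (hP : IsSmoothPoint h a b)
include hP

theorem ord_localCoord : P.ord (localCoord u v a b) = 1 :=
  P.ord_eq_one_of_irreducible (hC.irreducible_localCoord H hP)

theorem point_eq {Q : CurvePoint ℂ K} (hQ : IsCenteredAt Q.localRing u v a b) : P = Q :=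
  CurvePoint.ext_localRing (hC.eq_of_isCenteredAt H hP hQ)

theorem ord_sub_eq_one (hb : b ≠ 0) : P.ord (u - algebraMap ℂ K a) = 1 := by
  have := hC.ord_localCoord H hP
  rwa [localCoord, if_neg hb] at this

theorem ord_snd_eq_one (hb : b = 0) : P.ord v = 1 := by
  have := hC.ord_localCoord H hP
  rwa [localCoord, if_pos hb] at this

theorem ord_sub_eq_two (hb : b = 0) : P.ord (u - algebraMap ℂ K a) = 2 := by
  have hv := hC.ord_snd_eq_one H hP hb
  subst hb
  obtain ⟨e, he, h1⟩ := H.exists_isUnitAt_sub_of_eq_zero (by rw [← hP.sq]; simp)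
    (hP.smooth.resolve_left (by simp))
  rw [h1, P.ord_mul (pow_ne_zero 2 H.snd_ne_zero) (H.isUnitAt_ne_zero he), P.ord_pow,
    hC.ord_eq_zero he, hv]
  norm_num

omit hP in
theorem ord_aeval_X_sub_C_pow_mul {M : ℂ[X]} (k : ℕ) (hM : M.eval a ≠ 0) :
    P.ord (aeval u ((X - C a) ^ k * M)) = k * P.ord (u - algebraMap ℂ K a) := by
  have h0 : aeval u M ≠ 0 := H.aeval_ne_zero (by rintro rfl; simp at hM)
  rw [map_mul, map_pow, map_sub, aeval_X, aeval_C,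
    P.ord_mul (pow_ne_zero k (H.sub_algebraMap_ne_zero a)) h0, P.ord_pow,
    hC.ord_eq_zero (IsUnitAt.of_aeval hM), add_zero]

/-- The order of a function that does not vanish at the conjugate point, in terms of its norm. -/
theorem ord_linearForm_of_norm {p q M : ℂ[X]} {k : ℕ} (hb : b ≠ 0)
    (hN : p ^ 2 - q ^ 2 * h = (X - C a) ^ k * M) (hM : M.eval a ≠ 0)
    (hconj : p.eval a - q.eval a * b ≠ 0) : P.ord (linearForm u v p q) = k := by
  have h1 := H.linearForm_mul_conj p q
  have h2 : p.eval a + (-q).eval a * b ≠ 0 := by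
    rw [eval_neg]
    intro h3
    exact hconj (by linear_combination h3)
  have h3 : p ≠ 0 ∨ q ≠ 0 := by
    by_contra! h0
    simp [h0.1, h0.2] at hconj
  have h4 := congrArg P.ord h1
  rw [hN, hC.ord_aeval_X_sub_C_pow_mul H k hM, hC.ord_sub_eq_one H hP hb, mul_one,
    P.ord_mul (H.linearForm_ne_zero h3) (H.linearForm_ne_zero_of_eval h2),
    hC.ord_linearForm_eq_zero h2, add_zero] at h4
  exact h4

/-- The quantity in `hD` is `2v d/du` of `p + qv` evaluated at `(a, b)`. When `b = 0` it reduces to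
`q(a)h'(a)`, so a zero of `p + qv` there is simple with coordinate `v`. Constants added to `p` do
not affect it, so one condition controls all fibres. -/
theorem ord_linearForm_le_one {p q : ℂ[X]}
    (hD : 2 * (derivative q).eval a * h.eval a + q.eval a * (derivative h).eval a
      + 2 * (derivative p).eval a * b ≠ 0) : P.ord (linearForm u v p q) ≤ 1 := by
  by_cases h0 : p.eval a + q.eval a * b = 0
  · rcases eq_or_ne b 0 with rfl | hb
    · have h1 : h.eval a = 0 := by rw [← hP.sq]; simp
      rw [h1] at hD
      have hq : q.eval a ≠ 0 := by
        intro hq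
        simp [hq] at hD
      obtain ⟨e, he, h2⟩ := H.exists_isUnitAt_of_eq_zero h1 (hP.smooth.resolve_left (by simp))
        (p := p) (q := q) (by simpa using h0) hq
      rw [h2, P.ord_mul H.snd_ne_zero (H.isUnitAt_ne_zero he), hC.ord_eq_zero he,
        hC.ord_snd_eq_one H hP rfl, add_zero]
    · obtain ⟨e, he, h2⟩ := H.exists_isUnitAt_of_ne_zero hP.sq hb h0 hD
      rw [h2, P.ord_mul (H.sub_algebraMap_ne_zero a) (H.isUnitAt_ne_zero he), hC.ord_eq_zero he,
        hC.ord_sub_eq_one H hP hb, add_zero]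
  · rw [hC.ord_linearForm_eq_zero h0]
    exact zero_le_one

end IsCenteredAt

end Points

/-! ### The coordinates `x`, `y` present the function field as a double cover. -/

namespace HyperellipticCurve

variable {g : ℕ} (S : HyperellipticCurve g)

theorem algebraMap_algebraMap_eq_aeval (r : ℂ[X]) :
    algebraMap (RatFunc ℂ) S.FunctionField (algebraMap ℂ[X] (RatFunc ℂ) r) = aeval S.x r := by
  rw [x, aeval_algebraMap_apply, ← RatFunc.algebraMap_X, aeval_algebraMap_apply, aeval_X_left_apply]

theorem natDegree_pos : 0 < S.f.natDegree := by
  rcases S.natDegree_eq with h | h <;> omega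

theorem isDoubleCover : IsDoubleCover S.x S.y S.f := by
  refine IsDoubleCover.of_forall_eq_top S.y_sq ?_
    (IsDoubleCover.not_square_of_squarefree S.squarefree S.natDegree_pos) ?_
  · rw [transcendental_iff]
    intro r hr
    rw [← algebraMap_algebraMap_eq_aeval, map_eq_zero] at hr
    exact (map_eq_zero_iff _ (IsFractionRing.injective ℂ[X] (RatFunc ℂ))).mp hr
  · intro L hx hy
    have key : ∀ p : ℂ[X], aeval S.x p ∈ L := fun p => by
      have := (aeval (⟨S.x, hx⟩ : L) p).2
      simpa only [← IntermediateField.aeval_coe] using this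
    have key2 : ∀ r : RatFunc ℂ, algebraMap (RatFunc ℂ) S.FunctionField r ∈ L := by
      intro r
      obtain ⟨p, q, -, rfl⟩ := IsFractionRing.div_surjective (A := ℂ[X]) r
      rw [map_div₀, algebraMap_algebraMap_eq_aeval, algebraMap_algebraMap_eq_aeval]
      exact div_mem (key p) (key q)
    refine eq_top_iff.mpr fun z _ => ?_
    refine AdjoinRoot.induction_on S.equation z fun p => ?_
    induction p using Polynomial.induction_on' with
    | add p q hp hq => rw [map_add]; exact L.add_mem hp hq
    | monomial n c =>
      rw [← C_mul_X_pow_eq_monomial, map_mul, map_pow, AdjoinRoot.mk_X, AdjoinRoot.mk_C]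
      exact L.mul_mem (key2 c) (pow_mem hy n)

end HyperellipticCurve

/-! ### Fibres, passports and the Belyi condition. -/

section Passports

variable {K : Type*} [Field K] [Algebra ℂ K]

theorem hasZeroOrders_of_points {ι : Type*} [Fintype ι] {z : K} {P : ι → CurvePoint ℂ K}
    {k : ι → ℕ} (hinj : Function.Injective P) (hk : ∀ i, 0 < k i) (hord : ∀ i, (P i).ord z = k i)
    (hcomp : ∀ Q : CurvePoint ℂ K, 0 < Q.ord z → ∃ i, Q = P i) :
    HasZeroOrders z (Finset.univ.val.map k) := by
  refine ⟨Finset.univ.map ⟨P, hinj⟩, fun Q => ?_, ?_⟩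
  · rw [Finset.mem_map]
    constructor
    · rintro ⟨i, -, rfl⟩
      rw [Function.Embedding.coeFn_mk, hord]
      exact_mod_cast hk i
    · intro hQ
      obtain ⟨i, rfl⟩ := hcomp Q hQ
      exact ⟨i, Finset.mem_univ i, rfl⟩
  · rw [Finset.map_val, Multiset.map_map]
    simp only [Multiset.bind_def, Multiset.pure_def, Multiset.bind_singleton, Multiset.map_map]
    exact Multiset.map_congr rfl fun i _ => hord i

theorem HasZeroOrders.congr {z w : K} {r : Multiset ℕ} (h : HasZeroOrders z r)
    (hzw : ∀ P : CurvePoint ℂ K, 0 < P.ord z ∨ 0 < P.ord w → P.ord z = P.ord w) :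
    HasZeroOrders w r := by
  obtain ⟨s, hs, hr⟩ := h
  refine ⟨s, fun P => ?_, ?_⟩
  · rw [hs]
    constructor
    · intro h1
      rwa [← hzw P (Or.inl h1)]
    · intro h1
      rwa [hzw P (Or.inr h1)]
  · rw [← hr]
    exact Multiset.map_congr rfl fun P hP => (hzw P (Or.inl ((hs P).mp hP))).symm

/-- A nonzero function and its value at a point where it is a unit. -/
theorem CurvePoint.ord_sub_pos_of (P : CurvePoint ℂ K) {z : K} {c d : ℂ} (hcd : c ≠ d)
    (h : 0 < P.ord (z - algebraMap ℂ K c)) : P.ord (z - algebraMap ℂ K d) = 0 := by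
  have e : z - algebraMap ℂ K d = algebraMap ℂ K (c - d) + (z - algebraMap ℂ K c) := by
    rw [map_sub]; ring
  rw [e, P.ord_add_eq_of_lt, P.ord_algebraMap]
  · simpa [sub_eq_zero] using hcd
  · intro _
    rwa [P.ord_algebraMap]

theorem CurvePoint.ord_sub_algebraMap_of_neg (P : CurvePoint ℂ K) {z : K} (c : ℂ)
    (h : P.ord z < 0) : P.ord (z - algebraMap ℂ K c) = P.ord z := by
  rw [sub_eq_add_neg, P.ord_add_eq_of_lt (P.ne_zero_of_ord_ne h.ne)]
  intro _
  rwa [← map_neg, P.ord_algebraMap]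

theorem CurvePoint.ord_sub_one_pos_of (P : CurvePoint ℂ K) {z : K} (h : 0 < P.ord (z - 1)) :
    P.ord z = 0 := by
  have := P.ord_sub_pos_of (z := z) (c := 1) (d := 0) one_ne_zero (by simpa using h)
  simpa using this

/-- `1/β - c = -c(β - 1/c)/β`, and `β` has order zero wherever `1/β` takes the value `c ≠ 0`.
Inversion permutes `0, 1, ∞`. -/
theorem IsBelyiMap.inv {β : K} (h : IsBelyiMap β) : IsBelyiMap β⁻¹ := by
  have hβ : β ≠ 0 := by simpa using h.1 0
  refine ⟨fun c hc => h.1 c⁻¹ (by rw [map_inv₀, ← hc, inv_inv]), fun c hc0 hc1 P => ?_⟩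
  have hne : β - algebraMap ℂ K c⁻¹ ≠ 0 := sub_ne_zero.mpr (h.1 c⁻¹)
  have hc : algebraMap ℂ K c ≠ 0 := by simpa using hc0
  have e : β⁻¹ - algebraMap ℂ K c =
      algebraMap ℂ K (-c) * (β - algebraMap ℂ K c⁻¹) / β := by
    rw [map_inv₀, map_neg]
    field_simp
    ring
  have e2 := P.ord_div (mul_ne_zero (a := algebraMap ℂ K (-c)) (by simpa using hc0) hne) hβ
  rw [P.ord_mul (by simpa using hc0) hne, P.ord_algebraMap, zero_add, ← e] at e2
  have h3 := h.2 c⁻¹ (inv_ne_zero hc0) (by simpa using hc1) P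
  by_contra! h4
  have h5 := P.ord_sub_pos_of (z := β⁻¹) (c := c) (d := 0) hc0 (by omega)
  rw [map_zero, sub_zero, P.ord_inv] at h5
  omega

/-- The fibre over `1` is unchanged: `1/β - 1 = -(β - 1)/β`, and `β` is a unit at every zero of
either side. -/
theorem HasPassport.inv {β : K} {r₀ r₁ r₂ : Multiset ℕ} (hβ : β ≠ 0)
    (h : HasPassport β r₀ r₁ r₂) : HasPassport β⁻¹ r₂ r₁ r₀ := by
  refine ⟨h.2.2, h.2.1.congr fun P hP => ?_, by rw [inv_inv]; exact h.1⟩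
  rcases eq_or_ne (β - 1) 0 with h0 | h0
  · rw [sub_eq_zero] at h0
    rw [h0, inv_one]
  have e : β⁻¹ - 1 = -(β - 1) / β := by
    field_simp
    ring
  have e2 := P.ord_div (neg_ne_zero.mpr h0) hβ
  rw [← e, P.ord_neg] at e2
  rcases hP with h1 | h1
  · have := P.ord_sub_one_pos_of h1
    omega
  · have := P.ord_sub_one_pos_of h1
    rw [P.ord_inv] at this
    omega

namespace IsDoubleCover

variable {u v : K} {h : ℂ[X]} (H : IsDoubleCover u v h)
include H

theorem hasZeroOrders {z : K} {n : ℕ} {A B : Fin n → ℂ} {k : Fin n → ℕ}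
    (hP : ∀ i, IsSmoothPoint h (A i) (B i)) (hinj : Function.Injective fun i => (A i, B i))
    (hk : ∀ i, 0 < k i)
    (hord : ∀ i, ∀ P : CurvePoint ℂ K, IsCenteredAt P.localRing u v (A i) (B i) → P.ord z = k i)
    (hcomp : ∀ P : CurvePoint ℂ K, 0 < P.ord z → ∃ i, IsCenteredAt P.localRing u v (A i) (B i)) :
    HasZeroOrders z (Finset.univ.val.map k) := by
  choose P hC using fun i => H.exists_point (hP i)
  refine hasZeroOrders_of_points (P := P) (fun i j hij => hinj ?_) hk
    (fun i => hord i (P i) (hC i)) fun Q hQ => ?_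
  · have h1 := (hC i).eq_and_eq (hij ▸ hC j)
    exact Prod.ext h1.1 h1.2
  · obtain ⟨i, hi⟩ := hcomp Q hQ
    exact ⟨i, hi.point_eq H (hP i) (hC i)⟩

end IsDoubleCover

namespace IsDoubleCover

variable {u v : K} {h : ℂ[X]} (H : IsDoubleCover u v h) (hs : Squarefree h) {p q : ℂ[X]}
include H hs

/-- By `hD` the critical values at finite points are `0` and `1`; at a point where the derivative
does not vanish each `β - c` has order at most one. -/
theorem isBelyiMap_linearForm (hconst : ∀ c : ℂ, linearForm u v p q ≠ algebraMap ℂ K c)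
    (hinf : ∀ P : CurvePoint ℂ K, P.ord u < 0 → ∀ c : ℂ, c ≠ 0 → c ≠ 1 →
      P.ord (linearForm u v p q - algebraMap ℂ K c) ≤ 1)
    (hD : ∀ a b : ℂ, b ^ 2 = h.eval a → 2 * (derivative q).eval a * h.eval a
      + q.eval a * (derivative h).eval a + 2 * (derivative p).eval a * b = 0 →
      p.eval a + q.eval a * b = 0 ∨ p.eval a + q.eval a * b = 1) :
    IsBelyiMap (linearForm u v p q) := by
  refine ⟨hconst, fun c hc0 hc1 P => ?_⟩
  rcases lt_or_ge (P.ord u) 0 with hP | hP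
  · exact hinf P hP c hc0 hc1
  · obtain ⟨a, b, hb, hC⟩ := H.exists_isCenteredAt_of_ord hP
    by_contra! h1
    rw [linearForm_sub_algebraMap] at h1
    have h2 := hC.eval_eq_zero_of_ord_pos (p := p - C c) (q := q) (by omega)
    by_cases h3 : 2 * (derivative q).eval a * h.eval a + q.eval a * (derivative h).eval a
        + 2 * (derivative p).eval a * b = 0
    · rw [eval_sub, eval_C] at h2
      have h4 : p.eval a + q.eval a * b = c := by linear_combination h2
      rcases hD a b hb h3 with h5 | h5
      · exact hc0 (h4.symm.trans h5)
      · exact hc1 (h4.symm.trans h5)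
    · have h4 := hC.ord_linearForm_le_one H (.of_squarefree hs hb)
        (p := p - C c) (q := q) (by simpa using h3)
      omega

theorem hasZeroOrders_linearForm_sub (c : ℂ) (hinf : ∀ P : CurvePoint ℂ K, P.ord u < 0 →
      P.ord (linearForm u v p q - algebraMap ℂ K c) ≤ 0)
    {n : ℕ} {A B : Fin n → ℂ} {k : Fin n → ℕ}
    (hP : ∀ i, B i ^ 2 = h.eval (A i)) (hinj : Function.Injective fun i => (A i, B i))
    (hk : ∀ i, 0 < k i)
    (hord : ∀ i, ∀ P : CurvePoint ℂ K, IsCenteredAt P.localRing u v (A i) (B i) →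
      P.ord (linearForm u v (p - C c) q) = k i)
    (hcomp : ∀ a b : ℂ, b ^ 2 = h.eval a → p.eval a + q.eval a * b = c →
      ∃ i, a = A i ∧ b = B i) :
    HasZeroOrders (linearForm u v p q - algebraMap ℂ K c) (Finset.univ.val.map k) := by
  rw [linearForm_sub_algebraMap]
  refine H.hasZeroOrders (fun i => .of_squarefree hs (hP i)) hinj hk hord fun P hP' => ?_
  have hu : 0 ≤ P.ord u := by
    by_contra! h0
    rw [← linearForm_sub_algebraMap] at hP'
    exact (hinf P h0).not_gt hP'
  obtain ⟨a, b, hb, hC⟩ := H.exists_isCenteredAt_of_ord hu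
  have h2 := hC.eval_eq_zero_of_ord_pos hP'
  rw [eval_sub, eval_C] at h2
  obtain ⟨i, rfl, rfl⟩ := hcomp a b hb (by linear_combination h2)
  exact ⟨i, hC⟩

/-- The fibre of `p(u) + q(u) v` over `c`, from the factorisation of the norm of
`p(u) + q(u) v - c`. -/
theorem hasZeroOrders_linearForm_sub_of_norm (c d : ℂ) (hinf : ∀ P : CurvePoint ℂ K, P.ord u < 0 →
      P.ord (linearForm u v p q - algebraMap ℂ K c) ≤ 0)
    (hd : d ≠ 0) {n : ℕ} {A : Fin n → ℂ}
    {k : Fin n → ℕ} (hinj : Function.Injective A) (hk : ∀ i, 0 < k i)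
    (hN : ∀ t : ℂ, (p.eval t - c) ^ 2 - q.eval t ^ 2 * h.eval t = d * ∏ i, (t - A i) ^ k i)
    (hp : ∀ i, p.eval (A i) ≠ c) (hq : ∀ i, q.eval (A i) ≠ 0) :
    HasZeroOrders (linearForm u v p q - algebraMap ℂ K c) (Finset.univ.val.map k) := by
  have hroot : ∀ i, (p.eval (A i) - c) ^ 2 = q.eval (A i) ^ 2 * h.eval (A i) := by
    intro i
    rw [← sub_eq_zero, hN, Finset.prod_eq_zero (Finset.mem_univ i), mul_zero]
    rw [sub_self, zero_pow (hk i).ne']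
  -- Since `q(A i) ≠ 0`, the equation `p + qv = c` determines the point above `A i`. Since `p(A i) ≠
  -- c`, the conjugate function does not vanish there, so the full multiplicity `k i` of the norm is
  -- the order.
  refine H.hasZeroOrders_linearForm_sub hs c hinf (A := A)
    (B := fun i => -(p.eval (A i) - c) / q.eval (A i)) ?_ (fun i j hij => hinj (Prod.ext_iff.mp hij).1)
    hk ?_ ?_
  · intro i
    have := hq i
    field_simp
    linear_combination hroot i
  · intro i P hC
    have hqi := hq i
    have hpi := sub_ne_zero.mpr (hp i)
    refine hC.ord_linearForm_of_norm H (.of_squarefree hs ?_) ?_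
      (M := C d * ∏ j ∈ Finset.univ.erase i, (X - C (A j)) ^ k j) ?_ ?_ ?_
    · field_simp
      linear_combination hroot i
    · exact div_ne_zero (neg_ne_zero.mpr hpi) hqi
    · refine Polynomial.funext fun t => ?_
      have h1 := hN t
      rw [← Finset.mul_prod_erase _ _ (Finset.mem_univ i)] at h1
      simp only [eval_sub, eval_mul, eval_pow, eval_C, eval_X, eval_prod]
      rw [h1]
      ring
    · rw [eval_mul, eval_C, eval_prod]
      refine mul_ne_zero hd (Finset.prod_ne_zero_iff.mpr fun j hj => ?_)
      rw [eval_pow, eval_sub, eval_X, eval_C]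
      refine pow_ne_zero _ (sub_ne_zero.mpr fun hij => ?_)
      exact (Finset.mem_erase.mp hj).1 (hinj hij).symm
    · rw [eval_sub, eval_C, mul_div_cancel₀ _ hqi]
      intro h0
      exact hpi (by linear_combination h0 / 2)
  · intro a b hb hab
    have h1 : d * ∏ i, (a - A i) ^ k i = 0 := by
      rw [← hN, ← hb]
      linear_combination (p.eval a - c - q.eval a * b) * hab
    obtain ⟨i, -, hi⟩ := Finset.prod_eq_zero_iff.mp ((mul_eq_zero.mp h1).resolve_left hd)
    have hai : a = A i := sub_eq_zero.mp (pow_eq_zero_iff (hk i).ne' |>.mp hi)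
    subst hai
    refine ⟨i, rfl, ?_⟩
    rw [eq_div_iff (hq i)]
    linear_combination hab

end IsDoubleCover

/-- The functions `u` and `v` generate `K` over `ℂ`, and the only relation between them is
`v² = h(u)`, where `h` has degree `2g + 1` and no multiple roots. -/
structure IsOddCover (g : ℕ) (u v : K) (h : ℂ[X]) : Prop extends IsDoubleCover u v h where
  squarefree : Squarefree h
  natDegree_eq : h.natDegree = 2 * g + 1

/-! ### Odd degree: a single point at infinity, which is a branch point. -/

namespace IsOddCover

variable {g : ℕ} {u v : K} {h : ℂ[X]} (H : IsOddCover g u v h)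
include H

theorem isDoubleCover_inv : IsDoubleCover u⁻¹ (v / u ^ (g + 1)) (reflect (2 * (g + 1)) h) :=
  H.toIsDoubleCover.inv (by have := H.natDegree_eq; omega)

/-- The degree of `h` is one less than `2(g + 1)`, so the reversed polynomial has a simple root at
`0`, with derivative the leading coefficient of `h`. -/
theorem isSmoothPoint_inv : IsSmoothPoint (reflect (2 * (g + 1)) h) 0 0 := by
  have hd := H.natDegree_eq
  constructor
  · rw [← coeff_zero_eq_eval_zero, coeff_reflect, revAt_zero,
      coeff_eq_zero_of_natDegree_lt (by omega)]
    simp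
  · right
    rw [← coeff_zero_eq_eval_zero, coeff_derivative, coeff_reflect, revAt_le (by omega)]
    have : 2 * (g + 1) - (0 + 1) = h.natDegree := by omega
    rw [this, coeff_natDegree]
    have : h ≠ 0 := by rintro rfl; simp at hd
    simpa using this

theorem isSmoothPoint {a b : ℂ} (hb : b ^ 2 = h.eval a) : IsSmoothPoint h a b :=
  .of_squarefree H.squarefree hb

theorem isCenteredAt_inv {P : CurvePoint ℂ K} (hP : P.ord u < 0) :
    IsCenteredAt P.localRing u⁻¹ (v / u ^ (g + 1)) 0 0 := by
  have hd := H.natDegree_eq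
  obtain ⟨b, hb, hC⟩ := H.exists_isCenteredAt_of_ord_neg hP (n := g + 1) (by omega)
  rw [coeff_eq_zero_of_natDegree_lt (by omega)] at hb
  rwa [pow_eq_zero_iff two_ne_zero |>.mp hb] at hC

theorem exists_ord_neg : ∃ P : CurvePoint ℂ K, P.ord u < 0 := by
  obtain ⟨P, hC⟩ := H.isDoubleCover_inv.exists_point H.isSmoothPoint_inv
  refine ⟨P, ?_⟩
  have h1 := hC.ord_sub_eq_two H.isDoubleCover_inv H.isSmoothPoint_inv rfl
  rw [map_zero, sub_zero, P.ord_inv] at h1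
  omega

theorem eq_of_ord_neg {P Q : CurvePoint ℂ K} (hP : P.ord u < 0) (hQ : Q.ord u < 0) : P = Q :=
  (H.isCenteredAt_inv hP).point_eq H.isDoubleCover_inv H.isSmoothPoint_inv (H.isCenteredAt_inv hQ)

variable {P : CurvePoint ℂ K} (hP : P.ord u < 0)
include hP

theorem ord_fst : P.ord u = -2 := by
  have h1 := (H.isCenteredAt_inv hP).ord_sub_eq_two H.isDoubleCover_inv H.isSmoothPoint_inv rfl
  rw [map_zero, sub_zero, P.ord_inv] at h1
  omega

theorem ord_snd : P.ord v = -(2 * g + 1) := by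
  have h1 := (H.isCenteredAt_inv hP).ord_snd_eq_one H.isDoubleCover_inv H.isSmoothPoint_inv rfl
  rw [P.ord_div H.snd_ne_zero (pow_ne_zero _ H.fst_ne_zero), P.ord_pow, H.ord_fst hP] at h1
  push_cast at h1
  linarith

theorem ord_aeval {p : ℂ[X]} (hp : p ≠ 0) : P.ord (aeval u p) = -2 * p.natDegree := by
  have h1 := IsDoubleCover.aeval_inv_reflect H.fst_ne_zero (le_refl p.natDegree)
  have h2 : (reflect p.natDegree p).eval 0 ≠ 0 := by
    rw [← coeff_zero_eq_eval_zero, coeff_reflect, revAt_zero, coeff_natDegree]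
    simpa using hp
  have h3 := (H.isCenteredAt_inv hP).ord_eq_zero (IsUnitAt.of_aeval h2)
  rw [h1, P.ord_div (H.aeval_ne_zero hp) (pow_ne_zero _ H.fst_ne_zero), P.ord_pow,
    H.ord_fst hP] at h3
  linarith

/-- At infinity polynomials in `u` have even order, while `q(u)v` has odd order. The two summands
therefore never cancel, and the larger pole wins. -/
theorem ord_linearForm_of_lt {p q : ℂ[X]} (hp : p ≠ 0)
    (hpq : q ≠ 0 → 2 * q.natDegree + 2 * g + 1 < 2 * p.natDegree) :
    P.ord (linearForm u v p q) = -2 * p.natDegree := by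
  rw [linearForm, P.ord_add_eq_of_lt (H.aeval_ne_zero hp), H.ord_aeval hP hp]
  intro h0
  have hq : q ≠ 0 := by rintro rfl; simp at h0
  rw [P.ord_mul (H.aeval_ne_zero hq) H.snd_ne_zero, H.ord_aeval hP hp, H.ord_aeval hP hq,
    H.ord_snd hP]
  have := hpq hq
  omega

theorem ord_linearForm_of_gt {p q : ℂ[X]} (hq : q ≠ 0)
    (hpq : p ≠ 0 → 2 * p.natDegree < 2 * q.natDegree + 2 * g + 1) :
    P.ord (linearForm u v p q) = -(2 * q.natDegree + 2 * g + 1) := by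
  have h1 : P.ord (aeval u q * v) = -(2 * q.natDegree + 2 * g + 1) := by
    rw [P.ord_mul (H.aeval_ne_zero hq) H.snd_ne_zero, H.ord_aeval hP hq, H.ord_snd hP]
    ring
  rw [linearForm, add_comm, P.ord_add_eq_of_lt (mul_ne_zero (H.aeval_ne_zero hq) H.snd_ne_zero), h1]
  intro h0
  have hp : p ≠ 0 := by rintro rfl; simp at h0
  rw [h1, H.ord_aeval hP hp]
  have := hpq hp
  omega

end IsOddCover

namespace IsOddCover

variable {g : ℕ} {u v : K} {h : ℂ[X]} (H : IsOddCover g u v h) {p q : ℂ[X]} {m : ℕ} (hm : 0 < m)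
  (hinf : ∀ P : CurvePoint ℂ K, P.ord u < 0 → P.ord (linearForm u v p q) = -m)
include H hm hinf

theorem isBelyiMap_linearForm
    (hD : ∀ a b : ℂ, b ^ 2 = h.eval a → 2 * (derivative q).eval a * h.eval a
      + q.eval a * (derivative h).eval a + 2 * (derivative p).eval a * b = 0 →
      p.eval a + q.eval a * b = 0 ∨ p.eval a + q.eval a * b = 1) :
    IsBelyiMap (linearForm u v p q) := by
  refine H.toIsDoubleCover.isBelyiMap_linearForm H.squarefree (fun c hc => ?_)
    (fun P hP c _ _ => ?_) hD
  · obtain ⟨P, hP⟩ := H.exists_ord_neg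
    have h1 := hinf P hP
    rw [hc, P.ord_algebraMap] at h1
    omega
  · have h1 := hinf P hP
    rw [P.ord_sub_algebraMap_of_neg c (by omega)]
    omega

/-- `p + qv` is regular at finite points, so its only pole is the unique point at infinity. -/
theorem hasZeroOrders_inv_linearForm : HasZeroOrders (linearForm u v p q)⁻¹ {m} := by
  obtain ⟨P, hP⟩ := H.exists_ord_neg
  refine hasZeroOrders_of_points (ι := Unit) (P := fun _ => P) (k := fun _ => m)
    (fun _ _ _ => rfl) (fun _ => hm) (fun _ => by rw [P.ord_inv, hinf P hP, neg_neg]) ?_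
  intro Q hQ
  refine ⟨(), H.eq_of_ord_neg ?_ hP⟩
  by_contra! h0
  obtain ⟨a, b, -, hC⟩ := H.exists_isCenteredAt_of_ord h0
  rw [Q.ord_inv] at hQ
  have := hC.ord_linearForm_nonneg p q
  omega

omit H in
theorem ord_linearForm_sub_of_ord_neg (c : ℂ) (P : CurvePoint ℂ K) (hP : P.ord u < 0) :
    P.ord (linearForm u v p q - algebraMap ℂ K c) ≤ 0 := by
  rw [P.ord_sub_algebraMap_of_neg c (by rw [hinf P hP]; omega), hinf P hP]
  omega

theorem hasZeroOrders_linearForm_sub (c : ℂ) {n : ℕ} {A B : Fin n → ℂ} {k : Fin n → ℕ}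
    (hP : ∀ i, B i ^ 2 = h.eval (A i)) (hinj : Function.Injective fun i => (A i, B i))
    (hk : ∀ i, 0 < k i)
    (hord : ∀ i, ∀ P : CurvePoint ℂ K, IsCenteredAt P.localRing u v (A i) (B i) →
      P.ord (linearForm u v (p - C c) q) = k i)
    (hcomp : ∀ a b : ℂ, b ^ 2 = h.eval a → p.eval a + q.eval a * b = c →
      ∃ i, a = A i ∧ b = B i) :
    HasZeroOrders (linearForm u v p q - algebraMap ℂ K c) (Finset.univ.val.map k) :=
  H.toIsDoubleCover.hasZeroOrders_linearForm_sub H.squarefree c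
    (ord_linearForm_sub_of_ord_neg hm hinf c) hP hinj hk hord hcomp

theorem hasZeroOrders_linearForm_sub_of_norm (c d : ℂ) (hd : d ≠ 0) {n : ℕ} {A : Fin n → ℂ}
    {k : Fin n → ℕ} (hinj : Function.Injective A) (hk : ∀ i, 0 < k i)
    (hN : ∀ t : ℂ, (p.eval t - c) ^ 2 - q.eval t ^ 2 * h.eval t = d * ∏ i, (t - A i) ^ k i)
    (hp : ∀ i, p.eval (A i) ≠ c) (hq : ∀ i, q.eval (A i) ≠ 0) :
    HasZeroOrders (linearForm u v p q - algebraMap ℂ K c) (Finset.univ.val.map k) :=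
  H.toIsDoubleCover.hasZeroOrders_linearForm_sub_of_norm H.squarefree c d
    (ord_linearForm_sub_of_ord_neg hm hinf c) hd hinj hk hN hp hq

end IsOddCover

end Passports

/-! ### Residues, and valuations obtained from transcendental functions. -/

section Regular

variable {K : Type*} [Field K] [Algebra ℂ K]

theorem transcendental_of_forall_ne {z : K} (hz : ∀ c : ℂ, z ≠ algebraMap ℂ K c) :
    Transcendental ℂ z := by
  intro h
  have h1 := minpoly.irreducible h.isIntegral
  obtain ⟨c, hc⟩ := minpoly.mem_range_of_degree_eq_one ℂ z
    (IsAlgClosed.degree_eq_one_of_irreducible ℂ h1)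
  exact hz c hc.symm

/-- In the polynomial ring `ℂ[w]` the element `w` is not a unit, so it generates a proper ideal,
which extends to a valuation ring. -/
theorem exists_valuationSubring_of_transcendental {w : K} (hw : Transcendental ℂ w) :
    ∃ V : ValuationSubring K, (∀ c : ℂ, algebraMap ℂ K c ∈ V) ∧ V.valuation w < 1 := by
  let A : Subring K := (aeval (R := ℂ) w).range.toSubring
  let w' : A := ⟨w, X, aeval_X w⟩
  have hI : Ideal.span {w'} ≠ ⊤ := by
    rw [Ne, Ideal.span_singleton_eq_top]
    intro hu
    obtain ⟨⟨_, p, rfl⟩, hp⟩ := hu.exists_right_inv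
    have h1 : aeval w (X * p - 1) = 0 := by
      have h2 : w * aeval w p = 1 := congrArg Subtype.val hp
      simp [h2]
    have h3 := congrArg (eval 0) (transcendental_iff.mp hw _ h1)
    simp at h3
  obtain ⟨V, h1, h2⟩ := Ideal.image_subset_nonunits_valuationSubring _ hI
  refine ⟨V, fun c => h1 ⟨C c, aeval_C w c⟩, ?_⟩
  exact V.mem_nonunits_iff.mp (h2 ⟨w', Ideal.subset_span rfl, rfl⟩)

namespace IsCenteredAt

variable {P : CurvePoint ℂ K} {u v : K} {h : ℂ[X]} {a b : ℂ}
  (hC : IsCenteredAt P.localRing u v a b) (H : IsDoubleCover u v h) (hP : IsSmoothPoint h a b)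

include hC H hP

theorem exists_isUnitAt {z : K} (hz : z ≠ 0) :
    ∃ e, IsUnitAt u v a b e ∧ z = localCoord u v a b ^ P.ord z * e := by
  obtain ⟨n, e, he, h1⟩ := H.exists_eq_zpow_mul hP hz
  have h2 := congrArg P.ord h1
  rw [P.ord_mul (zpow_ne_zero _ H.localCoord_ne_zero) (H.isUnitAt_ne_zero he), P.ord_zpow,
    hC.ord_localCoord H hP, hC.ord_eq_zero he, mul_one, add_zero] at h2
  exact ⟨e, he, by rw [h2]; exact h1⟩

theorem exists_residue {z : K} (hz : z ∈ P.localRing) :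
    ∃ c : ℂ, P.localRing.valuation (z - algebraMap ℂ K c) < 1 := by
  rcases eq_or_ne z 0 with rfl | hz0
  · exact ⟨0, by simp⟩
  rcases (P.ord_nonneg hz).eq_or_lt' with h0 | h0
  · obtain ⟨e, ⟨p, q, r, s, -, h2, rfl⟩, he⟩ := hC.exists_isUnitAt H hP hz0
    rw [h0, zpow_zero, one_mul] at he
    refine ⟨(p.eval a + q.eval a * b) / (r.eval a + s.eval a * b), ?_⟩
    set c := (p.eval a + q.eval a * b) / (r.eval a + s.eval a * b) with hc
    have h3 := H.linearForm_ne_zero_of_eval h2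
    have e1 : z - algebraMap ℂ K c =
        linearForm u v (p - C c * r) (q - C c * s) / linearForm u v r s := by
      rw [he]
      field_simp
      simp only [linearForm, map_sub, map_mul, aeval_C]
      ring
    rw [e1, map_div₀, hC.valuation_linearForm_eq_one h2, div_one]
    refine hC.valuation_linearForm_lt_one ?_
    simp only [eval_sub, eval_mul, eval_C]
    rw [eq_div_iff h2] at hc
    linear_combination -hc
  · exact ⟨0, by simpa using P.valuation_lt_one_of_ord_pos h0⟩

end IsCenteredAt

/-! ### Derivations -/

section Derivation

variable {u v : K} {h : ℂ[X]} (H : IsDoubleCover u v h) (D : Derivation ℂ K K) {κ : ℂ}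
  (hD : D u = algebraMap ℂ K (2 * κ) * v)
include H hD

/-- Differentiate `v² = h(u)`. The scalar `κ` lets the same computation serve two charts: in genus
one it is `1` at finite points and `-1` at infinity. -/
theorem IsDoubleCover.derivation_snd : D v = algebraMap ℂ K κ * aeval u (derivative h) := by
  have h1 := congrArg D H.sq
  rw [Derivation.map_aeval, Derivation.leibniz_pow, hD] at h1
  have h2 := H.snd_ne_zero
  have := charZero_of_injective_algebraMap (algebraMap ℂ K).injective
  have h3 : (2 : K) ≠ 0 := two_ne_zero
  simp only [smul_eq_mul, nsmul_eq_mul, map_mul, map_ofNat, Nat.add_one_sub_one, pow_one,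
    Nat.cast_ofNat] at h1
  refine mul_left_cancel₀ (mul_ne_zero h3 h2) ?_
  linear_combination h1

theorem IsDoubleCover.derivation_linearForm (p q : ℂ[X]) : D (linearForm u v p q) =
    algebraMap ℂ K κ * linearForm u v (2 * derivative q * h + q * derivative h)
      (2 * derivative p) := by
  have h1 := H.derivation_snd D hD
  have h2 := H.sq
  simp only [linearForm, map_add, Derivation.leibniz, Derivation.map_aeval, h1, hD, smul_eq_mul,
    map_mul, map_ofNat, ← h2]
  ring

variable {a b : ℂ} (hP : IsSmoothPoint h a b) {P : CurvePoint ℂ K}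
  (hC : IsCenteredAt P.localRing u v a b)
include hC

theorem IsCenteredAt.derivation_mem_of_isUnitAt {e : K} (he : IsUnitAt u v a b e) :
    D e ∈ P.localRing := by
  obtain ⟨p, q, r, s, h1, h2, rfl⟩ := he
  have h3 : (linearForm u v r s)⁻¹ ∈ P.localRing := P.mem_of_ord_nonneg (by
    rw [P.ord_inv, hC.ord_linearForm_eq_zero h2, neg_zero])
  rw [Derivation.leibniz_div, H.derivation_linearForm D hD, H.derivation_linearForm D hD]
  simp only [smul_eq_mul]
  exact mul_mem (pow_mem h3 2) (sub_mem
    (mul_mem (hC.linearForm_mem _ _) (mul_mem (hC.algebraMap_mem _) (hC.linearForm_mem _ _)))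
    (mul_mem (hC.linearForm_mem _ _) (mul_mem (hC.algebraMap_mem _) (hC.linearForm_mem _ _))))

include hP

/-- `D` sends the coordinate `u - a` to `2κv`, nonzero where `b ≠ 0`, and the coordinate `v` to
`κh'(u)`, nonzero at a branch point. So `D` has neither a zero nor a pole at a smooth point. -/
theorem IsCenteredAt.derivation_localCoord_ne_zero_and_ord (hκ : κ ≠ 0) :
    D (localCoord u v a b) ≠ 0 ∧ P.ord (D (localCoord u v a b)) = 0 := by
  have key : ∃ p q : ℂ[X], p.eval a + q.eval a * b ≠ 0 ∧
      D (localCoord u v a b) = algebraMap ℂ K κ * linearForm u v p q := by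
    unfold localCoord
    split_ifs with hb
    · refine ⟨derivative h, 0, ?_, ?_⟩
      · simpa using hP.smooth.resolve_left (by simpa using hb)
      · rw [H.derivation_snd D hD, linearForm_zero_right]
    · refine ⟨0, C 2, by simpa using hb, ?_⟩
      rw [map_sub, hD, Derivation.map_algebraMap]
      simp [linearForm]
      ring
  obtain ⟨p, q, h1, h2⟩ := key
  have h3 : algebraMap ℂ K κ ≠ 0 := by simpa using hκ
  have h4 := H.linearForm_ne_zero_of_eval h1
  rw [h2]
  exact ⟨mul_ne_zero h3 h4, by
    rw [P.ord_mul h3 h4, P.ord_algebraMap, hC.ord_linearForm_eq_zero h1, add_zero]⟩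

theorem IsCenteredAt.derivation_mem {z : K} (hz : z ∈ P.localRing) : D z ∈ P.localRing := by
  rcases eq_or_ne z 0 with rfl | hz0
  · rw [map_zero]; exact zero_mem _
  obtain ⟨e, he, h1⟩ := hC.exists_isUnitAt H hP hz0
  have h0 := P.ord_nonneg hz
  have h2 := hC.derivation_mem_of_isUnitAt H D hD he
  have h3 : D (localCoord u v a b) ∈ P.localRing := by
    unfold localCoord
    split_ifs with hb
    · rw [H.derivation_snd D hD, ← linearForm_zero_right u v]
      exact mul_mem (hC.algebraMap_mem _) (hC.linearForm_mem _ _)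
    · rw [map_sub, hD, Derivation.map_algebraMap, sub_zero]
      exact mul_mem (hC.algebraMap_mem _) hC.snd_mem
  have h4 : e ∈ P.localRing := P.mem_of_ord_nonneg (hC.ord_eq_zero he).ge
  generalize P.ord z = n at h0 h1
  lift n to ℕ using h0
  rw [h1, zpow_natCast, Derivation.leibniz, Derivation.leibniz_pow]
  simp only [smul_eq_mul, nsmul_eq_mul]
  exact add_mem (mul_mem (pow_mem hC.localCoord_mem _) h2) (mul_mem h4 (mul_mem
    (natCast_mem _ _) (mul_mem (pow_mem hC.localCoord_mem _) h3)))

/-- In `D(t ^ n * e) = n t^(n-1) (Dt) e + t ^ n De` the first term has order exactly `n - 1`,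
because `n ≠ 0` in characteristic zero, and the second has order at least `n` unless it is zero. -/
theorem IsCenteredAt.derivation_ord (hκ : κ ≠ 0) {z : K} (hz : P.ord z ≠ 0) :
    D z ≠ 0 ∧ P.ord (D z) = P.ord z - 1 := by
  have hz0 := P.ne_zero_of_ord_ne hz
  obtain ⟨e, he, h1⟩ := hC.exists_isUnitAt H hP hz0
  obtain ⟨h2, h3⟩ := hC.derivation_localCoord_ne_zero_and_ord H D hD hP hκ
  have h4 := P.ord_nonneg (hC.derivation_mem_of_isUnitAt H D hD he)
  have ht := H.localCoord_ne_zero (a := a) (b := b)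
  have hto := hC.ord_localCoord H hP
  have he0 := H.isUnitAt_ne_zero he
  have heo := hC.ord_eq_zero he
  generalize P.ord z = n at hz h1
  have hn : ((n : ℂ)) ≠ 0 := by exact_mod_cast hz
  have hn' : algebraMap ℂ K n ≠ 0 := (map_ne_zero (algebraMap ℂ K)).mpr hn
  set t := localCoord u v a b
  have h5 : D z = algebraMap ℂ K n * (t ^ (n - 1) * (D t * e)) + t ^ n * D e := by
    rw [h1, Derivation.leibniz, Derivation.leibniz_zpow]
    simp only [smul_eq_mul, zsmul_eq_mul, map_intCast]
    ring
  have h6 : algebraMap ℂ K n * (t ^ (n - 1) * (D t * e)) ≠ 0 :=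
    mul_ne_zero hn' (mul_ne_zero (zpow_ne_zero _ ht) (mul_ne_zero h2 he0))
  have h7 : P.ord (algebraMap ℂ K n * (t ^ (n - 1) * (D t * e))) = n - 1 := by
    rw [P.ord_mul hn' (right_ne_zero_of_mul h6), P.ord_algebraMap,
      P.ord_mul (zpow_ne_zero _ ht) (mul_ne_zero h2 he0), P.ord_mul h2 he0, P.ord_zpow, hto, h3, heo]
    ring
  have h8 : P.ord (D z) = n - 1 := by
    rw [h5, P.ord_add_eq_of_lt h6, h7]
    intro h9
    rw [h7, P.ord_mul (zpow_ne_zero _ ht) (right_ne_zero_of_mul h9), P.ord_zpow, hto]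
    omega
  refine ⟨fun h9 => ?_, h8⟩
  rw [h5, add_eq_zero_iff_eq_neg] at h9
  have h10 := congrArg P.ord h9
  have h11 : t ^ n * D e ≠ 0 := by
    intro h12
    rw [h12, neg_zero] at h9
    exact h6 h9
  rw [P.ord_neg, h7, P.ord_mul (zpow_ne_zero _ ht) (right_ne_zero_of_mul h11), P.ord_zpow, hto] at h10
  omega

end Derivation

end Regular

/-! ### Functions on curves of genus one -/

namespace HyperellipticCurve

section General

variable {g : ℕ} (S : HyperellipticCurve g)

theorem natDegree_le : S.f.natDegree ≤ 2 * (g + 1) := by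
  rcases S.natDegree_eq with h | h <;> omega

theorem isSmoothPoint_reflect {b : ℂ} (hb : b ^ 2 = S.f.coeff (2 * (g + 1))) :
    IsSmoothPoint (reflect (2 * (g + 1)) S.f) 0 b := by
  have hf : S.f ≠ 0 := S.squarefree.ne_zero
  constructor
  · rw [hb, ← coeff_zero_eq_eval_zero, coeff_reflect, revAt_zero]
  · rcases S.natDegree_eq with h | h
    · right
      rw [← coeff_zero_eq_eval_zero, coeff_derivative, coeff_reflect, revAt_le (by omega)]
      have : 2 * (g + 1) - (0 + 1) = S.f.natDegree := by omega
      rw [this, coeff_natDegree]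
      simpa using hf
    · left
      rintro rfl
      have : 2 * (g + 1) = S.f.natDegree := by omega
      rw [this, coeff_natDegree] at hb
      exact hf (leadingCoeff_eq_zero.mp (by rw [← hb]; simp))

/-- Every point lies in one of the two affine charts. -/
theorem exists_chart (P : CurvePoint ℂ S.FunctionField) :
    (∃ a b : ℂ, IsSmoothPoint S.f a b ∧ IsCenteredAt P.localRing S.x S.y a b) ∨
    (P.ord S.x < 0 ∧ ∃ b : ℂ, IsSmoothPoint (reflect (2 * (g + 1)) S.f) 0 b ∧
      IsCenteredAt P.localRing S.x⁻¹ (S.y / S.x ^ (g + 1)) 0 b) := by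
  rcases lt_or_ge (P.ord S.x) 0 with h | h
  · right
    obtain ⟨b, hb, hC⟩ := S.isDoubleCover.exists_isCenteredAt_of_ord_neg h S.natDegree_le
    exact ⟨h, b, S.isSmoothPoint_reflect hb, hC⟩
  · left
    obtain ⟨a, b, hb, hC⟩ := S.isDoubleCover.exists_isCenteredAt_of_ord h
    exact ⟨a, b, .of_squarefree S.squarefree hb, hC⟩

theorem isDoubleCover_inv : IsDoubleCover S.x⁻¹ (S.y / S.x ^ (g + 1))
    (reflect (2 * (g + 1)) S.f) :=
  S.isDoubleCover.inv S.natDegree_le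

theorem exists_residue {P : CurvePoint ℂ S.FunctionField} {z : S.FunctionField}
    (hz : z ∈ P.localRing) :
    ∃ c : ℂ, P.localRing.valuation (z - algebraMap ℂ S.FunctionField c) < 1 := by
  rcases S.exists_chart P with ⟨a, b, hP, hC⟩ | ⟨-, b, hP, hC⟩
  · exact hC.exists_residue S.isDoubleCover hP hz
  · exact hC.exists_residue S.isDoubleCover_inv hP hz

theorem exists_point_of_valuationSubring {V : ValuationSubring S.FunctionField}
    (hV : ∀ c : ℂ, algebraMap ℂ S.FunctionField c ∈ V) (hV' : V ≠ ⊤) :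
    ∃ P : CurvePoint ℂ S.FunctionField, P.localRing = V := by
  rcases V.mem_or_inv_mem S.x with h | h
  · obtain ⟨a, b, hb, hC⟩ := S.isDoubleCover.exists_isCenteredAt_of_mem hV h hV'
    exact ⟨⟨V, hV, hC.isDiscreteValuationRing S.isDoubleCover
      (.of_squarefree S.squarefree hb)⟩, rfl⟩
  · by_cases h' : S.x ∈ V
    · obtain ⟨a, b, hb, hC⟩ := S.isDoubleCover.exists_isCenteredAt_of_mem hV h' hV'
      exact ⟨⟨V, hV, hC.isDiscreteValuationRing S.isDoubleCover
        (.of_squarefree S.squarefree hb)⟩, rfl⟩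
    · obtain ⟨a, b, hb, hC⟩ := S.isDoubleCover_inv.exists_isCenteredAt_of_mem hV h hV'
      have h1 : V.valuation S.x⁻¹ < 1 :=
        V.mem_nonunits_iff.mp (V.inv_mem_nonunits_iff.mpr (Or.inr h'))
      have hC' : IsCenteredAt V S.x⁻¹ (S.y / S.x ^ (g + 1)) 0 b :=
        ⟨hV, by simpa using h1, hC.snd⟩
      obtain rfl := (hC.eq_and_eq hC').1
      rw [← coeff_zero_eq_eval_zero, coeff_reflect, revAt_zero] at hb
      exact ⟨⟨V, hV, hC.isDiscreteValuationRing S.isDoubleCover_inv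
        (S.isSmoothPoint_reflect hb)⟩, rfl⟩

/-- `1/z` is transcendental, hence a nonunit of some valuation ring over `ℂ`. That ring is not the
whole field, so it is the local ring of a point, at which `z` has a pole. -/
theorem exists_ord_neg {z : S.FunctionField}
    (hz : ∀ c : ℂ, z ≠ algebraMap ℂ S.FunctionField c) :
    ∃ P : CurvePoint ℂ S.FunctionField, P.ord z < 0 := by
  have h1 : Transcendental ℂ z⁻¹ := fun h =>
    transcendental_of_forall_ne hz (by simpa using h.inv)
  have hz0 : z⁻¹ ≠ 0 := by simpa using hz 0
  obtain ⟨V, hV, hw⟩ := exists_valuationSubring_of_transcendental h1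
  obtain ⟨P, rfl⟩ := S.exists_point_of_valuationSubring hV (by
    rintro rfl
    have h2 := (ValuationSubring.mem_nonunits_iff_or _).mp
      ((ValuationSubring.mem_nonunits_iff _).mpr hw)
    rcases h2 with h2 | h2
    · exact hz0 h2
    · exact h2 (ValuationSubring.mem_top _))
  refine ⟨P, ?_⟩
  have := P.ord_pos_of_valuation_lt_one hz0 hw
  rw [P.ord_inv] at this
  omega

noncomputable instance : Algebra ℂ[X] S.FunctionField :=
  inferInstanceAs (Algebra ℂ[X] (AdjoinRoot S.equation))

instance : IsScalarTower ℂ[X] (RatFunc ℂ) S.FunctionField :=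
  inferInstanceAs (IsScalarTower ℂ[X] (RatFunc ℂ) (AdjoinRoot S.equation))

instance : IsScalarTower ℂ ℂ[X] S.FunctionField :=
  inferInstanceAs (IsScalarTower ℂ ℂ[X] (AdjoinRoot S.equation))

instance : FiniteDimensional (RatFunc ℂ) S.FunctionField :=
  (AdjoinRoot.powerBasis S.irreducible_equation.ne_zero).finite

/-- `ℂ(x)` is a localisation of `ℂ[x]`, and the function field is a finite separable extension of
`ℂ(x)`; derivations therefore extend uniquely along both steps. -/
instance : Algebra.FormallyEtale ℂ[X] S.FunctionField := by
  have := Algebra.FormallyEtale.of_isLocalization (Rₘ := RatFunc ℂ) (nonZeroDivisors ℂ[X])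
  have := Algebra.FormallyEtale.of_isSeparable (RatFunc ℂ) S.FunctionField
  exact Algebra.FormallyEtale.comp ℂ[X] (RatFunc ℂ) S.FunctionField

/-- By étaleness the differentials of the function field are the base change of those of `ℂ[x]`,
which are free on `dx`; so the image of `x` may be prescribed. -/
theorem exists_derivation (w : S.FunctionField) :
    ∃ D : Derivation ℂ S.FunctionField S.FunctionField, D S.x = w := by
  let φ : Ω[ℂ[X]⁄ℂ] →ₗ[ℂ[X]] S.FunctionField :=
    (Polynomial.mkDerivation ℂ w).liftKaehlerDifferential
  let e := KaehlerDifferential.tensorKaehlerEquivOfFormallyEtale ℂ ℂ[X] S.FunctionField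
  let ψ : Ω[S.FunctionField⁄ℂ] →ₗ[S.FunctionField] S.FunctionField :=
    (φ.liftBaseChange S.FunctionField).comp e.symm.toLinearMap
  refine ⟨ψ.compDer (KaehlerDifferential.D ℂ S.FunctionField), ?_⟩
  have hx : S.x = algebraMap ℂ[X] S.FunctionField X := by
    rw [IsScalarTower.algebraMap_apply ℂ[X] (RatFunc ℂ) S.FunctionField,
      algebraMap_algebraMap_eq_aeval, aeval_X]
  have h1 := KaehlerDifferential.tensorKaehlerEquivOfFormallyEtale_symm_D_algebraMap
    ℂ ℂ[X] S.FunctionField X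
  rw [hx]
  refine (congrArg (φ.liftBaseChange S.FunctionField) h1).trans ?_
  simp [φ, Polynomial.mkDerivation_X]

theorem exists_ord_sub_pos {z : S.FunctionField}
    (hz : ∀ c : ℂ, z ≠ algebraMap ℂ S.FunctionField c) (c : ℂ) :
    ∃ P : CurvePoint ℂ S.FunctionField, 0 < P.ord (z - algebraMap ℂ S.FunctionField c) := by
  obtain ⟨P, hP⟩ := S.exists_ord_neg (z := (z - algebraMap ℂ S.FunctionField c)⁻¹) (by
    intro d hd
    refine hz (d⁻¹ + c) ?_
    rw [map_add, map_inv₀, ← hd, inv_inv, sub_add_cancel])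
  refine ⟨P, ?_⟩
  rw [P.ord_inv] at hP
  omega

end General

section GenusOne

variable (S : HyperellipticCurve 1)

/-- The derivation dual to the invariant differential `dx / 2y`: it has neither zeros nor poles. -/
theorem exists_invariant_derivation :
    ∃ D : Derivation ℂ S.FunctionField S.FunctionField,
      ∀ P : CurvePoint ℂ S.FunctionField, (∀ z ∈ P.localRing, D z ∈ P.localRing) ∧
        ∀ z, P.ord z ≠ 0 → D z ≠ 0 ∧ P.ord (D z) = P.ord z - 1 := by
  obtain ⟨D, hD⟩ := S.exists_derivation (algebraMap ℂ S.FunctionField (2 * 1) * S.y)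
  have hx := S.isDoubleCover.fst_ne_zero
  -- This is where genus one enters: `D(1/x) = -2y/x²`, and `y/x²` is exactly the second coordinate
  -- of the chart at infinity.
  have hD' : D S.x⁻¹ = algebraMap ℂ S.FunctionField (2 * (-1)) * (S.y / S.x ^ (1 + 1)) := by
    rw [Derivation.leibniz_inv, hD]
    simp only [smul_eq_mul, mul_one, mul_neg, map_neg]
    field_simp
    ring
  refine ⟨D, fun P => ?_⟩
  rcases S.exists_chart P with ⟨a, b, hP, hC⟩ | ⟨-, b, hP, hC⟩
  · exact ⟨fun z hz => hC.derivation_mem S.isDoubleCover D hD hP hz,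
      fun z hz => hC.derivation_ord S.isDoubleCover D hD hP one_ne_zero hz⟩
  · exact ⟨fun z hz => hC.derivation_mem S.isDoubleCover_inv D hD' hP hz,
      fun z hz => hC.derivation_ord S.isDoubleCover_inv D hD' hP (by norm_num) hz⟩

/-- A function on a curve of genus one does not have a simple pole as its only pole. -/
theorem false_of_simple_pole {z : S.FunctionField} {Q : CurvePoint ℂ S.FunctionField}
    (hQ : Q.ord z = -1) (hz : ∀ P : CurvePoint ℂ S.FunctionField, P ≠ Q → 0 ≤ P.ord z) : False := by
  obtain ⟨D, hD⟩ := S.exists_invariant_derivation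
  have hz0 : z ≠ 0 := Q.ne_zero_of_ord_ne (by omega)
  have hmul : ∀ w : S.FunctionField, Q.localRing.valuation w < 1 → z * w ∈ Q.localRing := by
    intro w hw
    rcases eq_or_ne w 0 with rfl | hw0
    · rw [mul_zero]; exact zero_mem _
    · have := Q.ord_pos_of_valuation_lt_one hw0 hw
      refine Q.mem_of_ord_nonneg ?_
      rw [Q.ord_mul hz0 hw0]
      omega
  -- `Dz` has a double pole at `Q`, so `Dz/z²` has a nonzero residue `α` there.
  obtain ⟨hD0, hDQ⟩ := (hD Q).2 z (by omega)
  have h0 : Q.ord (D z / z ^ 2) = 0 := by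
    rw [Q.ord_div hD0 (pow_ne_zero 2 hz0), Q.ord_pow, hDQ, hQ]
    norm_num
  obtain ⟨α, hα⟩ := S.exists_residue (Q.mem_of_ord_nonneg h0.ge)
  have hα0 : α ≠ 0 := by
    rintro rfl
    rw [map_zero, sub_zero] at hα
    exact (Q.ord_pos_of_valuation_lt_one (div_ne_zero hD0 (pow_ne_zero 2 hz0)) hα).ne' h0
  obtain ⟨β, hβ⟩ := S.exists_residue (hmul _ hα)
  have h1 := hmul _ hβ
  -- `T` is `Dz - αz² - βz`. The nested form shows that it is regular at `Q`, each factor `z` being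
  -- multiplied by a function vanishing there.
  set T := z * (z * (D z / z ^ 2 - algebraMap ℂ S.FunctionField α) -
    algebraMap ℂ S.FunctionField β) with hT
  have hT' : T = D z - algebraMap ℂ S.FunctionField α * z ^ 2 -
      algebraMap ℂ S.FunctionField β * z := by
    rw [hT]
    field_simp
  -- `T` has no pole at all, so it is constant.
  obtain ⟨γ, hγ⟩ : ∃ γ : ℂ, T = algebraMap ℂ S.FunctionField γ := by
    by_contra! hne
    obtain ⟨P, hP⟩ := S.exists_ord_neg hne
    refine hP.not_ge (P.ord_nonneg ?_)
    by_cases hPQ : P = Q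
    · exact hPQ ▸ h1
    · have h2 := P.mem_of_ord_nonneg (hz P hPQ)
      rw [hT']
      exact sub_mem (sub_mem ((hD P).1 z h2) (mul_mem (P.algebraMap_mem α) (pow_mem h2 2)))
        (mul_mem (P.algebraMap_mem β) h2)
  obtain ⟨e, he⟩ : ∃ e : ℂ, α * e ^ 2 + β * e + γ = 0 := by
    obtain ⟨s, hs⟩ := IsAlgClosed.exists_pow_nat_eq (β ^ 2 - 4 * α * γ) two_pos
    refine ⟨(-β + s) / (2 * α), ?_⟩
    field_simp
    linear_combination hs
  have hnc : ∀ c : ℂ, z ≠ algebraMap ℂ S.FunctionField c := by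
    rintro c rfl
    rw [Q.ord_algebraMap] at hQ
    omega
  -- The second root of `αX² + βX + γ`, by Vieta.
  set e' := -β / α - e with he'
  have hfac : D z = algebraMap ℂ S.FunctionField α * ((z - algebraMap ℂ S.FunctionField e) *
      (z - algebraMap ℂ S.FunctionField e')) := by
    have h2 : α * (e + e') = -β := by rw [he']; field_simp; ring
    have h3 : α * (e * e') = γ := by linear_combination e * h2 - he
    have h2' := congrArg (algebraMap ℂ S.FunctionField) h2
    have h3' := congrArg (algebraMap ℂ S.FunctionField) h3
    simp only [map_mul, map_add, map_neg] at h2' h3'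
    rw [hγ] at hT'
    linear_combination -hT' + z * h2' - h3'
  -- At a zero of `z - e` the derivative drops the order by one, whereas `α(z - e)(z - e')` has at
  -- least the order of `z - e`.
  obtain ⟨P, hP⟩ := S.exists_ord_sub_pos hnc e
  have h4 := ((hD P).2 _ hP.ne').2
  rw [map_sub, Derivation.map_algebraMap, sub_zero, hfac,
    P.ord_mul (by simpa using hα0) (mul_ne_zero (sub_ne_zero.mpr (hnc e)) (sub_ne_zero.mpr (hnc e'))),
    P.ord_algebraMap, P.ord_mul (sub_ne_zero.mpr (hnc e)) (sub_ne_zero.mpr (hnc e'))] at h4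
  by_cases hee : e = e'
  · rw [← hee] at h4
    omega
  · have := P.ord_sub_pos_of hee hP
    omega

/-- The exponents in `(Dβ)³ / (β²(β - 1)²)` are chosen to cancel triple ramification over `0` and
`1`: there the order is `3·2 - 2·3 = 0`. At a pole of order `n` it is `-3(n + 1) + 4n = n - 3`,
hence `1` for `n = 4` and `-1` for `n = 2`. -/
theorem not_isBelyiPair_33_33_42 (β : S.FunctionField) :
    ¬ S.IsBelyiPair β {3, 3} {3, 3} {4, 2} := by
  rintro ⟨⟨hnc, -⟩, h0, h1, hinf⟩
  have key : ∀ z : S.FunctionField, HasZeroOrders z {3, 3} →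
      ∀ P : CurvePoint ℂ S.FunctionField, 0 < P.ord z → P.ord z = 3 := by
    rintro z ⟨s, hs, hr⟩ P hP
    have h2 := Multiset.mem_map_of_mem (fun P : CurvePoint ℂ S.FunctionField => P.ord z)
      (Finset.mem_val.mpr ((hs P).mpr hP))
    rw [hr] at h2
    simpa using h2
  obtain ⟨C', Q, hC, hQ, hCQ⟩ : ∃ C' Q : CurvePoint ℂ S.FunctionField, C'.ord β = -4 ∧
      Q.ord β = -2 ∧ ∀ P : CurvePoint ℂ S.FunctionField, P.ord β < 0 → P = C' ∨ P = Q := by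
    obtain ⟨s, hs, hr⟩ := hinf
    have hr' : s.val.map (fun P => P.ord β⁻¹) = 4 ::ₘ {2} := by
      rw [hr]
      simp
    classical
    obtain ⟨C', hC, hC1, hC2⟩ := (Multiset.map_eq_cons _ _ _ _).mpr hr'
    obtain ⟨Q, hQ, hQ2⟩ := Multiset.map_eq_singleton.mp hC2
    rw [CurvePoint.ord_inv] at hC1 hQ2
    refine ⟨C', Q, by omega, by omega, fun P hP => ?_⟩
    have h3 : P ∈ s.val := Finset.mem_val.mpr ((hs P).mpr (by rw [P.ord_inv]; omega))
    rw [← Multiset.cons_erase hC, hQ] at h3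
    simpa using h3
  obtain ⟨D, hD⟩ := S.exists_invariant_derivation
  have hD1 : D (β - 1) = D β := by rw [map_sub, Derivation.map_one_eq_zero, sub_zero]
  have hβ0 : β ≠ 0 := by simpa using hnc 0
  have hβ1 : β - 1 ≠ 0 := sub_ne_zero.mpr (by simpa using hnc 1)
  have hDβ : D β ≠ 0 := ((hD Q).2 β (by omega)).1
  have hord : ∀ P : CurvePoint ℂ S.FunctionField, P.ord (D β ^ 3 / (β ^ 2 * (β - 1) ^ 2)) =
      3 * P.ord (D β) - 2 * P.ord β - 2 * P.ord (β - 1) := by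
    intro P
    rw [P.ord_div (pow_ne_zero 3 hDβ) (mul_ne_zero (pow_ne_zero 2 hβ0) (pow_ne_zero 2 hβ1)),
      P.ord_mul (pow_ne_zero 2 hβ0) (pow_ne_zero 2 hβ1), P.ord_pow, P.ord_pow, P.ord_pow]
    push_cast
    ring
  have hneg : ∀ P : CurvePoint ℂ S.FunctionField, P.ord β < 0 → P.ord (β - 1) = P.ord β := by
    intro P hP
    simpa using P.ord_sub_algebraMap_of_neg 1 hP
  -- Away from the fibres over `0`, `1`, `∞` the order is `3 ord(Dβ)`, which is nonnegative because
  -- `D` preserves local rings.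
  refine S.false_of_simple_pole (z := D β ^ 3 / (β ^ 2 * (β - 1) ^ 2)) (Q := Q) ?_ fun P hPQ => ?_
  · rw [hord, hneg Q (by omega), ((hD Q).2 β (by omega)).2, hQ]
    norm_num
  · rw [hord]
    rcases lt_trichotomy (P.ord β) 0 with h2 | h2 | h2
    · obtain rfl := (hCQ P h2).resolve_right hPQ
      rw [hneg P h2, ((hD P).2 β h2.ne).2, hC]
      norm_num
    · have h3 := P.ord_nonneg ((hD P).1 β (P.mem_of_ord_nonneg h2.ge))
      rcases lt_trichotomy (P.ord (β - 1)) 0 with h4 | h4 | h4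
      · omega
      · omega
      · have h5 := key _ h1 P h4
        have h6 := ((hD P).2 (β - 1) h4.ne').2
        rw [hD1, h5] at h6
        omega
    · have h3 := key _ h0 P h2
      have h4 : P.ord (β - 1) = 0 := by
        have := P.ord_sub_pos_of (z := β) (c := 0) (d := 1) zero_ne_one (by simpa using h2)
        simpa using this
      have h6 := ((hD P).2 β h2.ne').2
      omega

end GenusOne

end HyperellipticCurve

/-! ### Squarefree polynomials and quartic number fields. -/

section Construction

theorem squarefree_of_forall_isRoot {f : ℂ[X]}
    (h : ∀ t : ℂ, f.eval t = 0 → (derivative f).eval t ≠ 0) : Squarefree f := by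
  refine Polynomial.Separable.squarefree ?_
  rw [Polynomial.separable_def]
  refine (Polynomial.isCoprime_iff_aeval_ne_zero_of_isAlgClosed ℂ ℂ f (derivative f)).mpr fun t => ?_
  rw [coe_aeval_eq_eval]
  by_cases h0 : f.eval t = 0
  · exact Or.inr (h t h0)
  · exact Or.inl h0

theorem squarefree_cubic {a b : ℂ} (h : 4 * a ^ 3 + 27 * b ^ 2 ≠ 0) :
    Squarefree (X ^ 3 + C a * X + C b) := by
  refine squarefree_of_forall_isRoot fun t ht ht' => h ?_
  simp at ht ht'
  -- The discriminant as a combination of the cubic and its derivative.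
  linear_combination (-18 * a * t + 27 * b) * ht + (6 * a * t ^ 2 - 9 * b * t + 4 * a ^ 2) * ht'

theorem natDegree_cubic' (a b : ℂ) : (X ^ 3 + C a * X + C b).natDegree = 3 := by
  compute_degree!

namespace HyperellipticCurve

variable {g : ℕ}

theorem isOddCover (S : HyperellipticCurve g) {f : ℂ[X]} (hf : S.f = f)
    (hd : f.natDegree = 2 * g + 1) : IsOddCover g S.x S.y f :=
  { hf ▸ S.isDoubleCover with
    squarefree := hf ▸ S.squarefree
    natDegree_eq := hd }

end HyperellipticCurve

theorem IsBelyiPairOfGenus.intro {g : ℕ} {f : ℂ[X]}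
    {β : (S : HyperellipticCurve g) → S.FunctionField} {r₀ r₁ r₂ : Multiset ℕ}
    (hs : Squarefree f) (hd : f.natDegree = 2 * g + 1)
    (hβ : ∀ S : HyperellipticCurve g, IsOddCover g S.x S.y f → S.IsBelyiPair (β S) r₀ r₁ r₂) :
    IsBelyiPairOfGenus g f β r₀ r₁ r₂ :=
  ⟨⟨f, hs, Or.inl hd⟩, rfl, hβ _ (HyperellipticCurve.isOddCover _ rfl hd)⟩

/-- The hypothesis `hmem` is stated for an arbitrary subfield, so that the field of definition is
checked by closure properties following the expression for `β`. -/
theorem IsQuarticBelyiPairOfGenus.intro {ξ a b : ℂ} {f : ℂ[X]}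
    {β : (S : HyperellipticCurve 1) → S.FunctionField} {r₀ r₁ r₂ : Multiset ℕ}
    (hξ : Module.finrank ℚ ℚ⟮ξ⟯ = 4) (hf : f = X ^ 3 + C a * X + C b)
    (hΔ : 4 * a ^ 3 + 27 * b ^ 2 ≠ 0) (ha : a ∈ ℚ⟮ξ⟯) (hb : b ∈ ℚ⟮ξ⟯)
    (hβ : ∀ S : HyperellipticCurve 1, IsOddCover 1 S.x S.y (X ^ 3 + C a * X + C b) →
      S.IsBelyiPair (β S) r₀ r₁ r₂)
    (hmem : ∀ (S : HyperellipticCurve 1) (F : Subfield S.FunctionField), S.x ∈ F → S.y ∈ F →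
      (∀ c ∈ ℚ⟮ξ⟯, algebraMap ℂ S.FunctionField c ∈ F) → β S ∈ F) :
    IsQuarticBelyiPairOfGenus 1 ξ f β r₀ r₁ r₂ := by
  subst hf
  refine ⟨hξ, ⟨_, squarefree_cubic hΔ, Or.inl (natDegree_cubic' a b)⟩, rfl,
    hβ _ (HyperellipticCurve.isOddCover _ rfl (natDegree_cubic' a b)), fun n => ?_,
    hmem _ _ (Subfield.subset_closure (by simp)) (Subfield.subset_closure (by simp))
      fun c hc => Subfield.subset_closure (Or.inl ⟨c, hc, rfl⟩)⟩
  simp only [coeff_add, coeff_X_pow, coeff_C_mul, coeff_X, coeff_C]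
  refine add_mem (add_mem ?_ (mul_mem ha ?_)) ?_ <;> split_ifs <;>
    first | exact one_mem _ | exact zero_mem _ | exact hb

theorem finrank_adjoin_of_eisenstein {ξ : ℂ} {P : ℤ[X]} {p : ℕ} (hp : p.Prime) (hP : P.Monic)
    (hdeg : P.natDegree = 4) (hE : P.IsEisensteinAt (Ideal.span {(p : ℤ)})) (hξ : aeval ξ P = 0) :
    Module.finrank ℚ ℚ⟮ξ⟯ = 4 := by
  have hpp : (Ideal.span {(p : ℤ)}).IsPrime :=
    (Ideal.span_singleton_prime (by exact_mod_cast hp.ne_zero)).mpr (Nat.prime_iff_prime_int.mp hp)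
  have h1 : Irreducible P := hE.irreducible hpp hP.isPrimitive (by omega)
  have h2 := (hP.irreducible_iff_irreducible_map_fraction_map (K := ℚ)).mp h1
  have h3 : aeval ξ (P.map (algebraMap ℤ ℚ)) = 0 := by rw [aeval_map_algebraMap, hξ]
  have h4 := minpoly.eq_of_irreducible_of_monic h2 h3 (hP.map _)
  have h5 : IsIntegral ℚ ξ := ⟨_, hP.map _, h3⟩
  rw [IntermediateField.adjoin.finrank h5, ← h4, hP.natDegree_map, hdeg]

end Construction

/-! ### Belyi maps with a single pole, from the factorisations of two norms. -/

namespace IsOddCover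

variable {K : Type*} [Field K] [Algebra ℂ K]

variable {g : ℕ} {u v : K} {h : ℂ[X]} (H : IsOddCover g u v h) {p q : ℂ[X]} {m : ℕ} (hm : 0 < m)
  (hinf : ∀ P : CurvePoint ℂ K, P.ord u < 0 → P.ord (linearForm u v p q) = -m)
include H hm hinf

theorem isBelyi_of_norm {n₀ n₁ : ℕ} {A₀ : Fin n₀ → ℂ} {A₁ : Fin n₁ → ℂ} {k₀ : Fin n₀ → ℕ}
    {k₁ : Fin n₁ → ℕ} {d₀ d₁ : ℂ}
    (hD : ∀ a b : ℂ, b ^ 2 = h.eval a → 2 * (derivative q).eval a * h.eval a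
      + q.eval a * (derivative h).eval a + 2 * (derivative p).eval a * b = 0 →
      p.eval a + q.eval a * b = 0 ∨ p.eval a + q.eval a * b = 1)
    (hd₀ : d₀ ≠ 0) (hA₀ : Function.Injective A₀) (hk₀ : ∀ i, 0 < k₀ i)
    (hN₀ : ∀ t : ℂ, p.eval t ^ 2 - q.eval t ^ 2 * h.eval t = d₀ * ∏ i, (t - A₀ i) ^ k₀ i)
    (hp₀ : ∀ i, p.eval (A₀ i) ≠ 0) (hq₀ : ∀ i, q.eval (A₀ i) ≠ 0)
    (hd₁ : d₁ ≠ 0) (hA₁ : Function.Injective A₁) (hk₁ : ∀ i, 0 < k₁ i)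
    (hN₁ : ∀ t : ℂ, (p.eval t - 1) ^ 2 - q.eval t ^ 2 * h.eval t = d₁ * ∏ i, (t - A₁ i) ^ k₁ i)
    (hp₁ : ∀ i, p.eval (A₁ i) ≠ 1) (hq₁ : ∀ i, q.eval (A₁ i) ≠ 0) :
    IsBelyiMap (linearForm u v p q) ∧ HasPassport (linearForm u v p q)
      (Finset.univ.val.map k₀) (Finset.univ.val.map k₁) {m} := by
  refine ⟨H.isBelyiMap_linearForm hm hinf hD, ?_, ?_, H.hasZeroOrders_inv_linearForm hm hinf⟩
  · have := H.hasZeroOrders_linearForm_sub_of_norm hm hinf 0 d₀ hd₀ hA₀ hk₀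
      (by simpa using hN₀) hp₀ hq₀
    simpa using this
  · have := H.hasZeroOrders_linearForm_sub_of_norm hm hinf 1 d₁ hd₁ hA₁ hk₁ hN₁ hp₁ hq₁
    simpa using this

end IsOddCover

namespace IsOddCover

variable {K : Type*} [Field K] [Algebra ℂ K]

variable {g : ℕ} {u v : K} {h : ℂ[X]} (H : IsOddCover g u v h)
include H

/-- For `β = 1/2 + qv` the conjugation `v ↦ -v` is `β ↦ 1 - β`. The fibres over `0` and `1` are
exchanged, both have norm `1/4 - q²h`, and `β` is `0` or `1` exactly where this vanishes. As `p' =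
0`, the critical equation involves `u` alone. -/
theorem isBelyi_half_add {q : ℂ[X]} {n : ℕ} {A : Fin n → ℂ} {k : Fin n → ℕ} {d : ℂ} {m : ℕ}
    (hm : m = 2 * q.natDegree + 2 * g + 1)
    (hD : ∀ a : ℂ, 2 * (derivative q).eval a * h.eval a + q.eval a * (derivative h).eval a = 0 →
      4 * q.eval a ^ 2 * h.eval a = 1)
    (hd : d ≠ 0) (hA : Function.Injective A) (hk : ∀ i, 0 < k i)
    (hN : ∀ t : ℂ, 1 / 4 - q.eval t ^ 2 * h.eval t = d * ∏ i, (t - A i) ^ k i)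
    (hq : ∀ i, q.eval (A i) ≠ 0) :
    IsBelyiMap (linearForm u v (C (1 / 2)) q) ∧ HasPassport (linearForm u v (C (1 / 2)) q)
      (Finset.univ.val.map k) (Finset.univ.val.map k) {m} := by
  have hq0 : q ≠ 0 := by
    rintro rfl
    have h1 := hD 0
    simp at h1
  refine H.isBelyi_of_norm (by omega) (fun P hP => ?_) (fun a b hb hab => ?_) hd hA hk
    (fun t => ?_) (fun i => by simp) hq hd hA hk (fun t => ?_) (fun i => ?_) hq
  · rw [H.ord_linearForm_of_gt hP hq0 (fun _ => by rw [natDegree_C]; omega), hm]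
    push_cast
    ring
  · have h1 := hD a (by simpa using hab)
    rw [← hb] at h1
    have h2 : (1 / 2 + q.eval a * b) * (1 / 2 + q.eval a * b - 1) = 0 := by
      linear_combination h1 / 4
    rw [eval_C]
    rcases mul_eq_zero.mp h2 with h3 | h3
    · exact Or.inl h3
    · exact Or.inr (sub_eq_zero.mp h3)
  · rw [← hN, eval_C]
    ring
  · rw [← hN, eval_C]
    ring
  · rw [eval_C]
    norm_num

end IsOddCover

/-! ### The two pairs `β = (1 + y)/2`. -/

theorem belyiPair_3_3_3 :
    IsBelyiPairOfGenus 1 (X ^ 3 + 1) (fun S => 1 / 2 * (1 + S.y)) {3} {3} {3} := by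
  refine .intro ?_ (by compute_degree!) fun S H => ?_
  · refine squarefree_of_forall_isRoot fun t ht ht' => ?_
    norm_num at ht ht'
    norm_num [ht'] at ht
  · have e : 1 / 2 * (1 + S.y) = linearForm S.x S.y (C (1 / 2)) (C (1 / 2)) := by
      simp only [linearForm, aeval_C, map_div₀, map_one, map_ofNat]
      ring
    rw [e]
    -- The norm is `1/4 - (x³ + 1)/4 = -x³/4`.
    refine H.isBelyi_half_add (A := ![0]) (k := ![3]) (d := -1 / 4) (by simp) ?_ (by norm_num)
      (Function.injective_of_subsingleton _) (by simp) ?_ (by simp)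
    · intro a ha
      norm_num at ha ⊢
      rw [ha]
    · intro t
      simp
      ring

theorem belyiPair_5_5_5 :
    IsBelyiPairOfGenus 2 (X ^ 5 + 1) (fun S => (S.y + 1) / 2) {5} {5} {5} := by
  refine .intro ?_ (by compute_degree!) fun S H => ?_
  · refine squarefree_of_forall_isRoot fun t ht ht' => ?_
    norm_num at ht ht'
    norm_num [ht'] at ht
  · have e : (S.y + 1) / 2 = linearForm S.x S.y (C (1 / 2)) (C (1 / 2)) := by
      simp only [linearForm, aeval_C, map_div₀, map_one, map_ofNat]
      ring
    rw [e]
    refine H.isBelyi_half_add (A := ![0]) (k := ![5]) (d := -1 / 4) (by simp) ?_ (by norm_num)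
      (Function.injective_of_subsingleton _) (by simp) ?_ (by simp)
    · intro a ha
      norm_num at ha ⊢
      rw [ha]
    · intro t
      simp
      ring

/-! ### Auxiliary facts for explicit verifications. -/

theorem forall_fin_three {p : Fin 3 → Prop} (h0 : p 0) (h1 : p 1) (h2 : p 2) : ∀ i, p i := by
  intro i
  fin_cases i
  exacts [h0, h1, h2]

theorem injective_pair {α : Type*} {a b : α} (h : a ≠ b) : Function.Injective ![a, b] := by
  intro i j hij
  fin_cases i <;> fin_cases j <;> simp_all

theorem injective_triple {α : Type*} {a b c : α} (hab : a ≠ b) (hac : a ≠ c) (hbc : b ≠ c) :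
    Function.Injective ![a, b, c] := by
  intro i j hij
  fin_cases i <;> fin_cases j <;> simp_all

/-- Inequalities in `ℚ(ξ)` are certified by an explicit inverse `z` of the difference, which reduces
them to an identity modulo the quartic of `ξ`. -/
theorem ne_of_mul_sub_eq_one {x y z : ℂ} (h : z * (x - y) = 1) : x ≠ y := by
  rintro rfl
  simp at h

theorem exists_roots_quadratic {α β : ℂ} (h : α ^ 2 - 4 * β ≠ 0) :
    ∃ r s : ℂ, r ≠ s ∧ r ^ 2 + α * r + β = 0 ∧ s ^ 2 + α * s + β = 0 ∧
      ∀ t : ℂ, t ^ 2 + α * t + β = (t - r) * (t - s) := by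
  obtain ⟨w, hw⟩ := IsAlgClosed.exists_pow_nat_eq (α ^ 2 - 4 * β) two_pos
  refine ⟨(-α + w) / 2, (-α - w) / 2, ?_, ?_, ?_, fun t => ?_⟩
  · intro h0
    have : w = 0 := by linear_combination h0
    apply h
    rw [← hw, this]
    ring
  · linear_combination hw / 4
  · linear_combination hw / 4
  · linear_combination hw / 4

section Cubic

variable (a b c₀ c₁ c₂ d₀ d₁ t : ℂ)

theorem eval_cubic : (X ^ 3 + C a * X + C b).eval t = t ^ 3 + a * t + b := by simp

theorem eval_derivative_cubic :
    (derivative (X ^ 3 + C a * X + C b)).eval t = 3 * t ^ 2 + a := by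
  simp
  norm_num

theorem eval_quadratic : (C c₀ + C c₁ * X + C c₂ * X ^ 2).eval t = c₀ + c₁ * t + c₂ * t ^ 2 := by
  simp

theorem eval_derivative_quadratic :
    (derivative (C c₀ + C c₁ * X + C c₂ * X ^ 2)).eval t = c₁ + 2 * c₂ * t := by
  simp
  ring

theorem eval_linear : (C d₀ + C d₁ * X).eval t = d₀ + d₁ * t := by simp

theorem eval_derivative_linear : (derivative (C d₀ + C d₁ * X)).eval t = d₁ := by simp

theorem natDegree_quadratic_le : (C c₀ + C c₁ * X + C c₂ * X ^ 2).natDegree ≤ 2 := by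
  compute_degree

variable {c₀ c₁ c₂ d₀ d₁}

theorem natDegree_quadratic_of_ne (h : c₂ ≠ 0) :
    (C c₀ + C c₁ * X + C c₂ * X ^ 2).natDegree = 2 := by
  compute_degree!

theorem natDegree_linear_of_ne (h : d₁ ≠ 0) : (C d₀ + C d₁ * X).natDegree = 1 := by
  compute_degree!

end Cubic

namespace IsOddCover

variable {K : Type*} [Field K] [Algebra ℂ K]

/-- A function `c₀ + c₁ u + c₂ u² + (d₀ + d₁ u) v` of degree four or five on the curve
`v² = u³ + a u + b` is a Belyi map if it takes only the values `0` and `1` at its critical points;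
its passport is read off from the norms of the function and of the function minus one. -/
theorem isBelyi_of_norm_cubic {u v : K} {a b c₀ c₁ c₂ d₀ d₁ : ℂ} {m : ℕ}
    (H : IsOddCover 1 u v (X ^ 3 + C a * X + C b))
    (hm : m = 4 ∧ c₂ ≠ 0 ∧ d₁ = 0 ∨ m = 5 ∧ d₁ ≠ 0)
    {n₀ n₁ : ℕ} {A₀ : Fin n₀ → ℂ} {A₁ : Fin n₁ → ℂ} {k₀ : Fin n₀ → ℕ}
    {k₁ : Fin n₁ → ℕ} {e₀ e₁ : ℂ}
    (hD : ∀ s y : ℂ, y ^ 2 = s ^ 3 + a * s + b →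
      2 * d₁ * (s ^ 3 + a * s + b) + (d₀ + d₁ * s) * (3 * s ^ 2 + a)
        + 2 * (c₁ + 2 * c₂ * s) * y = 0 →
      c₀ + c₁ * s + c₂ * s ^ 2 + (d₀ + d₁ * s) * y = 0 ∨
        c₀ + c₁ * s + c₂ * s ^ 2 + (d₀ + d₁ * s) * y = 1)
    (he₀ : e₀ ≠ 0) (hA₀ : Function.Injective A₀) (hk₀ : ∀ i, 0 < k₀ i)
    (hN₀ : ∀ t : ℂ, (c₀ + c₁ * t + c₂ * t ^ 2) ^ 2 - (d₀ + d₁ * t) ^ 2 * (t ^ 3 + a * t + b) =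
      e₀ * ∏ i, (t - A₀ i) ^ k₀ i)
    (hp₀ : ∀ i, c₀ + c₁ * A₀ i + c₂ * A₀ i ^ 2 ≠ 0) (hq₀ : ∀ i, d₀ + d₁ * A₀ i ≠ 0)
    (he₁ : e₁ ≠ 0) (hA₁ : Function.Injective A₁) (hk₁ : ∀ i, 0 < k₁ i)
    (hN₁ : ∀ t : ℂ, (c₀ + c₁ * t + c₂ * t ^ 2 - 1) ^ 2 - (d₀ + d₁ * t) ^ 2 * (t ^ 3 + a * t + b) =
      e₁ * ∏ i, (t - A₁ i) ^ k₁ i)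
    (hp₁ : ∀ i, c₀ + c₁ * A₁ i + c₂ * A₁ i ^ 2 ≠ 1) (hq₁ : ∀ i, d₀ + d₁ * A₁ i ≠ 0) :
    IsBelyiMap (linearForm u v (C c₀ + C c₁ * X + C c₂ * X ^ 2) (C d₀ + C d₁ * X)) ∧
      HasPassport (linearForm u v (C c₀ + C c₁ * X + C c₂ * X ^ 2) (C d₀ + C d₁ * X))
        (Finset.univ.val.map k₀) (Finset.univ.val.map k₁) {m} := by
  refine H.isBelyi_of_norm (by omega) (fun P hP => ?_) (fun s y hy hs => ?_) he₀ hA₀ hk₀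
    (fun t => ?_) (fun i => ?_) (fun i => ?_) he₁ hA₁ hk₁ (fun t => ?_) (fun i => ?_) fun i => ?_
  · rcases hm with ⟨rfl, h2, rfl⟩ | ⟨rfl, h1⟩
    · have h3 := natDegree_quadratic_of_ne (c₀ := c₀) (c₁ := c₁) h2
      rw [H.ord_linearForm_of_lt hP, h3]
      · norm_num
      · intro h4
        simp [h4] at h3
      · intro _
        rw [h3]
        simp
    · have h3 := natDegree_linear_of_ne (d₀ := d₀) h1
      rw [H.ord_linearForm_of_gt hP, h3]
      · norm_num
      · intro h4
        simp [h4] at h3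
      · intro _
        have := natDegree_quadratic_le c₀ c₁ c₂
        omega
  · simp only [eval_cubic, eval_derivative_cubic, eval_quadratic, eval_derivative_quadratic,
      eval_linear, eval_derivative_linear] at hy hs ⊢
    exact hD s y hy hs
  · simpa only [eval_cubic, eval_quadratic, eval_linear] using hN₀ t
  · simpa only [eval_quadratic] using hp₀ i
  · simpa only [eval_linear] using hq₀ i
  · simpa only [eval_cubic, eval_quadratic, eval_linear] using hN₁ t
  · simpa only [eval_quadratic] using hp₁ i
  · simpa only [eval_linear] using hq₁ i

end IsOddCover

/-- Used where `β` is given as `1/(p + qv)`, or becomes so in other coordinates: the verification is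
then carried out for the denominator. -/
theorem IsBelyiMap.inv_and_hasPassport_inv {K : Type*} [Field K] [Algebra ℂ K] {β : K}
    {r₀ r₁ r₂ : Multiset ℕ} (h : IsBelyiMap β ∧ HasPassport β r₀ r₁ r₂) :
    IsBelyiMap β⁻¹ ∧ HasPassport β⁻¹ r₂ r₁ r₀ :=
  ⟨h.1.inv, h.2.inv (by simpa using h.1.1 0)⟩

theorem finrank_adjoin_quartic {ξ : ℂ} {p : ℕ} (hp : p.Prime) {a₀ a₁ a₂ a₃ : ℤ}
    (h₀ : (p : ℤ) ∣ a₀) (h₁ : (p : ℤ) ∣ a₁) (h₂ : (p : ℤ) ∣ a₂) (h₃ : (p : ℤ) ∣ a₃)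
    (h₀' : ¬ (p : ℤ) ^ 2 ∣ a₀) (hξ : ξ ^ 4 + a₃ * ξ ^ 3 + a₂ * ξ ^ 2 + a₁ * ξ + a₀ = 0) :
    Module.finrank ℚ ℚ⟮ξ⟯ = 4 := by
  have hdeg : (X ^ 4 + C a₃ * X ^ 3 + C a₂ * X ^ 2 + C a₁ * X + C a₀).natDegree = 4 := by
    compute_degree!
  have hmon : (X ^ 4 + C a₃ * X ^ 3 + C a₂ * X ^ 2 + C a₁ * X + C a₀).Monic := by
    monicity!
  refine finrank_adjoin_of_eisenstein hp hmon hdeg ⟨?_, ?_, ?_⟩ (by simpa using hξ)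
  · rw [hmon.leadingCoeff, Ideal.mem_span_singleton]
    intro h
    exact hp.one_lt.ne' (by exact_mod_cast Int.eq_one_of_dvd_one (by positivity) h)
  · intro n hn
    rw [hdeg] at hn
    rw [Ideal.mem_span_singleton]
    simp only [coeff_add, coeff_C_mul, coeff_X_pow, coeff_X, coeff_C]
    interval_cases n <;> simpa
  · rw [Ideal.span_singleton_pow, Ideal.mem_span_singleton]
    simpa only [coeff_add, coeff_C_mul, coeff_X_pow, coeff_X, coeff_C, if_true, OfNat.zero_ne_ofNat,
      if_false, one_ne_zero, mul_zero, zero_add] using h₀'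

theorem finrank_adjoin_of_sub_two {ξ : ℂ} (hξ : ξ ^ 4 - 2 = 0) : Module.finrank ℚ ℚ⟮ξ⟯ = 4 :=
  finrank_adjoin_quartic (p := 2) (a₀ := -2) (a₁ := 0) (a₂ := 0) (a₃ := 0) (by norm_num)
    (by norm_num) (by norm_num) (by norm_num) (by norm_num) (by norm_num)
    (by push_cast; linear_combination hξ)

theorem finrank_adjoin_of_add_ten {ξ : ℂ} (hξ : ξ ^ 4 + 10 = 0) : Module.finrank ℚ ℚ⟮ξ⟯ = 4 :=
  finrank_adjoin_quartic (p := 2) (a₀ := 10) (a₁ := 0) (a₂ := 0) (a₃ := 0) (by norm_num)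
    (by norm_num) (by norm_num) (by norm_num) (by norm_num) (by norm_num)
    (by push_cast; linear_combination hξ)

theorem finrank_adjoin_of_sub_forty_five {ξ : ℂ} (hξ : ξ ^ 4 - 45 = 0) :
    Module.finrank ℚ ℚ⟮ξ⟯ = 4 :=
  finrank_adjoin_quartic (p := 5) (a₀ := -45) (a₁ := 0) (a₂ := 0) (a₃ := 0) (by norm_num)
    (by norm_num) (by norm_num) (by norm_num) (by norm_num) (by norm_num)
    (by push_cast; linear_combination hξ)

theorem finrank_adjoin_of_add_forty {ξ : ℂ} (hξ : ξ ^ 4 + 40 = 0) : Module.finrank ℚ ℚ⟮ξ⟯ = 4 :=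
  finrank_adjoin_quartic (p := 5) (a₀ := 40) (a₁ := 0) (a₂ := 0) (a₃ := 0) (by norm_num)
    (by norm_num) (by norm_num) (by norm_num) (by norm_num) (by norm_num)
    (by push_cast; linear_combination hξ)

/-- The quartic becomes an Eisenstein polynomial at `3` in `ξ + 1`. -/
theorem finrank_adjoin_of_quartic {ξ : ℂ}
    (hξ : ξ ^ 4 - 2 * ξ ^ 3 - 6 * ξ ^ 2 - 8 * ξ + 16 = 0) : Module.finrank ℚ ℚ⟮ξ⟯ = 4 := by
  have h1 : ℚ⟮ξ⟯ = ℚ⟮ξ + 1⟯ := by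
    refine le_antisymm (adjoin_simple_le_iff.mpr ?_) (adjoin_simple_le_iff.mpr ?_)
    · simpa using sub_mem (mem_adjoin_simple_self ℚ (ξ + 1)) (one_mem _)
    · exact add_mem (mem_adjoin_simple_self ℚ ξ) (one_mem _)
  rw [h1]
  exact finrank_adjoin_quartic (p := 3) (a₀ := 21) (a₁ := -6) (a₂ := 6) (a₃ := -6) (by norm_num)
    (by norm_num) (by norm_num) (by norm_num) (by norm_num) (by norm_num)
    (by push_cast; linear_combination hξ)

/-! ### Maps of degree four and five whose reciprocal has its only pole at infinity. -/

instance {g : ℕ} (S : HyperellipticCurve g) : CharZero S.FunctionField :=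
  charZero_of_injective_algebraMap (algebraMap ℂ S.FunctionField).injective

/-- `1/β` has a fourfold pole at infinity. Its norm is `36(x + 5ξ²/108)³(x - 67ξ²/108)`, and the
norm of `1/β - 1` is `36(x - 13ξ²/108)⁴`. -/
theorem belyiPair_4_4_31 {ξ : ℂ} (hξ : ξ ^ 4 - 2 = 0) :
    IsQuarticBelyiPairOfGenus 1 ξ
      (X ^ 3 + C (47 / 1944) * X + C (2359 / 314928 * ξ ^ 2))
      (fun S => 1 / (467 / 972 + (ξ ^ 2 / 9) • S.x - 6 * S.x ^ 2 - (4 * ξ) • S.y))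
      {4} {4} {3, 1} := by
  refine .intro (finrank_adjoin_of_sub_two hξ) rfl (a := 47 / 1944) (b := 2359 / 314928 * ξ ^ 2)
    (ne_of_mul_sub_eq_one (z := 324)
    (by linear_combination (5564881 / 11337408) * hξ))
    ?_ ?_ (fun S H => ?_) (fun S F hx hy hc => ?_)
  · exact div_mem (ofNat_mem _ _) (ofNat_mem _ _)
  · exact mul_mem (div_mem (ofNat_mem _ _) (ofNat_mem _ _))
      (pow_mem (mem_adjoin_simple_self ℚ ξ) 2)
  · have e : 1 / (467 / 972 + (ξ ^ 2 / 9) • S.x - 6 * S.x ^ 2 - (4 * ξ) • S.y) =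
        (linearForm S.x S.y (C (467 / 972) + C (1 / 9 * ξ ^ 2) * X + C (-6) * X ^ 2)
          (C (-4 * ξ) + C 0 * X))⁻¹ := by
      rw [one_div]
      congr 1
      simp only [linearForm, map_add, map_mul, map_neg, map_pow, map_div₀, map_ofNat,
        map_one, map_zero, aeval_C, aeval_X, Algebra.smul_def]
      ring
    rw [e]
    have hD : ∀ s y : ℂ, y ^ 2 = s ^ 3 + (47 / 1944) * s + (2359 / 314928 * ξ ^ 2) →
        2 * 0 * (s ^ 3 + (47 / 1944) * s + (2359 / 314928 * ξ ^ 2)) + ((-4 * ξ) + 0 * s) *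
            (3 * s ^ 2 + (47 / 1944)) + 2 * ((1 / 9 * ξ ^ 2) + 2 * (-6) * s) * y = 0 →
        (467 / 972) + (1 / 9 * ξ ^ 2) * s + (-6) * s ^ 2 + ((-4 * ξ) + 0 * s) * y = 0 ∨ (467
            / 972) + (1 / 9 * ξ ^ 2) * s + (-6) * s ^ 2 + ((-4 * ξ) + 0 * s) * y = 1 := by
      intro s y hy hD
      -- Multiplying the critical equation by its conjugate eliminates `y`. Up to a constant the
      -- result is this product, whose roots are the multiple roots of the two norms, with exponents
      -- lowered by one.
      have hN : (s + (5 / 108 * ξ ^ 2)) ^ 2 * (s + (-13 / 108 * ξ ^ 2)) ^ 3 = 0 := by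
        linear_combination (1 / 2592 * ξ ^ 2 * y + 1 / 48 * ξ * s ^ 2 + 47 / 279936 * ξ - 1
            / 24 * s * y) * hD + (-1 / 11664 * ξ ^ 4 + 1 / 54 * ξ ^ 2 * s - s ^ 2) * hy +
            (-54925 / 14693280768 * ξ ^ 6 - 9295 / 136048896 * ξ ^ 4 * s + 949 / 629856 * ξ ^ 2
            * s ^ 2 - 2209 / 272097792 * ξ ^ 2 + 47 / 3888 * s ^ 3) * hξ
      rcases mul_eq_zero.mp hN with h1 | h1
      · replace h1 := pow_eq_zero_iff (by norm_num) |>.mp h1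
        exact Or.inl (by linear_combination (-3 / 2 * ξ ^ 3) * hD + (5 / 6 * ξ ^ 6 - 18 * ξ
            ^ 4 * s - 36 * ξ ^ 3 * y + 7 / 18 * ξ ^ 2 - 6 * s) * h1 + (-25 / 648 * ξ ^ 4 + 2 * ξ
            * y - 467 / 1944) * hξ)
      · replace h1 := pow_eq_zero_iff (by norm_num) |>.mp h1
        exact Or.inr (by linear_combination (3 / 4 * ξ ^ 3) * hD + (13 / 12 * ξ ^ 6 + 9 * ξ
            ^ 4 * s + 18 * ξ ^ 3 * y - 11 / 18 * ξ ^ 2 - 6 * s) * h1 + (169 / 1296 * ξ ^ 4 + 2 *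
            ξ * y + 505 / 1944) * hξ)
    have hp00 : (467 / 972) + (1 / 9 * ξ ^ 2) * (-5 / 108 * ξ ^ 2) + (-6) * (-5 / 108 * ξ ^
        2) ^ 2 ≠ 0 := ne_of_mul_sub_eq_one (z := 9 / 4)
      (by linear_combination (-35 / 864) * hξ)
    have hq00 : (-4 * ξ) + 0 * (-5 / 108 * ξ ^ 2) ≠ 0 := ne_of_mul_sub_eq_one (z := -1 / 8 *
        ξ ^ 3)
      (by linear_combination (1 / 2) * hξ)
    have hp01 : (467 / 972) + (1 / 9 * ξ ^ 2) * (67 / 108 * ξ ^ 2) + (-6) * (67 / 108 * ξ ^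
        2) ^ 2 ≠ 0 := ne_of_mul_sub_eq_one (z := -1 / 4)
      (by linear_combination (4355 / 7776) * hξ)
    have hq01 : (-4 * ξ) + 0 * (67 / 108 * ξ ^ 2) ≠ 0 := ne_of_mul_sub_eq_one (z := -1 / 8 *
        ξ ^ 3)
      (by linear_combination (1 / 2) * hξ)
    have he0 : (36 : ℂ) ≠ 0 := ne_of_mul_sub_eq_one (z := 1 / 36)
      (by linear_combination (0) * hξ)
    have hN0 : ∀ t : ℂ, ((467 / 972) + (1 / 9 * ξ ^ 2) * t + (-6) * t ^ 2) ^ 2 - ((-4 * ξ) +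
        0 * t) ^ 2 * (t ^ 3 + (47 / 1944) * t + (2359 / 314928 * ξ ^ 2)) =
        (36) * ∏ i, (t - ![-5 / 108 * ξ ^ 2, 67 / 108 * ξ ^ 2] i) ^ ![3, 1] i := by
      intro t
      rw [Fin.prod_univ_two]
      change _ = (36) * ((t - (-5 / 108 * ξ ^ 2)) ^ 3 * (t - (67 / 108 * ξ ^ 2)) ^ 1)
      linear_combination (8375 / 3779136 * ξ ^ 4 + 1225 / 8748 * ξ ^ 2 * t + 467 / 162 * t ^
          2 - 218089 / 1889568) * hξ
    have ha001 : -5 / 108 * ξ ^ 2 ≠ 67 / 108 * ξ ^ 2 := ne_of_mul_sub_eq_one (z := -3 / 4 *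
        ξ ^ 2)
      (by linear_combination (1 / 2) * hξ)
    have hp10 : (467 / 972) + (1 / 9 * ξ ^ 2) * (13 / 108 * ξ ^ 2) + (-6) * (13 / 108 * ξ ^
        2) ^ 2 ≠ 1 := ne_of_mul_sub_eq_one (z := -3 / 2)
      (by linear_combination (143 / 1296) * hξ)
    have hq10 : (-4 * ξ) + 0 * (13 / 108 * ξ ^ 2) ≠ 0 := ne_of_mul_sub_eq_one (z := -1 / 8 *
        ξ ^ 3)
      (by linear_combination (1 / 2) * hξ)
    have he1 : (36 : ℂ) ≠ 0 := ne_of_mul_sub_eq_one (z := 1 / 36)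
      (by linear_combination (0) * hξ)
    have hN1 : ∀ t : ℂ, ((467 / 972) + (1 / 9 * ξ ^ 2) * t + (-6) * t ^ 2 - 1) ^ 2 - ((-4 *
        ξ) + 0 * t) ^ 2 * (t ^ 3 + (47 / 1944) * t + (2359 / 314928 * ξ ^ 2)) =
        (36) * ∏ i, (t - ![13 / 108 * ξ ^ 2] i) ^ ![4] i := by
      intro t
      rw [Fin.prod_univ_one]
      change _ = (36) * ((t - (13 / 108 * ξ ^ 2)) ^ 4)
      linear_combination (-28561 / 3779136 * ξ ^ 4 + 2197 / 8748 * ξ ^ 2 * t - 505 / 162 * t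
          ^ 2 - 255025 / 1889568) * hξ
    exact IsBelyiMap.inv_and_hasPassport_inv
      (H.isBelyi_of_norm_cubic (Or.inl ⟨rfl, by norm_num, rfl⟩)
      (A₀ := ![-5 / 108 * ξ ^ 2, 67 / 108 * ξ ^ 2]) (k₀ := ![3, 1]) (e₀ := 36)
      (A₁ := ![13 / 108 * ξ ^ 2]) (k₁ := ![4]) (e₁ := 36)
      hD he0 (injective_pair ha001) (fun i => by fin_cases i <;> norm_num) hN0
        (Fin.forall_fin_two.mpr ⟨hp00, hp01⟩) (Fin.forall_fin_two.mpr ⟨hq00, hq01⟩)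
      he1 (Function.injective_of_subsingleton _) (fun i => by fin_cases i; norm_num) hN1
        (fun i => by fin_cases i; exact hp10) (fun i => by fin_cases i; exact hq10))
  · simp only [Algebra.smul_def]
    repeat' with_reducible_and_instances (first
        | exact hx | exact hy | exact ofNat_mem _ _ | exact one_mem _ | exact mem_adjoin_simple_self ℚ ξ
        | apply add_mem | apply sub_mem | apply div_mem | apply mul_mem | apply neg_mem | apply pow_mem
        | apply hc)

-- `1/β` has a fivefold pole at infinity. Its norm has one triple root in `ℚ(ξ)` and two simple
-- roots, conjugate roots of a quadratic over `ℚ(ξ)`; the norm of `1/β - 1` is a constant times a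
-- fifth power.
set_option maxHeartbeats 1000000 in
theorem belyiPair_5_5_311 {ξ : ℂ} (hξ : ξ ^ 4 - 2 * ξ ^ 3 - 6 * ξ ^ 2 - 8 * ξ + 16 = 0) :
    IsQuarticBelyiPairOfGenus 1 ξ
      (X ^ 3 + C (25 / 324) * X
        + C (1 / 839808 * (-1975 * ξ ^ 3 + 3950 * ξ ^ 2 + 19750 * ξ + 7900)))
      (fun S => -24300 /
        (25 * (-424 + 3888 * S.x ^ 2 + (9 * (2 + ξ) * (-2 + (-4 + ξ) * ξ)) • S.x)
          + 108 * S.y * (algebraMap ℂ _ (50 * (-8 + ξ * (-2 + (-2 + ξ) * ξ)))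
            + (9 * (-32 + ξ * (-18 + ξ * (6 + ξ)))) • S.x)))
      {5} {5} {3, 1, 1} := by
  refine .intro (finrank_adjoin_of_quartic hξ) rfl (a := 25 / 324)
    (b := 1 / 839808 * (-1975 * ξ ^ 3 + 3950 * ξ ^ 2 + 19750 * ξ + 7900))
    (ne_of_mul_sub_eq_one (z := 82944 / 3125)
    (by linear_combination (6241 / 1574640 * ξ ^ 2 - 6241 / 787320 * ξ - 43687 / 787320) * hξ))
    ?_ ?_ (fun S H => ?_) (fun S F hx hy hc => ?_)
  · exact div_mem (ofNat_mem _ _) (ofNat_mem _ _)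
  · repeat' with_reducible_and_instances (first
        | exact ofNat_mem _ _ | exact one_mem _ | exact mem_adjoin_simple_self ℚ ξ
        | apply add_mem | apply div_mem | apply mul_mem | apply neg_mem | apply pow_mem)
  · have e : -24300 /
        (25 * (-424 + 3888 * S.x ^ 2 + (9 * (2 + ξ) * (-2 + (-4 + ξ) * ξ)) • S.x)
          + 108 * S.y * (algebraMap ℂ _ (50 * (-8 + ξ * (-2 + (-2 + ξ) * ξ)))
            + (9 * (-32 + ξ * (-18 + ξ * (6 + ξ)))) • S.x)) =
        (linearForm S.x S.y (C (106 / 243) + C (-1 / 108 * ξ ^ 3 + 1 / 54 * ξ ^ 2 + 5 / 54 * ξ + 1 / 27) * X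
            + C (-4) * X ^ 2)
          (C (-2 / 9 * ξ ^ 3 + 4 / 9 * ξ ^ 2 + 4 / 9 * ξ + 16 / 9)
            + C (-1 / 25 * ξ ^ 3 - 6 / 25 * ξ ^ 2 + 18 / 25 * ξ + 32 / 25) * X))⁻¹ := by
      rw [← inv_div]
      congr 1
      simp only [linearForm, map_add, map_mul, map_sub, map_neg, map_pow, map_div₀, map_ofNat,
        map_one, aeval_C, aeval_X, Algebra.smul_def]
      ring
    rw [e]
    -- `r` and `s` are the `x`-coordinates of the two simple poles of `β`. Only the quadratic they
    -- satisfy is used afterwards.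
    obtain ⟨r, s, hrs, hr, hs, hquad⟩ := exists_roots_quadratic (α := 41 / 216 * ξ ^ 3 - 41
        / 108 * ξ ^ 2 - 205 / 108 * ξ - 41 / 54) (β := 905 / 243)
      (ne_of_mul_sub_eq_one (z := -4 / 25) (by linear_combination (-1681 / 291600 * ξ ^ 2 +
          1681 / 145800 * ξ + 11767 / 145800) * hξ))
    have hD : ∀ s y : ℂ, y ^ 2 = s ^ 3 + (25 / 324) * s + (1 / 839808 * (-1975 * ξ ^ 3 +
        3950 * ξ ^ 2 + 19750 * ξ + 7900)) →
        2 * (-1 / 25 * ξ ^ 3 - 6 / 25 * ξ ^ 2 + 18 / 25 * ξ + 32 / 25) * (s ^ 3 + (25 / 324)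
            * s + (1 / 839808 * (-1975 * ξ ^ 3 + 3950 * ξ ^ 2 + 19750 * ξ + 7900))) + ((-2 / 9 *
            ξ ^ 3 + 4 / 9 * ξ ^ 2 + 4 / 9 * ξ + 16 / 9) + (-1 / 25 * ξ ^ 3 - 6 / 25 * ξ ^ 2 + 18
            / 25 * ξ + 32 / 25) * s) * (3 * s ^ 2 + (25 / 324)) + 2 * ((-1 / 108 * ξ ^ 3 + 1 /
            54 * ξ ^ 2 + 5 / 54 * ξ + 1 / 27) + 2 * (-4) * s) * y = 0 →
        (106 / 243) + (-1 / 108 * ξ ^ 3 + 1 / 54 * ξ ^ 2 + 5 / 54 * ξ + 1 / 27) * s + (-4) *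
            s ^ 2 + ((-2 / 9 * ξ ^ 3 + 4 / 9 * ξ ^ 2 + 4 / 9 * ξ + 16 / 9) + (-1 / 25 * ξ ^ 3 -
            6 / 25 * ξ ^ 2 + 18 / 25 * ξ + 32 / 25) * s) * y = 0 ∨ (106 / 243) + (-1 / 108 * ξ ^
            3 + 1 / 54 * ξ ^ 2 + 5 / 54 * ξ + 1 / 27) * s + (-4) * s ^ 2 + ((-2 / 9 * ξ ^ 3 + 4
            / 9 * ξ ^ 2 + 4 / 9 * ξ + 16 / 9) + (-1 / 25 * ξ ^ 3 - 6 / 25 * ξ ^ 2 + 18 / 25 * ξ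
            + 32 / 25) * s) * y = 1 := by
      intro s y hy hD
      -- The norm of the critical equation, up to a constant: exponents `3 - 1` and `5 - 1`, while
      -- the simple roots `r`, `s` contribute nothing.
      have hN : (s + (-1 / 108 * ξ ^ 3 + 1 / 54 * ξ ^ 2 + 5 / 54 * ξ + 1 / 27)) ^ 2 * (s +
          (7 / 216 * ξ ^ 3 - 7 / 108 * ξ ^ 2 - 35 / 108 * ξ - 7 / 54)) ^ 4 = 0 := by
        linear_combination (-79 / 483729408 * ξ ^ 9 - 79 / 241864704 * ξ ^ 8 + 2291 /
            241864704 * ξ ^ 7 + 1 / 5760 * ξ ^ 6 * s ^ 3 + 1 / 1728 * ξ ^ 6 * s ^ 2 + 1 / 124416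
            * ξ ^ 6 * s - 1 / 62208 * ξ ^ 6 * y + 379 / 20155392 * ξ ^ 6 + 1 / 1440 * ξ ^ 5 * s
            ^ 3 - 1 / 432 * ξ ^ 5 * s ^ 2 + 1 / 31104 * ξ ^ 5 * s + 1 / 15552 * ξ ^ 5 * y -
            21499 / 120932352 * ξ ^ 5 - 1 / 144 * ξ ^ 4 * s ^ 3 - 1 / 216 * ξ ^ 4 * s ^ 2 - 5 /
            15552 * ξ ^ 4 * s + 1 / 3888 * ξ ^ 4 * y - 14231 / 60466176 * ξ ^ 4 - 1 / 96 * ξ ^ 3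
            * s ^ 3 + 1 / 144 * ξ ^ 3 * s ^ 2 - 1 / 72 * ξ ^ 3 * s * y - 5 / 10368 * ξ ^ 3 * s -
            1 / 1944 * ξ ^ 3 * y + 12211 / 20155392 * ξ ^ 3 + 11 / 288 * ξ ^ 2 * s ^ 3 + 11 /
            432 * ξ ^ 2 * s ^ 2 + 1 / 36 * ξ ^ 2 * s * y + 55 / 31104 * ξ ^ 2 * s - 29 / 15552 *
            ξ ^ 2 * y + 11191 / 7558272 * ξ ^ 2 + 49 / 720 * ξ * s ^ 3 + 11 / 216 * ξ * s ^ 2 +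
            5 / 36 * ξ * s * y + 49 / 15552 * ξ * s - 5 / 3888 * ξ * y + 26831 / 15116544 * ξ +
            1 / 45 * s ^ 3 + 1 / 54 * s ^ 2 + 1 / 18 * s * y + 1 / 972 * s - 1 / 3888 * y + 529
            / 944784) * hD + (-1 / 3359232 * ξ ^ 9 + 1 / 559872 * ξ ^ 8 + 1 / 186624 * ξ ^ 7 - 1
            / 1944 * ξ ^ 6 * s - 25 / 839808 * ξ ^ 6 + 1 / 486 * ξ ^ 5 * s - 19 / 279936 * ξ ^ 5
            + 2 / 243 * ξ ^ 4 * s + 17 / 139968 * ξ ^ 4 - 2 / 9 * ξ ^ 3 * s ^ 2 - 4 / 243 * ξ ^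
            3 * s + 179 / 419904 * ξ ^ 3 + 4 / 9 * ξ ^ 2 * s ^ 2 - 29 / 486 * ξ ^ 2 * s + 1 /
            2592 * ξ ^ 2 + 20 / 9 * ξ * s ^ 2 - 10 / 243 * ξ * s + 5 / 34992 * ξ + 8 / 9 * s ^ 2
            - 2 / 243 * s + 1 / 52488) * hy + (2401 / 25389989167104 * ξ ^ 14 - 12005 /
            12694994583552 * ξ ^ 13 - 16807 / 12694994583552 * ξ ^ 12 - 343 / 39182082048 * ξ ^
            11 * s + 6460129 / 203119913336832 * ξ ^ 11 + 343 / 4897760256 * ξ ^ 10 * s + 179113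
            / 25389989167104 * ξ ^ 10 + 1715 / 9795520512 * ξ ^ 9 * s - 23847185 /
            50779978334208 * ξ ^ 9 - 79 / 1209323520 * ξ ^ 8 * s ^ 3 - 265 / 241864704 * ξ ^ 8 *
            s ^ 2 - 151157 / 78364164096 * ξ ^ 8 * s - 1561441 / 5642219814912 * ξ ^ 8 - 79 /
            120932352 * ξ ^ 7 * s ^ 3 + 1753 / 362797056 * ξ ^ 7 * s ^ 2 - 97225 / 39182082048 *
            ξ ^ 7 * s + 3145949 / 940369969152 * ξ ^ 7 + 1501 / 604661760 * ξ ^ 6 * s ^ 3 +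
            11273 / 362797056 * ξ ^ 6 * s ^ 2 + 781055 / 39182082048 * ξ ^ 6 * s + 14768381 /
            2821109907456 * ξ ^ 6 + 1 / 28800 * ξ ^ 5 * s ^ 6 + 1 / 4320 * ξ ^ 5 * s ^ 5 + 121 /
            311040 * ξ ^ 5 * s ^ 4 + 11519 / 151165440 * ξ ^ 5 * s ^ 3 - 30361 / 362797056 * ξ ^
            5 * s ^ 2 + 333553 / 9795520512 * ξ ^ 5 * s - 32694533 / 6347497291776 * ξ ^ 5 + 1 /
            2400 * ξ ^ 4 * s ^ 6 + 1 / 1080 * ξ ^ 4 * s ^ 5 - 13 / 8640 * ξ ^ 4 * s ^ 4 - 5263 /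
            60466176 * ξ ^ 4 * s ^ 3 - 79205 / 181398528 * ξ ^ 4 * s ^ 2 - 1184905 / 19591041024
            * ξ ^ 4 * s - 333949817 / 12694994583552 * ξ ^ 4 - 1 / 7200 * ξ ^ 3 * s ^ 6 - 1 /
            120 * ξ ^ 3 * s ^ 5 - 121 / 77760 * ξ ^ 3 * s ^ 4 - 233491 / 151165440 * ξ ^ 3 * s ^
            3 + 17035 / 45349632 * ξ ^ 3 * s ^ 2 - 1972133 / 9795520512 * ξ ^ 3 * s - 563010607
            / 12694994583552 * ξ ^ 3 - 83 / 7200 * ξ ^ 2 * s ^ 6 - 1 / 120 * ξ ^ 2 * s ^ 5 + 307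
            / 77760 * ξ ^ 2 * s ^ 4 + 22511 / 30233088 * ξ ^ 2 * s ^ 3 + 22903 / 11337408 * ξ ^
            2 * s ^ 2 - 2117975 / 9795520512 * ξ ^ 2 * s - 259449157 / 6347497291776 * ξ ^ 2 -
            13 / 2400 * ξ * s ^ 6 + 29 / 1080 * ξ * s ^ 5 - 17 / 2880 * ξ * s ^ 4 + 69733 /
            9447840 * ξ * s ^ 3 + 87679 / 90699264 * ξ * s ^ 2 - 72527 / 612220032 * ξ * s -
            76164973 / 3173748645888 * ξ + 193 / 3600 * s ^ 6 + 7 / 540 * s ^ 5 - 137 / 38880 *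
            s ^ 4 + 114577 / 37791360 * s ^ 3 + 1157 / 15116544 * s ^ 2 - 61037 / 2448880128 * s
            - 8898721 / 1586874322944) * hξ
      rcases mul_eq_zero.mp hN with h1 | h1
      · replace h1 := pow_eq_zero_iff (by norm_num) |>.mp h1
        exact Or.inl (by linear_combination (1 / 1000 * ξ ^ 6 * s + 1 / 180 * ξ ^ 6 + 1 /
            250 * ξ ^ 5 * s - 1 / 45 * ξ ^ 5 - 1 / 25 * ξ ^ 4 * s - 2 / 45 * ξ ^ 4 - 3 / 50 * ξ
            ^ 3 * s + 1 / 15 * ξ ^ 3 + 11 / 50 * ξ ^ 2 * s + 11 / 45 * ξ ^ 2 + 49 / 125 * ξ * s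
            + 22 / 45 * ξ + 16 / 125 * s + 8 / 45) * hD + (1 / 6298560000 * ξ ^ 18 + 1 /
            1574640000 * ξ ^ 17 - 7 / 393660000 * ξ ^ 16 + 1 / 58320000 * ξ ^ 15 * s + 17 /
            157464000 * ξ ^ 15 + 1 / 9720000 * ξ ^ 14 * s + 233 / 524880000 * ξ ^ 14 - 1 /
            648000 * ξ ^ 13 * s - 37 / 3645000 * ξ ^ 13 + 1 / 540000 * ξ ^ 12 * s ^ 2 + 47 /
            4860000 * ξ ^ 12 * s + 325403 / 6298560000 * ξ ^ 12 + 1 / 67500 * ξ ^ 11 * s ^ 2 +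
            127 / 2430000 * ξ ^ 11 * s - 14329 / 157464000 * ξ ^ 11 - 2 / 16875 * ξ ^ 10 * s ^ 2
            - 73 / 81000 * ξ ^ 10 * s - 100169 / 393660000 * ξ ^ 10 + 1 / 5000 * ξ ^ 9 * s ^ 3 +
            13 / 13500 * ξ ^ 9 * s ^ 2 + 63551 / 14580000 * ξ ^ 9 * s + 1 / 6000 * ξ ^ 9 * y +
            1015243 / 787320000 * ξ ^ 9 + 1 / 500 * ξ ^ 8 * s ^ 3 + 29 / 4500 * ξ ^ 8 * s ^ 2 -
            4739 / 486000 * ξ ^ 8 * s + 1 / 3000 * ξ ^ 8 * y + 1431953 / 787320000 * ξ ^ 8 - 17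
            / 2500 * ξ ^ 7 * s ^ 3 - 847 / 11250 * ξ ^ 7 * s ^ 2 - 20171 / 2430000 * ξ ^ 7 * s -
            29 / 3000 * ξ ^ 7 * y - 2808031 / 393660000 * ξ ^ 7 - 101 / 1250 * ξ ^ 6 * s ^ 3 -
            47 / 3750 * ξ ^ 6 * s ^ 2 + 2 / 125 * ξ ^ 6 * s * y + 95647 / 3645000 * ξ ^ 6 * s +
            191 / 2250 * ξ ^ 6 * y - 9090361 / 393660000 * ξ ^ 6 + 113 / 1250 * ξ ^ 5 * s ^ 3 +
            3289 / 5625 * ξ ^ 5 * s ^ 2 + 8 / 125 * ξ ^ 5 * s * y + 174691 / 1215000 * ξ ^ 5 * s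
            - 1057 / 4500 * ξ ^ 5 * y + 111193 / 21870000 * ξ ^ 5 + 509 / 625 * ξ ^ 4 * s ^ 3 +
            1531 / 2250 * ξ ^ 4 * s ^ 2 - 16 / 25 * ξ ^ 4 * s * y + 161579 / 607500 * ξ ^ 4 * s
            - 1333 / 2250 * ξ ^ 4 * y + 11187773 / 131220000 * ξ ^ 4 + 11 / 125 * ξ ^ 3 * s ^ 3
            - 2714 / 3375 * ξ ^ 3 * s ^ 2 - 24 / 25 * ξ ^ 3 * s * y - 3229 / 4860 * ξ ^ 3 * s +
            443 / 750 * ξ ^ 3 * y + 360827 / 3936600 * ξ ^ 3 - 1666 / 625 * ξ ^ 2 * s ^ 3 -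
            77438 / 16875 * ξ ^ 2 * s ^ 2 + 88 / 25 * ξ ^ 2 * s * y - 159139 / 101250 * ξ ^ 2 *
            s + 3182 / 1125 * ξ ^ 2 * y + 17419727 / 98415000 * ξ ^ 2 - 1856 / 625 * ξ * s ^ 3 -
            98624 / 16875 * ξ * s ^ 2 + 784 / 125 * ξ * s * y - 394832 / 151875 * ξ * s + 9076 /
            1125 * ξ * y + 9666457 / 24603750 * ξ - 512 / 625 * s ^ 3 - 30208 / 16875 * s ^ 2 +
            256 / 125 * s * y - 2241572 / 455625 * s + 4544 / 1125 * y + 1795277 / 12301875) *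
            h1 + (1 / 680244480000 * ξ ^ 17 + 1 / 170061120000 * ξ ^ 16 - 29 / 170061120000 * ξ
            ^ 15 + 11 / 11337408000 * ξ ^ 14 + 53 / 11337408000 * ξ ^ 13 - 2773 / 28343520000 *
            ξ ^ 12 + 315707 / 680244480000 * ξ ^ 11 - 43601 / 85030560000 * ξ ^ 10 - 142067 /
            34012224000 * ξ ^ 9 + 1 / 648000 * ξ ^ 8 * y + 108613 / 6802444800 * ξ ^ 8 + 1 /
            324000 * ξ ^ 7 * y + 51821 / 3401222400 * ξ ^ 7 - 31 / 324000 * ξ ^ 6 * y - 709949 /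
            17006112000 * ξ ^ 6 + 47 / 54000 * ξ ^ 5 * y - 118691 / 1417176000 * ξ ^ 5 - 1 / 432
            * ξ ^ 4 * y - 913351 / 944784000 * ξ ^ 4 - 89 / 9000 * ξ ^ 3 * y + 361397 /
            2834352000 * ξ ^ 3 + 1333 / 81000 * ξ ^ 2 * y + 49096513 / 21257640000 * ξ ^ 2 +
            1291 / 40500 * ξ * y + 49797881 / 10628820000 * ξ + 1022 / 10125 * y + 133571473 /
            5314410000) * hξ)
      · replace h1 := pow_eq_zero_iff (by norm_num) |>.mp h1
        exact Or.inr (by linear_combination (-1 / 3000 * ξ ^ 6 * s - 1 / 540 * ξ ^ 6 - 1 /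
            750 * ξ ^ 5 * s + 1 / 135 * ξ ^ 5 + 1 / 75 * ξ ^ 4 * s + 2 / 135 * ξ ^ 4 + 1 / 50 *
            ξ ^ 3 * s - 1 / 45 * ξ ^ 3 - 11 / 150 * ξ ^ 2 * s - 11 / 135 * ξ ^ 2 - 49 / 375 * ξ
            * s - 22 / 135 * ξ - 16 / 375 * s - 8 / 135) * hD + (343 / 151165440000 * ξ ^ 18 +
            343 / 37791360000 * ξ ^ 17 - 2401 / 9447840000 * ξ ^ 16 - 49 / 699840000 * ξ ^ 15 *
            s - 4753 / 3779136000 * ξ ^ 15 - 49 / 116640000 * ξ ^ 14 * s + 150479 / 12597120000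
            * ξ ^ 14 + 49 / 7776000 * ξ ^ 13 * s + 1813 / 29160000 * ξ ^ 13 + 7 / 3240000 * ξ ^
            12 * s ^ 2 + 2737 / 58320000 * ξ ^ 12 * s - 5318297 / 18895680000 * ξ ^ 12 + 7 /
            405000 * ξ ^ 11 * s ^ 2 - 6223 / 29160000 * ξ ^ 11 * s - 347953 / 236196000 * ξ ^ 11
            - 7 / 50625 * ξ ^ 10 * s ^ 2 - 1799 / 972000 * ξ ^ 10 * s + 31126213 / 9447840000 *
            ξ ^ 10 - 1 / 15000 * ξ ^ 9 * s ^ 3 - 1 / 648 * ξ ^ 9 * s ^ 2 + 132919 / 43740000 * ξ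
            ^ 9 * s + 1 / 6000 * ξ ^ 9 * y + 18891649 / 1180980000 * ξ ^ 9 - 1 / 1500 * ξ ^ 8 *
            s ^ 3 + 59 / 27000 * ξ ^ 8 * s ^ 2 + 46931 / 1458000 * ξ ^ 8 * s + 1 / 3000 * ξ ^ 8
            * y - 12127247 / 2361960000 * ξ ^ 8 + 17 / 7500 * ξ ^ 7 * s ^ 3 + 3071 / 67500 * ξ ^
            7 * s ^ 2 - 210263 / 14580000 * ξ ^ 7 * s - 29 / 3000 * ξ ^ 7 * y - 12329077 /
            147622500 * ξ ^ 7 + 101 / 3750 * ξ ^ 6 * s ^ 3 - 569 / 22500 * ξ ^ 6 * s ^ 2 - 2 /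
            375 * ξ ^ 6 * s * y - 4154579 / 21870000 * ξ ^ 6 * s - 227 / 6750 * ξ ^ 6 * y -
            309458527 / 2361960000 * ξ ^ 6 - 113 / 3750 * ξ ^ 5 * s ^ 3 - 11897 / 33750 * ξ ^ 5
            * s ^ 2 - 8 / 375 * ξ ^ 5 * s * y - 1715717 / 7290000 * ξ ^ 5 * s + 3229 / 13500 * ξ
            ^ 5 * y + 3099263 / 65610000 * ξ ^ 5 - 509 / 1875 * ξ ^ 4 * s ^ 3 - 679 / 2700 * ξ ^
            4 * s ^ 2 + 16 / 75 * ξ ^ 4 * s * y + 723677 / 3645000 * ξ ^ 4 * s + 2401 / 6750 * ξ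
            ^ 4 * y + 199779553 / 393660000 * ξ ^ 4 - 11 / 375 * ξ ^ 3 * s ^ 3 + 7133 / 10125 *
            ξ ^ 3 * s ^ 2 + 8 / 25 * ξ ^ 3 * s * y + 237503 / 182250 * ξ ^ 3 * s - 1871 / 2250 *
            ξ ^ 3 * y + 58034831 / 59049000 * ξ ^ 3 + 1666 / 1875 * ξ ^ 2 * s ^ 3 + 106967 /
            50625 * ξ ^ 2 * s ^ 2 - 88 / 75 * ξ ^ 2 * s * y + 274772 / 151875 * ξ ^ 2 * s - 8054
            / 3375 * ξ ^ 2 * y + 171474757 / 295245000 * ξ ^ 2 + 1856 / 1875 * ξ * s ^ 3 +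
            112736 / 50625 * ξ * s ^ 2 - 784 / 375 * ξ * s * y + 679232 / 455625 * ξ * s - 7972
            / 3375 * ξ * y - 58540723 / 73811250 * ξ + 512 / 1875 * s ^ 3 + 32512 / 50625 * s ^
            2 - 256 / 375 * s * y - 4904428 / 1366875 * s + 832 / 3375 * y - 14896703 /
            36905625) * h1 + (-2401 / 32651735040000 * ξ ^ 17 - 2401 / 8162933760000 * ξ ^ 16 +
            69629 / 8162933760000 * ξ ^ 15 + 22981 / 544195584000 * ξ ^ 14 - 226037 /
            544195584000 * ξ ^ 13 - 2973467 / 1360488960000 * ξ ^ 12 + 41619851 / 4081466880000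
            * ξ ^ 11 + 55588169 / 1020366720000 * ξ ^ 10 - 51467437 / 408146688000 * ξ ^ 9 - 7 /
            1296000 * ξ ^ 8 * y - 25599053 / 40814668800 * ξ ^ 8 - 7 / 648000 * ξ ^ 7 * y +
            8713483 / 25509168000 * ξ ^ 7 + 217 / 648000 * ξ ^ 6 * y + 76582207 / 25509168000 *
            ξ ^ 6 + 121 / 108000 * ξ ^ 5 * y + 29198549 / 6802444800 * ξ ^ 5 - 37 / 4320 * ξ ^ 4
            * y + 5968057 / 2834352000 * ξ ^ 4 - 277 / 18000 * ξ ^ 3 * y - 308965531 /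
            17006112000 * ξ ^ 3 + 6869 / 162000 * ξ ^ 2 * y - 5199384341 / 127545840000 * ξ ^ 2
            + 5813 / 81000 * ξ * y - 2009712337 / 63772920000 * ξ + 1148 / 10125 * y -
            1208804171 / 31886460000) * hξ)
    have hp0q : ∀ s : ℂ, s ^ 2 + (41 / 216 * ξ ^ 3 - 41 / 108 * ξ ^ 2 - 205 / 108 * ξ - 41 /
        54) * s + (905 / 243) = 0 → (106 / 243) + (-1 / 108 * ξ ^ 3 + 1 / 54 * ξ ^ 2 + 5 / 54 *
        ξ + 1 / 27) * s + (-4) * s ^ 2 ≠ 0 := fun s hs =>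
      ne_of_mul_sub_eq_one (z := -3 / 856 * ξ ^ 3 * s + 3 / 428 * ξ ^ 2 * s + 15 / 428 * ξ *
          s + 3 / 214 * s - 113 / 1284) (by linear_combination (-9 / 3424 * ξ ^ 6 + 9 / 856 * ξ
          ^ 5 + 9 / 214 * ξ ^ 4 + 3 / 214 * ξ ^ 3 * s - 9 / 107 * ξ ^ 3 - 3 / 107 * ξ ^ 2 * s -
          261 / 856 * ξ ^ 2 - 15 / 107 * ξ * s - 45 / 214 * ξ - 6 / 107 * s + 199 / 642) * hs +
          (41 / 82176 * ξ ^ 5 * s - 41 / 20544 * ξ ^ 4 * s - 205 / 20544 * ξ ^ 3 * s + 451 /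
          20544 * ξ ^ 2 * s + 905 / 92448 * ξ ^ 2 + 1517 / 20544 * ξ * s - 905 / 46224 * ξ + 287
          / 10272 * s - 6335 / 46224) * hξ)
    have hq0q : ∀ s : ℂ, s ^ 2 + (41 / 216 * ξ ^ 3 - 41 / 108 * ξ ^ 2 - 205 / 108 * ξ - 41 /
        54) * s + (905 / 243) = 0 → (-2 / 9 * ξ ^ 3 + 4 / 9 * ξ ^ 2 + 4 / 9 * ξ + 16 / 9) + (-1
        / 25 * ξ ^ 3 - 6 / 25 * ξ ^ 2 + 18 / 25 * ξ + 32 / 25) * s ≠ 0 := fun s hs =>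
      ne_of_mul_sub_eq_one (z := 1 / 192 * ξ ^ 3 * s - 61 / 10368 * ξ ^ 3 - 1 / 96 * ξ ^ 2 *
          s - 61 / 1728 * ξ ^ 2 - 1 / 96 * ξ * s + 61 / 576 * ξ - 1 / 24 * s + 61 / 324) (by
          linear_combination (-1 / 4800 * ξ ^ 6 - 1 / 1200 * ξ ^ 5 + 1 / 150 * ξ ^ 4 + 1 / 300 *
          ξ ^ 3 - 13 / 1200 * ξ ^ 2 - 13 / 300 * ξ - 4 / 75) * hs + (41 / 1036800 * ξ ^ 5 * s +
          41 / 259200 * ξ ^ 4 * s - 41 / 28800 * ξ ^ 3 * s - 19 / 8100 * ξ ^ 2 * s + 1 / 480 * ξ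
          ^ 2 + 881 / 86400 * ξ * s + 1 / 80 * ξ + 16 / 2025 * s - 7 / 240) * hξ)
    have hp00 : (106 / 243) + (-1 / 108 * ξ ^ 3 + 1 / 54 * ξ ^ 2 + 5 / 54 * ξ + 1 / 27) * (1
        / 108 * ξ ^ 3 - 1 / 54 * ξ ^ 2 - 5 / 54 * ξ - 1 / 27) + (-4) * (1 / 108 * ξ ^ 3 - 1 / 54
        * ξ ^ 2 - 5 / 54 * ξ - 1 / 27) ^ 2 ≠ 0 := ne_of_mul_sub_eq_one (z := 3)
      (by linear_combination (-5 / 3888 * ξ ^ 2 + 5 / 1944 * ξ + 35 / 1944) * hξ)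
    have hq00 : (-2 / 9 * ξ ^ 3 + 4 / 9 * ξ ^ 2 + 4 / 9 * ξ + 16 / 9) + (-1 / 25 * ξ ^ 3 - 6
        / 25 * ξ ^ 2 + 18 / 25 * ξ + 32 / 25) * (1 / 108 * ξ ^ 3 - 1 / 54 * ξ ^ 2 - 5 / 54 * ξ -
        1 / 27) ≠ 0 := ne_of_mul_sub_eq_one (z := -1 / 96 * ξ ^ 3 - 1 / 16 * ξ ^ 2 + 3 / 16 * ξ
        + 1 / 3)
      (by linear_combination (1 / 259200 * ξ ^ 5 + 1 / 21600 * ξ ^ 4 - 1 / 64800 * ξ ^ 3 +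
          67 / 64800 * ξ ^ 2 + 287 / 21600 * ξ - 857 / 32400) * hξ)
    have he0 : 24 / 125 * ξ ^ 3 - 48 / 125 * ξ ^ 2 - 48 / 25 * ξ - 96 / 125 ≠ 0 :=
        ne_of_mul_sub_eq_one (z := 25 / 1152 * ξ ^ 3 - 25 / 576 * ξ ^ 2 - 125 / 576 * ξ - 25 /
        288)
      (by linear_combination (1 / 240 * ξ ^ 2 - 1 / 120 * ξ - 7 / 120) * hξ)
    have hN0 : ∀ t : ℂ, ((106 / 243) + (-1 / 108 * ξ ^ 3 + 1 / 54 * ξ ^ 2 + 5 / 54 * ξ + 1 /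
        27) * t + (-4) * t ^ 2) ^ 2 - ((-2 / 9 * ξ ^ 3 + 4 / 9 * ξ ^ 2 + 4 / 9 * ξ + 16 / 9) +
        (-1 / 25 * ξ ^ 3 - 6 / 25 * ξ ^ 2 + 18 / 25 * ξ + 32 / 25) * t) ^ 2 * (t ^ 3 + (25 /
        324) * t + (1 / 839808 * (-1975 * ξ ^ 3 + 3950 * ξ ^ 2 + 19750 * ξ + 7900))) =
        (24 / 125 * ξ ^ 3 - 48 / 125 * ξ ^ 2 - 48 / 25 * ξ - 96 / 125) * ∏ i, (t - ![1 / 108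
            * ξ ^ 3 - 1 / 54 * ξ ^ 2 - 5 / 54 * ξ - 1 / 27, r, s] i) ^ ![3, 1, 1] i := by
      intro t
      rw [Fin.prod_univ_three]
      change _ = (24 / 125 * ξ ^ 3 - 48 / 125 * ξ ^ 2 - 48 / 25 * ξ - 96 / 125) * ((t - (1 /
          108 * ξ ^ 3 - 1 / 54 * ξ ^ 2 - 5 / 54 * ξ - 1 / 27)) ^ 3 * (t - r) ^ 1 * (t - s) ^ 1)
      linear_combination (41 / 1417176000 * ξ ^ 11 * t - 41 / 177147000 * ξ ^ 10 * t - 41 /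
          70858800 * ξ ^ 9 * t - 121 / 13122000 * ξ ^ 8 * t ^ 2 + 451 / 70858800 * ξ ^ 8 * t +
          181 / 318864600 * ξ ^ 8 + 121 / 2187000 * ξ ^ 7 * t ^ 2 + 287 / 35429400 * ξ ^ 7 * t -
          181 / 53144100 * ξ ^ 7 + 1331 / 6561000 * ξ ^ 6 * t ^ 2 - 11603 / 177147000 * ξ ^ 6 *
          t - 1991 / 159432300 * ξ ^ 6 + 13 / 13500 * ξ ^ 5 * t ^ 3 - 23153 / 20995200 * ξ ^ 5 *
          t ^ 2 - 173839 / 708588000 * ξ ^ 5 * t + 15667 / 85030560 * ξ ^ 5 - 13 / 3375 * ξ ^ 4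
          * t ^ 3 - 21869 / 8748000 * ξ ^ 4 * t ^ 2 + 38467 / 35429400 * ξ ^ 4 * t - 32723 /
          106288200 * ξ ^ 4 - 13 / 675 * ξ ^ 3 * t ^ 3 + 28961 / 5248800 * ξ ^ 3 * t ^ 2 + 94789
          / 35429400 * ξ ^ 3 * t - 1141 / 1417176 * ξ ^ 3 - 1 / 625 * ξ ^ 2 * t ^ 5 - 11 / 225 *
          ξ ^ 2 * t ^ 4 - 289 / 40500 * ξ ^ 2 * t ^ 3 + 824521 / 26244000 * ξ ^ 2 * t ^ 2 -
          444689 / 35429400 * ξ ^ 2 * t - 128443 / 318864600 * ξ ^ 2 - 14 / 625 * ξ * t ^ 5 - 2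
          / 45 * ξ * t ^ 4 + 539 / 2250 * ξ * t ^ 3 - 32723 / 972000 * ξ * t ^ 2 - 2395579 /
          177147000 * ξ * t - 16363 / 35429400 * ξ - 34 / 625 * t ^ 5 + 154 / 225 * t ^ 4 - 331
          / 6750 * t ^ 3 - 2902811 / 13122000 * t ^ 2 - 1343129 / 88573500 * t + 1601273 /
          159432300) * hξ + (-1 / 6561000 * ξ ^ 12 + 1 / 820125 * ξ ^ 11 + 2 / 820125 * ξ ^ 10 +
          1 / 20250 * ξ ^ 9 * t - 8 / 273375 * ξ ^ 9 - 1 / 3375 * ξ ^ 8 * t - 29 / 820125 * ξ ^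
          8 - 1 / 1125 * ξ ^ 7 * t + 224 / 820125 * ξ ^ 7 - 2 / 375 * ξ ^ 6 * t ^ 2 + 2 / 405 *
          ξ ^ 6 * t + 412 / 820125 * ξ ^ 6 + 8 / 375 * ξ ^ 5 * t ^ 2 + 38 / 3375 * ξ ^ 5 * t -
          592 / 820125 * ξ ^ 5 + 32 / 375 * ξ ^ 4 * t ^ 2 - 68 / 3375 * ξ ^ 4 * t - 2258 /
          820125 * ξ ^ 4 + 24 / 125 * ξ ^ 3 * t ^ 3 - 64 / 375 * ξ ^ 3 * t ^ 2 - 716 / 10125 * ξ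
          ^ 3 * t - 272 / 91125 * ξ ^ 3 - 48 / 125 * ξ ^ 2 * t ^ 3 - 232 / 375 * ξ ^ 2 * t ^ 2 -
          8 / 125 * ξ ^ 2 * t - 1264 / 820125 * ξ ^ 2 - 48 / 25 * ξ * t ^ 3 - 32 / 75 * ξ * t ^
          2 - 16 / 675 * ξ * t - 64 / 164025 * ξ - 96 / 125 * t ^ 3 - 32 / 375 * t ^ 2 - 32 /
          10125 * t - 32 / 820125) * hquad t
    have ha0q : ∀ s : ℂ, s ^ 2 + (41 / 216 * ξ ^ 3 - 41 / 108 * ξ ^ 2 - 205 / 108 * ξ - 41 /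
        54) * s + (905 / 243) = 0 → s ≠ 1 / 108 * ξ ^ 3 - 1 / 54 * ξ ^ 2 - 5 / 54 * ξ - 1 / 27
        := fun s hs =>
      ne_of_mul_sub_eq_one (z := -43 / 900 * ξ ^ 3 + 43 / 450 * ξ ^ 2 + 43 / 90 * ξ - 6 / 25
          * s + 43 / 225) (by linear_combination (-6 / 25) * hs + (43 / 97200 * ξ ^ 2 - 43 /
          48600 * ξ - 301 / 48600) * hξ)
    have hp10 : (106 / 243) + (-1 / 108 * ξ ^ 3 + 1 / 54 * ξ ^ 2 + 5 / 54 * ξ + 1 / 27) *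
        (-7 / 216 * ξ ^ 3 + 7 / 108 * ξ ^ 2 + 35 / 108 * ξ + 7 / 54) + (-4) * (-7 / 216 * ξ ^ 3
        + 7 / 108 * ξ ^ 2 + 35 / 108 * ξ + 7 / 54) ^ 2 ≠ 1 := ne_of_mul_sub_eq_one (z := -2 / 3)
      (by linear_combination (91 / 34992 * ξ ^ 2 - 91 / 17496 * ξ - 637 / 17496) * hξ)
    have hq10 : (-2 / 9 * ξ ^ 3 + 4 / 9 * ξ ^ 2 + 4 / 9 * ξ + 16 / 9) + (-1 / 25 * ξ ^ 3 - 6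
        / 25 * ξ ^ 2 + 18 / 25 * ξ + 32 / 25) * (-7 / 216 * ξ ^ 3 + 7 / 108 * ξ ^ 2 + 35 / 108 *
        ξ + 7 / 54) ≠ 0 := ne_of_mul_sub_eq_one (z := -1 / 144 * ξ ^ 3 - 1 / 24 * ξ ^ 2 + 1 / 8
        * ξ + 2 / 9)
      (by linear_combination (-7 / 777600 * ξ ^ 5 - 7 / 64800 * ξ ^ 4 + 7 / 194400 * ξ ^ 3 +
          881 / 194400 * ξ ^ 2 + 691 / 64800 * ξ - 3451 / 97200) * hξ)
    have he1 : 24 / 125 * ξ ^ 3 - 48 / 125 * ξ ^ 2 - 48 / 25 * ξ - 96 / 125 ≠ 0 :=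
        ne_of_mul_sub_eq_one (z := 25 / 1152 * ξ ^ 3 - 25 / 576 * ξ ^ 2 - 125 / 576 * ξ - 25 /
        288)
      (by linear_combination (1 / 240 * ξ ^ 2 - 1 / 120 * ξ - 7 / 120) * hξ)
    have hN1 : ∀ t : ℂ, ((106 / 243) + (-1 / 108 * ξ ^ 3 + 1 / 54 * ξ ^ 2 + 5 / 54 * ξ + 1 /
        27) * t + (-4) * t ^ 2 - 1) ^ 2 - ((-2 / 9 * ξ ^ 3 + 4 / 9 * ξ ^ 2 + 4 / 9 * ξ + 16 / 9)
        + (-1 / 25 * ξ ^ 3 - 6 / 25 * ξ ^ 2 + 18 / 25 * ξ + 32 / 25) * t) ^ 2 * (t ^ 3 + (25 /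
        324) * t + (1 / 839808 * (-1975 * ξ ^ 3 + 3950 * ξ ^ 2 + 19750 * ξ + 7900))) =
        (24 / 125 * ξ ^ 3 - 48 / 125 * ξ ^ 2 - 48 / 25 * ξ - 96 / 125) * ∏ i, (t - ![-7 /
            216 * ξ ^ 3 + 7 / 108 * ξ ^ 2 + 35 / 108 * ξ + 7 / 54] i) ^ ![5] i := by
      intro t
      rw [Fin.prod_univ_one]
      change _ = (24 / 125 * ξ ^ 3 - 48 / 125 * ξ ^ 2 - 48 / 25 * ξ - 96 / 125) * ((t - (-7
          / 216 * ξ ^ 3 + 7 / 108 * ξ ^ 2 + 35 / 108 * ξ + 7 / 54)) ^ 5)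
      linear_combination (-16807 / 2448880128000 * ξ ^ 14 + 16807 / 244888012800 * ξ ^ 13 +
          117649 / 1224440064000 * ξ ^ 12 - 2401 / 2267481600 * ξ ^ 11 * t - 117649 /
          51018336000 * ξ ^ 11 + 2401 / 283435200 * ξ ^ 10 * t - 16807 / 34012224000 * ξ ^ 10 +
          2401 / 113374080 * ξ ^ 9 * t + 1731121 / 51018336000 * ξ ^ 9 - 343 / 5248800 * ξ ^ 8 *
          t ^ 2 - 26411 / 113374080 * ξ ^ 8 * t + 285719 / 15305500800 * ξ ^ 8 + 343 / 874800 *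
          ξ ^ 7 * t ^ 2 - 16807 / 56687040 * ξ ^ 7 * t - 18370051 / 76527504000 * ξ ^ 7 + 3773 /
          2624400 * ξ ^ 6 * t ^ 2 + 679483 / 283435200 * ξ ^ 6 * t - 51950437 / 153055008000 * ξ
          ^ 6 - 49 / 24300 * ξ ^ 5 * t ^ 3 - 164561 / 20995200 * ξ ^ 5 * t ^ 2 + 135337 /
          35429400 * ξ ^ 5 * t + 12424841 / 25509168000 * ξ ^ 5 + 49 / 6075 * ξ ^ 4 * t ^ 3 -
          31477 / 1749600 * ξ ^ 4 * t ^ 2 - 184939 / 28343520 * ξ ^ 4 * t + 959827 / 944784000 *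
          ξ ^ 4 + 49 / 1215 * ξ ^ 3 * t ^ 3 + 205721 / 5248800 * ξ ^ 3 * t ^ 2 - 563677 /
          28343520 * ξ ^ 3 * t + 3222689 / 1275458400 * ξ ^ 3 - 1 / 625 * ξ ^ 2 * t ^ 5 - 11 /
          225 * ξ ^ 2 * t ^ 4 - 3359 / 24300 * ξ ^ 2 * t ^ 3 + 510797 / 5248800 * ξ ^ 2 * t ^ 2
          - 103903 / 2834352 * ξ ^ 2 * t + 76266763 / 19131876000 * ξ ^ 2 - 14 / 625 * ξ * t ^ 5
          - 2 / 45 * ξ * t ^ 4 - 2447 / 12150 * ξ * t ^ 3 + 3797 / 38880 * ξ * t ^ 2 - 1147637 /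
          35429400 * ξ * t + 16272527 / 4782969000 * ξ - 34 / 625 * t ^ 5 + 154 / 225 * t ^ 4 -
          2623 / 12150 * t ^ 3 + 677153 / 2624400 * t ^ 2 - 362437 / 17714700 * t + 86122159 /
          4782969000) * hξ
    have hd : -1 / 25 * ξ ^ 3 - 6 / 25 * ξ ^ 2 + 18 / 25 * ξ + 32 / 25 ≠ 0 :=
        ne_of_mul_sub_eq_one (z := -5 / 96 * ξ ^ 3 + 5 / 48 * ξ ^ 2 + 5 / 48 * ξ + 5 / 12)
      (by linear_combination (1 / 480 * ξ ^ 2 + 1 / 80 * ξ - 7 / 240) * hξ)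
    exact IsBelyiMap.inv_and_hasPassport_inv
      (H.isBelyi_of_norm_cubic (Or.inr ⟨rfl, hd⟩)
      (A₀ := ![1 / 108 * ξ ^ 3 - 1 / 54 * ξ ^ 2 - 5 / 54 * ξ - 1 / 27, r, s]) (k₀ := ![3, 1, 1])
      (e₀ := 24 / 125 * ξ ^ 3 - 48 / 125 * ξ ^ 2 - 48 / 25 * ξ - 96 / 125)
      (A₁ := ![-7 / 216 * ξ ^ 3 + 7 / 108 * ξ ^ 2 + 35 / 108 * ξ + 7 / 54]) (k₁ := ![5])
      (e₁ := 24 / 125 * ξ ^ 3 - 48 / 125 * ξ ^ 2 - 48 / 25 * ξ - 96 / 125)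
      hD he0 (injective_triple (ha0q r hr).symm (ha0q s hs).symm hrs) (fun i => by fin_cases i
        <;> norm_num) hN0 (forall_fin_three (hp00) (hp0q r hr) (hp0q s hs)) (forall_fin_three
        (hq00) (hq0q r hr) (hq0q s hs))
      he1 (Function.injective_of_subsingleton _) (fun i => by fin_cases i; norm_num) hN1
        (fun i => by fin_cases i; exact hp10) (fun i => by fin_cases i; exact hq10))
  · simp only [Algebra.smul_def]
    repeat' with_reducible_and_instances (first
        | exact hx | exact hy | exact ofNat_mem _ _ | exact one_mem _ | exact mem_adjoin_simple_self ℚ ξ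
        | apply add_mem | apply sub_mem | apply div_mem | apply mul_mem | apply neg_mem | apply pow_mem
        | apply hc)

theorem belyiPair_5_5_221 {ξ : ℂ} (hξ : ξ ^ 4 + 10 = 0) :
    IsQuarticBelyiPairOfGenus 1 ξ
      (X ^ 3 - C (5275 / 6144) * X + C (77675 / 1769472 * ξ ^ 2))
      (fun S => 1 / (17969 / 18432 - (ξ ^ 2 / 96) • S.x - S.x ^ 2
        - (algebraMap ℂ _ (-(ξ / 24)) - (4 * ξ ^ 3 / 25) • S.x) * S.y))
      {5} {5} {2, 2, 1} := by
  refine .intro (finrank_adjoin_of_add_ten hξ) (by rw [C_neg]; ring) (a := -(5275 / 6144))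
    (b := 77675 / 1769472 * ξ ^ 2)
    (ne_of_mul_sub_eq_one (z := -1024 / 3125)
    (by linear_combination (-9653449 / 566231040) * hξ))
    ?_ ?_ (fun S H => ?_) (fun S F hx hy hc => ?_)
  · exact neg_mem (div_mem (ofNat_mem _ _) (ofNat_mem _ _))
  · exact mul_mem (div_mem (ofNat_mem _ _) (ofNat_mem _ _))
      (pow_mem (mem_adjoin_simple_self ℚ ξ) 2)
  · have e : 1 / (17969 / 18432 - (ξ ^ 2 / 96) • S.x - S.x ^ 2
        - (algebraMap ℂ _ (-(ξ / 24)) - (4 * ξ ^ 3 / 25) • S.x) * S.y) =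
        (linearForm S.x S.y (C (17969 / 18432) + C (-1 / 96 * ξ ^ 2) * X + C (-1) * X ^ 2)
          (C (1 / 24 * ξ) + C (4 / 25 * ξ ^ 3) * X))⁻¹ := by
      rw [one_div]
      congr 1
      simp only [linearForm, map_add, map_mul, map_neg, map_pow, map_div₀, map_ofNat,
        map_one, aeval_C, aeval_X, Algebra.smul_def]
      ring
    rw [e]
    -- Here the two roots of the quadratic are the `x`-coordinates of the two double poles of `β`;
    -- the simple pole lies over `113ξ²/192`.
    obtain ⟨r, s, hrs, hr, hs, hquad⟩ := exists_roots_quadratic (α := 7 / 96 * ξ ^ 2) (β :=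
        -14645 / 18432)
      (ne_of_mul_sub_eq_one (z := 8 / 25) (by linear_combination (49 / 28800) * hξ))
    have hD : ∀ s y : ℂ, y ^ 2 = s ^ 3 + (-(5275 / 6144)) * s + (77675 / 1769472 * ξ ^ 2) →
        2 * (4 / 25 * ξ ^ 3) * (s ^ 3 + (-(5275 / 6144)) * s + (77675 / 1769472 * ξ ^ 2)) +
            ((1 / 24 * ξ) + (4 / 25 * ξ ^ 3) * s) * (3 * s ^ 2 + (-(5275 / 6144))) + 2 * ((-1 /
            96 * ξ ^ 2) + 2 * (-1) * s) * y = 0 →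
        (17969 / 18432) + (-1 / 96 * ξ ^ 2) * s + (-1) * s ^ 2 + ((1 / 24 * ξ) + (4 / 25 * ξ
            ^ 3) * s) * y = 0 ∨ (17969 / 18432) + (-1 / 96 * ξ ^ 2) * s + (-1) * s ^ 2 + ((1 /
            24 * ξ) + (4 / 25 * ξ ^ 3) * s) * y = 1 := by
      intro s y hy hD
      -- The quadratic appears once, for the two double poles of `β`, and the point over `1` four
      -- times.
      have hN : (s ^ 2 + (7 / 96 * ξ ^ 2) * s + (-14645 / 18432)) ^ 1 * (s + (-17 / 192 * ξ
          ^ 2)) ^ 4 = 0 := by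
        linear_combination (3107 / 14155776 * ξ ^ 7 + 1 / 80 * ξ ^ 5 * s ^ 3 - 211 / 32768 *
            ξ ^ 5 * s + 1 / 3072 * ξ ^ 4 * y + 1 / 512 * ξ ^ 3 * s ^ 2 - 5275 / 9437184 * ξ ^ 3
            + 1 / 16 * ξ ^ 2 * s * y) * hD + (1 / 147456 * ξ ^ 6 + 1 / 384 * ξ ^ 4 * s + 1 / 4 *
            ξ ^ 2 * s ^ 2) * hy + (-9653449 / 3131031158784 * ξ ^ 8 - 3107 / 8847360 * ξ ^ 6 * s
            ^ 3 + 24185419 / 130459631616 * ξ ^ 6 * s - 1 / 100 * ξ ^ 4 * s ^ 6 + 211 / 20480 *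
            ξ ^ 4 * s ^ 4 - 53783 / 18874368 * ξ ^ 4 * s ^ 2 - 5565125 / 2783138807808 * ξ ^ 4 -
            1 / 320 * ξ ^ 2 * s ^ 5 + 11813 / 1769472 * ξ ^ 2 * s ^ 3 + 1 / 10 * s ^ 6 - 2929 /
            36864 * s ^ 4) * hξ
      rcases mul_eq_zero.mp hN with h1 | h1
      · replace h1 := pow_eq_zero_iff (by norm_num) |>.mp h1
        exact Or.inl (by linear_combination (-104 / 30375 * ξ ^ 5 * s - 512 / 10125 * ξ ^ 3
            * s ^ 2 - 13 / 14580 * ξ ^ 3 - 16 / 1215 * ξ * s) * hD + (-49 / 43740000 * ξ ^ 12 +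
            7 / 455625 * ξ ^ 10 * s - 32 / 151875 * ξ ^ 8 * s ^ 2 - 1229 / 729000 * ξ ^ 8 + 2048
            / 50625 * ξ ^ 6 * s ^ 3 + 1022 / 91125 * ξ ^ 6 * s + 512 / 30375 * ξ ^ 4 * s ^ 2 +
            10757 / 1749600 * ξ ^ 4 - 2048 / 10125 * ξ ^ 3 * s * y + 2 / 1215 * ξ ^ 2 * s - 64 /
            1215 * ξ * y - 1) * h1 + (343 / 4199040000 * ξ ^ 10 * s - 143521 / 161243136000 * ξ
            ^ 8 + 61277 / 335923200 * ξ ^ 6 * s - 2125297 / 1612431360 * ξ ^ 4 - 13 / 182250 * ξ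
            ^ 3 * s * y + 70921 / 11197440 * ξ ^ 2 * s - 13 / 699840 * ξ * y + 277 / 15360) *
            hξ)
      · replace h1 := pow_eq_zero_iff (by norm_num) |>.mp h1
        exact Or.inr (by linear_combination (16 / 375 * ξ ^ 5 * s + 1 / 90 * ξ ^ 3) * hD +
            (-4913 / 207360000 * ξ ^ 14 - 289 / 1080000 * ξ ^ 12 * s - 17 / 5625 * ξ ^ 10 * s ^
            2 + 17543 / 20736000 * ξ ^ 10 - 64 / 1875 * ξ ^ 8 * s ^ 3 + 1763 / 108000 * ξ ^ 8 *
            s + 2 / 125 * ξ ^ 7 * y - 16 / 1125 * ξ ^ 6 * s ^ 2 + 827 / 138240 * ξ ^ 6 + 64 /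
            375 * ξ ^ 5 * s * y - 1 / 720 * ξ ^ 4 * s + 46 / 225 * ξ ^ 3 * y - 19 / 192 * ξ ^ 2
            - s) * h1 + (-83521 / 39813120000 * ξ ^ 12 + 47719 / 497664000 * ξ ^ 8 + 17 / 12000
            * ξ ^ 5 * y - 77669 / 132710400 * ξ ^ 4 + 1 / 240 * ξ * y - 463 / 184320) * hξ)
    have hp0q : ∀ s : ℂ, s ^ 2 + (7 / 96 * ξ ^ 2) * s + (-14645 / 18432) = 0 → (17969 /
        18432) + (-1 / 96 * ξ ^ 2) * s + (-1) * s ^ 2 ≠ 0 := fun s hs =>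
      ne_of_mul_sub_eq_one (z := -128 / 147 * ξ ^ 2 * s + 1388 / 441) (by
          linear_combination (-8 / 147 * ξ ^ 4 + 128 / 147 * ξ ^ 2 * s - 1388 / 441) * hs + (1 /
          252 * ξ ^ 2 * s - 14645 / 338688) * hξ)
    have hq0q : ∀ s : ℂ, s ^ 2 + (7 / 96 * ξ ^ 2) * s + (-14645 / 18432) = 0 → (1 / 24 * ξ)
        + (4 / 25 * ξ ^ 3) * s ≠ 0 := fun s hs =>
      ne_of_mul_sub_eq_one (z := -19 / 252 * ξ ^ 3 - 16 / 21 * ξ * s) (by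
          linear_combination (-64 / 525 * ξ ^ 4) * hs + (-1 / 315 * ξ ^ 2 * s - 1 / 10) * hξ)
    have hp02 : (17969 / 18432) + (-1 / 96 * ξ ^ 2) * (113 / 192 * ξ ^ 2) + (-1) * (113 /
        192 * ξ ^ 2) ^ 2 ≠ 0 := ne_of_mul_sub_eq_one (z := 2 / 9)
      (by linear_combination (-12995 / 165888) * hξ)
    have hq02 : (1 / 24 * ξ) + (4 / 25 * ξ ^ 3) * (113 / 192 * ξ ^ 2) ≠ 0 :=
        ne_of_mul_sub_eq_one (z := 1 / 9 * ξ ^ 3)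
      (by linear_combination (113 / 10800 * ξ ^ 4 - 1 / 10) * hξ)
    have he0 : 32 / 125 * ξ ^ 2 ≠ 0 := ne_of_mul_sub_eq_one (z := -25 / 64 * ξ ^ 2)
      (by linear_combination (-1 / 10) * hξ)
    have hN0 : ∀ t : ℂ, ((17969 / 18432) + (-1 / 96 * ξ ^ 2) * t + (-1) * t ^ 2) ^ 2 - ((1 /
        24 * ξ) + (4 / 25 * ξ ^ 3) * t) ^ 2 * (t ^ 3 + (-(5275 / 6144)) * t + (77675 / 1769472 *
        ξ ^ 2)) =
        (32 / 125 * ξ ^ 2) * ∏ i, (t - ![r, s, 113 / 192 * ξ ^ 2] i) ^ ![2, 2, 1] i := by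
      intro t
      rw [Fin.prod_univ_three]
      change _ = (32 / 125 * ξ ^ 2) * ((t - r) ^ 2 * (t - s) ^ 2 * (t - (113 / 192 * ξ ^ 2))
          ^ 1)
      -- The quadratic occurs squared in the norm, so `hquad` enters through a difference of
      -- squares.
      linear_combination (-1487 / 4608000 * ξ ^ 4 * t ^ 2 - 16 / 625 * ξ ^ 2 * t ^ 5 + 6133
          / 144000 * ξ ^ 2 * t ^ 3 - 1197257 / 66355200 * ξ ^ 2 * t + 1 / 10 * t ^ 4 - 17969 /
          92160 * t ^ 2 + 322884961 / 3397386240) * hξ + (-113 / 750 * ξ ^ 4 + 32 / 125 * ξ ^ 2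
          * t) * (t ^ 2 + (7 / 96 * ξ ^ 2) * t + (-14645 / 18432) + (t - r) * (t - s)) * hquad t
    have ha0q : ∀ s : ℂ, s ^ 2 + (7 / 96 * ξ ^ 2) * s + (-14645 / 18432) = 0 → s ≠ 113 / 192
        * ξ ^ 2 := fun s hs =>
      ne_of_mul_sub_eq_one (z := 127 / 900 * ξ ^ 2 + 16 / 75 * s) (by linear_combination (16
          / 75) * hs + (-14351 / 172800) * hξ)
    have hp10 : (17969 / 18432) + (-1 / 96 * ξ ^ 2) * (17 / 192 * ξ ^ 2) + (-1) * (17 / 192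
        * ξ ^ 2) ^ 2 ≠ 1 := ne_of_mul_sub_eq_one (z := 16)
      (by linear_combination (-323 / 2304) * hξ)
    have hq10 : (1 / 24 * ξ) + (4 / 25 * ξ ^ 3) * (17 / 192 * ξ ^ 2) ≠ 0 :=
        ne_of_mul_sub_eq_one (z := ξ ^ 3)
      (by linear_combination (17 / 1200 * ξ ^ 4 - 1 / 10) * hξ)
    have he1 : 32 / 125 * ξ ^ 2 ≠ 0 := ne_of_mul_sub_eq_one (z := -25 / 64 * ξ ^ 2)
      (by linear_combination (-1 / 10) * hξ)
    have hN1 : ∀ t : ℂ, ((17969 / 18432) + (-1 / 96 * ξ ^ 2) * t + (-1) * t ^ 2 - 1) ^ 2 -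
        ((1 / 24 * ξ) + (4 / 25 * ξ ^ 3) * t) ^ 2 * (t ^ 3 + (-(5275 / 6144)) * t + (77675 /
        1769472 * ξ ^ 2)) =
        (32 / 125 * ξ ^ 2) * ∏ i, (t - ![17 / 192 * ξ ^ 2] i) ^ ![5] i := by
      intro t
      rw [Fin.prod_univ_one]
      change _ = (32 / 125 * ξ ^ 2) * ((t - (17 / 192 * ξ ^ 2)) ^ 5)
      linear_combination (1419857 / 1019215872000 * ξ ^ 8 - 83521 / 1061683200 * ξ ^ 6 * t +
          301 / 460800 * ξ ^ 4 * t ^ 2 - 1419857 / 101921587200 * ξ ^ 4 - 16 / 625 * ξ ^ 2 * t ^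
          5 + 11 / 5760 * ξ ^ 2 * t ^ 3 + 7127 / 35389440 * ξ ^ 2 * t + 1 / 10 * t ^ 4 + 463 /
          92160 * t ^ 2 + 214369 / 3397386240) * hξ
    have hd : 4 / 25 * ξ ^ 3 ≠ 0 := ne_of_mul_sub_eq_one (z := -5 / 8 * ξ)
      (by linear_combination (-1 / 10) * hξ)
    exact IsBelyiMap.inv_and_hasPassport_inv
      (H.isBelyi_of_norm_cubic (Or.inr ⟨rfl, hd⟩)
      (A₀ := ![r, s, 113 / 192 * ξ ^ 2]) (k₀ := ![2, 2, 1]) (e₀ := 32 / 125 * ξ ^ 2)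
      (A₁ := ![17 / 192 * ξ ^ 2]) (k₁ := ![5]) (e₁ := 32 / 125 * ξ ^ 2)
      hD he0 (injective_triple hrs (ha0q r hr) (ha0q s hs)) (fun i => by fin_cases i <;> norm_num)
        hN0 (forall_fin_three (hp0q r hr) (hp0q s hs) (hp02))
        (forall_fin_three (hq0q
        r hr) (hq0q s hs) (hq02))
      he1 (Function.injective_of_subsingleton _) (fun i => by fin_cases i; norm_num) hN1
        (fun i => by fin_cases i; exact hp10) (fun i => by fin_cases i; exact hq10))
  · simp only [Algebra.smul_def]
    repeat' with_reducible_and_instances (first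
        | exact hx | exact hy | exact ofNat_mem _ _ | exact one_mem _ | exact mem_adjoin_simple_self ℚ ξ
        | apply add_mem | apply sub_mem | apply div_mem | apply mul_mem | apply neg_mem | apply pow_mem
        | apply hc)

/-! ### Change of generators of the function field. -/

section ChangeOfCoordinates

variable {K : Type*} [Field K] [Algebra ℂ K]

/-- If `u` were algebraic over `ℂ`, so would be `v`, and then `x`, which lies in every field
containing both. -/
theorem transcendental_of_forall_intermediateField {u v x : K} {h : ℂ[X]}
    (hx : Transcendental ℂ x) (hsq : v ^ 2 = aeval u h)
    (hL : ∀ L : IntermediateField ℂ K, u ∈ L → v ∈ L → x ∈ L) : Transcendental ℂ u := by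
  intro (hu : IsAlgebraic ℂ u)
  have hu' : IsAlgebraic ℂ v := by
    refine IsAlgebraic.of_pow (n := 2) two_pos ?_
    have h1 := (aeval (⟨u, mem_algebraicClosure_iff.mpr hu⟩ : algebraicClosure ℂ K) h).2
    rwa [← IntermediateField.aeval_coe, mem_algebraicClosure_iff, ← hsq] at h1
  have h1 := hL (algebraicClosure ℂ K) (mem_algebraicClosure_iff.mpr hu)
    (mem_algebraicClosure_iff.mpr hu')
  exact hx (mem_algebraicClosure_iff.mp h1)

/-- Another pair of generators of the function field which satisfies an equation of the
same type. -/
theorem IsOddCover.of_mem {g g' : ℕ} {x y u v : K} {f h : ℂ[X]} (H : IsOddCover g x y f)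
    (hs : Squarefree h) (hd : h.natDegree = 2 * g' + 1) (hsq : v ^ 2 = aeval u h)
    (hL : ∀ L : IntermediateField ℂ K, u ∈ L → v ∈ L → x ∈ L ∧ y ∈ L) : IsOddCover g' u v h :=
  { IsDoubleCover.of_forall_eq_top hsq
      (transcendental_of_forall_intermediateField H.transcendental hsq
        fun L h1 h2 => (hL L h1 h2).1)
      (IsDoubleCover.not_square_of_squarefree hs (by omega))
      fun L h1 h2 => H.eq_top_of_mem (hL L h1 h2).1 (hL L h1 h2).2 with
    squarefree := hs
    natDegree_eq := hd }

theorem IsCenteredAt.ord_linearForm_zero_right {P : CurvePoint ℂ K} {u v : K} {h : ℂ[X]} {a b : ℂ}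
    (hC : IsCenteredAt P.localRing u v a b) (H : IsDoubleCover u v h) {p M : ℂ[X]} {k : ℕ}
    (hp : p = (X - C a) ^ k * M) (hM : M.eval a ≠ 0) :
    P.ord (linearForm u v p 0) = k * P.ord (u - algebraMap ℂ K a) := by
  rw [linearForm_zero_right, hp, hC.ord_aeval_X_sub_C_pow_mul H k hM]

end ChangeOfCoordinates

/-- The pole of `1/β` is the 2-torsion point `(-1, 0)`. Translation by it has `x`-coordinate `u = (1
- x)/(1 + x)`, sends the pole to infinity, keeps the equation of the curve, and gives `1/β = 1 -
u²`. -/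
theorem belyiPair_4_4_22 :
    IsBelyiPairOfGenus 1 (X ^ 3 - X) (fun S => (S.x + 1) ^ 2 / (4 * S.x)) {4} {4} {2, 2} := by
  have hs : Squarefree (X ^ 3 - X : ℂ[X]) := by
    have := squarefree_cubic (a := -1) (b := 0) (by norm_num)
    simpa [sub_eq_add_neg] using this
  refine .intro hs (by compute_degree!) fun S H => ?_
  have hx : S.x + 1 ≠ 0 := by simpa using H.sub_algebraMap_ne_zero (-1)
  have hx0 := H.fst_ne_zero
  have hy : S.y ^ 2 = S.x ^ 3 - S.x := by simpa using H.sq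
  have H' : IsOddCover 1 ((1 - S.x) / (1 + S.x)) (2 * S.y / (S.x + 1) ^ 2) (X ^ 3 - X) := by
    have hx' : 1 + S.x ≠ 0 := by rwa [add_comm]
    refine H.of_mem hs (by compute_degree!) ?_ fun L hu hv => ?_
    · simp only [map_sub, map_pow, aeval_X, div_pow, mul_pow, hy]
      field_simp
      ring
    · have h1 : (1 - S.x) / (1 + S.x) + 1 = 2 / (1 + S.x) := by
        field_simp
        ring
      have h2 : S.x = 2 / ((1 - S.x) / (1 + S.x) + 1) - 1 := by
        rw [h1]
        field_simp
        ring
      have hxL : S.x ∈ L := by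
        rw [h2]
        exact sub_mem (div_mem (ofNat_mem _ _) (add_mem hu (one_mem _))) (one_mem _)
      refine ⟨hxL, ?_⟩
      have h3 : S.y = 2 * S.y / (S.x + 1) ^ 2 * (S.x + 1) ^ 2 / 2 := by
        field_simp
      rw [h3]
      exact div_mem (mul_mem hv (pow_mem (add_mem hxL (one_mem _)) 2)) (ofNat_mem _ _)
  have e : (S.x + 1) ^ 2 / (4 * S.x) =
      (linearForm ((1 - S.x) / (1 + S.x)) (2 * S.y / (S.x + 1) ^ 2) (1 - X ^ 2) 0)⁻¹ := by
    have hx' : 1 + S.x ≠ 0 := by rwa [add_comm]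
    rw [linearForm_zero_right, ← inv_div]
    congr 1
    simp only [map_sub, map_pow, map_one, aeval_X]
    field_simp
    ring
  rw [e]
  -- From here on only the relation between `u` and `v` matters.
  generalize (1 - S.x) / (1 + S.x) = u at H' ⊢
  generalize 2 * S.y / (S.x + 1) ^ 2 = v at H' ⊢
  have hdeg : (1 - X ^ 2 : ℂ[X]).natDegree = 2 := by compute_degree!
  have hinf : ∀ P : CurvePoint ℂ S.FunctionField, P.ord u < 0 →
      P.ord (linearForm u v (1 - X ^ 2) 0) = -(4 : ℕ) := by
    intro P hP
    rw [H'.ord_linearForm_of_lt hP (by rintro h; simp [h] at hdeg) (by simp), hdeg]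
    norm_num
  refine IsBelyiMap.inv_and_hasPassport_inv ⟨H'.isBelyiMap_linearForm (by norm_num) hinf ?_,
    ?_, ?_, H'.hasZeroOrders_inv_linearForm (by norm_num) hinf⟩
  · intro a b hb hab
    simp at hb hab ⊢
    rcases hab with rfl | rfl
    · right; norm_num
    · have h1 : a * (a ^ 2 - 1) = 0 := by linear_combination -hb
      rcases mul_eq_zero.mp h1 with rfl | h2
      · right; norm_num
      · left; linear_combination -h2
  -- The norm criterion does not apply, since `q = 0`; but the points over `u = ±1`, and `u = 0` for
  -- the other fibre, are branch points, where `u - a` has order two.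
  · have := H'.hasZeroOrders_linearForm_sub (by norm_num) hinf 0 (A := ![1, -1]) (B := ![0, 0])
      (k := ![2, 2]) ?_ ?_ ?_ ?_ ?_
    · rw [map_zero, sub_zero] at this
      exact this
    · intro i
      fin_cases i <;> simp
      norm_num
    · intro i j hij
      exact injective_pair (by norm_num) (Prod.ext_iff.mp hij).1
    · intro i
      fin_cases i <;> norm_num
    · refine Fin.forall_fin_two.mpr ⟨fun P hC => ?_, fun P hC => ?_⟩
      · rw [hC.ord_linearForm_zero_right H'.toIsDoubleCover (k := 1) (M := -(X + 1)) ?_ ?_,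
          hC.ord_sub_eq_two H'.toIsDoubleCover (H'.isSmoothPoint ?_) rfl]
        · rfl
        · simp
        · simp; ring
        · norm_num
      · rw [hC.ord_linearForm_zero_right H'.toIsDoubleCover (k := 1) (M := 1 - X) ?_ ?_,
          hC.ord_sub_eq_two H'.toIsDoubleCover (H'.isSmoothPoint ?_) rfl]
        · rfl
        · simp; norm_num
        · simp; ring
        · norm_num
    · intro a b hb hab
      simp at hb hab
      have h1 : (a - 1) * (a + 1) = 0 := by linear_combination -hab
      have h2 : b = 0 := by
        refine pow_eq_zero_iff two_ne_zero |>.mp ?_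
        rw [hb]
        linear_combination -a * hab
      rcases mul_eq_zero.mp h1 with h3 | h3
      · exact ⟨0, sub_eq_zero.mp h3, h2⟩
      · exact ⟨1, by simpa using eq_neg_of_add_eq_zero_left h3, h2⟩
  · have := H'.hasZeroOrders_linearForm_sub (by norm_num) hinf 1 (A := ![0]) (B := ![0])
      (k := ![4]) ?_ (Function.injective_of_subsingleton _) ?_ ?_ ?_
    · simpa using this
    · intro i
      simp
    · intro i
      simp
    · refine Fin.forall_fin_one.mpr fun P hC => ?_
      rw [hC.ord_linearForm_zero_right H'.toIsDoubleCover (k := 2) (M := -1) ?_ ?_,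
          hC.ord_sub_eq_two H'.toIsDoubleCover (H'.isSmoothPoint ?_) rfl]
      · rfl
      · simp
      · simp
      · simp
    · intro a b hb hab
      simp at hb hab
      subst hab
      exact ⟨0, rfl, by simpa using hb⟩

theorem injective_quadruple {α : Type*} {a b c d : α} (hab : a ≠ b) (hac : a ≠ c) (had : a ≠ d)
    (hbc : b ≠ c) (hbd : b ≠ d) (hcd : c ≠ d) : Function.Injective ![a, b, c, d] := by
  intro i j hij
  fin_cases i <;> fin_cases j <;> simp_all

theorem exists_primitive_cube_root : ∃ w : ℂ, w ^ 2 + w + 1 = 0 := by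
  obtain ⟨r, -, -, hr, -⟩ := exists_roots_quadratic (α := 1) (β := 1) (by norm_num)
  exact ⟨r, by linear_combination hr⟩

/-- Translation by the 3-torsion point `(0, 1)` carries the pole `(0, -1)` of `1/β` to infinity and
preserves `y² = x³ + 1`. In the new coordinates `1/β = 1/2 - u³/4 - v/2`, with norm `u³(u³ - 8)/16`,
while `1/β - 1` has norm `u⁶/16`. -/
theorem belyiPair_6_6_3111 :
    IsBelyiPairOfGenus 1 (X ^ 3 + 1)
      (fun S => 1 / (1 - (8 + 8 * S.x ^ 3 + S.x ^ 6) / S.x ^ 6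
        - (-8 - 4 * S.x ^ 3) / S.x ^ 6 * S.y))
      {6} {6} {3, 1, 1, 1} := by
  have hs : Squarefree (X ^ 3 + 1 : ℂ[X]) := by
    simpa using squarefree_cubic (a := 0) (b := 1) (by norm_num)
  refine .intro hs (by compute_degree!) fun S H => ?_
  have hx := H.fst_ne_zero
  have hy1 : 1 + S.y ≠ 0 := by
    simpa [linearForm] using H.linearForm_ne_zero (p := 1) (q := 1) (Or.inl one_ne_zero)
  have hy2 : S.y - 1 ≠ 0 := by
    simpa [linearForm, sub_eq_neg_add] using
      H.linearForm_ne_zero (p := -1) (q := 1) (Or.inr one_ne_zero)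
  have hy : S.y ^ 2 = S.x ^ 3 + 1 := by simpa using H.sq
  have H' : IsOddCover 1 (-2 * S.x / (1 + S.y)) ((S.y - 3) / (1 + S.y)) (X ^ 3 + 1) := by
    refine H.of_mem hs (by compute_degree!) ?_ fun L hu hv => ?_
    · simp only [map_add, map_pow, aeval_X, map_one, div_pow, mul_pow]
      have hx3 : S.x ^ 3 = S.y ^ 2 - 1 := by rw [hy]; ring
      rw [hx3]
      field_simp
      ring
    · have h1 : 1 + S.y = 4 / (1 - (S.y - 3) / (1 + S.y)) := by
        have : 1 - (S.y - 3) / (1 + S.y) = 4 / (1 + S.y) := by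
          field_simp
          ring
        rw [this]
        field_simp
      have hyL : 1 + S.y ∈ L := by
        rw [h1]
        exact div_mem (ofNat_mem _ _) (sub_mem (one_mem _) hv)
      have h2 : S.x = -2 * S.x / (1 + S.y) * (1 + S.y) / (-2) := by
        field_simp
      constructor
      · rw [h2]
        exact div_mem (mul_mem hu hyL) (neg_mem (ofNat_mem _ _))
      · simpa using sub_mem hyL (one_mem L)
  have e : 1 / (1 - (8 + 8 * S.x ^ 3 + S.x ^ 6) / S.x ^ 6
        - (-8 - 4 * S.x ^ 3) / S.x ^ 6 * S.y) =
      (linearForm (-2 * S.x / (1 + S.y)) ((S.y - 3) / (1 + S.y))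
        (C (1 / 2) - C (1 / 4) * X ^ 3) (C (-1 / 2)))⁻¹ := by
    rw [one_div]
    congr 1
    have hx3 : S.x ^ 3 = S.y ^ 2 - 1 := by rw [hy]; ring
    have hx6 : S.x ^ 6 = (S.y ^ 2 - 1) ^ 2 := by rw [← hx3]; ring
    have hy3 : S.y ^ 2 - 1 ≠ 0 := by rw [← hx3]; exact pow_ne_zero 3 hx
    simp only [linearForm, map_sub, map_mul, map_pow, aeval_X, aeval_C, map_div₀, map_one, map_neg,
      map_ofNat, div_pow, mul_pow]
    rw [hx6, hx3]
    field_simp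
    ring
  rw [e]
  generalize -2 * S.x / (1 + S.y) = u at H' ⊢
  generalize (S.y - 3) / (1 + S.y) = v at H' ⊢
  obtain ⟨w, hw⟩ := exists_primitive_cube_root
  have hw1 : w ≠ 1 := by
    rintro rfl
    norm_num at hw
  have hw3 : w ^ 3 = 1 := by linear_combination (w - 1) * hw
  have hw0 : w ≠ 0 := by
    rintro rfl
    norm_num at hw3
  have hdeg : (C (1 / 2) - C (1 / 4) * X ^ 3 : ℂ[X]).natDegree = 3 := by compute_degree!
  refine IsBelyiMap.inv_and_hasPassport_inv (H'.isBelyi_of_norm (m := 6) (by norm_num) ?_ ?_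
    (d₀ := 1 / 16) (A₀ := ![0, 2, 2 * w, 2 * w ^ 2]) (k₀ := ![3, 1, 1, 1]) (by norm_num)
    (injective_quadruple ?_ ?_ ?_ ?_ ?_ ?_) ?_ ?_ ?_ ?_
    (d₁ := 1 / 16) (A₁ := ![0]) (k₁ := ![6]) (by norm_num)
    (Function.injective_of_subsingleton _) ?_ ?_ ?_ ?_)
  · intro P hP
    rw [H'.ord_linearForm_of_lt hP (fun h => by rw [h] at hdeg; simp at hdeg) (by rw [hdeg]; simp), hdeg]
    norm_num
  · intro a b hb hab
    simp at hb hab ⊢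
    have h1 : a ^ 2 * (1 + b) = 0 := by linear_combination -2 / 3 * hab
    have h2 : (b - 1) * (b + 1) = 0 ∧ a ^ 3 = 0 := by
      rcases mul_eq_zero.mp h1 with h | h
      · have h3 : a = 0 := pow_eq_zero_iff two_ne_zero |>.mp h
        subst h3
        exact ⟨by linear_combination hb, by norm_num⟩
      · exact ⟨by linear_combination (b - 1) * h, by linear_combination (b - 1) * h - hb⟩
    rcases mul_eq_zero.mp h2.1 with h | h
    · left; linear_combination -1 / 4 * h2.2 - 1 / 2 * h
    · right; linear_combination -1 / 4 * h2.2 - 1 / 2 * h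
  · norm_num
  · simpa using hw0
  · simpa using hw0
  · intro h
    exact hw1 (by linear_combination -h / 2)
  · intro h
    exact hw1 (by linear_combination w * h / 2 + hw3)
  · intro h
    exact hw1 (mul_left_cancel₀ hw0 (by linear_combination -h / 2))
  · intro i
    fin_cases i <;> norm_num
  · intro t
    rw [Fin.prod_univ_four]
    simp
    linear_combination (-1 / 16 * t ^ 3 * (t - 2) * (-2 * t + 4 * (w - 1))) * hw
  · intro i
    fin_cases i <;> simp [mul_pow, ← pow_mul, hw3] <;> norm_num
    rw [show w ^ 6 = (w ^ 3) ^ 2 by ring, hw3]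
    norm_num
  · intro i
    simp
  · intro i
    fin_cases i
    norm_num
  · intro t
    simp
    ring
  · intro i
    fin_cases i
    norm_num
  · intro i
    simp

/-- With `u = x - 1/3` the curve is `v² = u(u² + u + 1)` and `1/β = 1 - u³`. The primitive cube
roots of unity are branch points and give double zeros. Two distinct points lie over `u = 1`, and
`u³` has order six at the branch point `u = 0`. -/
theorem belyiPair_6_6_2211 :
    IsBelyiPairOfGenus 1 (X ^ 3 + C (2 / 3) * X - C (7 / 27))
      (fun S => 1 / (1 + 1 / 27 * (1 - 9 * S.x + 27 * S.x ^ 2 - 27 * S.x ^ 3)))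
      {6} {6} {2, 2, 1, 1} := by
  have hs : Squarefree (X ^ 3 + C (2 / 3) * X - C (7 / 27) : ℂ[X]) := by
    have := squarefree_cubic (a := 2 / 3) (b := -(7 / 27)) (by norm_num)
    rwa [C_neg, ← sub_eq_add_neg] at this
  refine .intro hs (by compute_degree!) fun S H => ?_
  have hy := H.sq
  simp only [map_sub, map_add, map_mul, map_pow, aeval_X, aeval_C, map_div₀, map_ofNat] at hy
  have hs' : Squarefree (X ^ 3 + X ^ 2 + X : ℂ[X]) := by
    refine squarefree_of_forall_isRoot fun t ht ht' => ?_
    norm_num at ht ht'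
    have h0 : t = 1 / 4 := by linear_combination (-3 / 4 * t - 1 / 4) * ht' + 9 / 4 * ht
    rw [h0] at ht'
    norm_num at ht'
  have H' : IsOddCover 1 (S.x - 1 / 3) S.y (X ^ 3 + X ^ 2 + X) := by
    refine H.of_mem hs' (by compute_degree!) ?_ fun L hu hv => ?_
    · simp only [map_add, map_pow, aeval_X]
      rw [hy]
      ring
    · refine ⟨?_, hv⟩
      simpa using add_mem hu (div_mem (one_mem L) (ofNat_mem L 3))
  have e : 1 / (1 + 1 / 27 * (1 - 9 * S.x + 27 * S.x ^ 2 - 27 * S.x ^ 3)) =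
      (linearForm (S.x - 1 / 3) S.y (1 - X ^ 3) 0)⁻¹ := by
    rw [linearForm_zero_right, one_div]
    congr 1
    simp only [map_sub, map_pow, map_one, aeval_X]
    ring
  rw [e]
  generalize S.x - 1 / 3 = u at H' ⊢
  generalize S.y = v at H' ⊢
  obtain ⟨w, hw⟩ := exists_primitive_cube_root
  obtain ⟨r, hr⟩ := IsAlgClosed.exists_pow_nat_eq (3 : ℂ) two_pos
  have hw1 : w ≠ 1 := by
    rintro rfl
    norm_num at hw
  have hr0 : r ≠ 0 := by
    rintro rfl
    norm_num at hr
  have hw3 : w ^ 3 = 1 := by linear_combination (w - 1) * hw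
  have hw2 : w ≠ w ^ 2 := fun h => hw1 (by linear_combination w * h + h + hw3)
  have hw2' : w ^ 2 ≠ 1 := fun h => hw1 (by linear_combination hw3 - w * h)
  have hdeg : (1 - X ^ 3 : ℂ[X]).natDegree = 3 := by compute_degree!
  have hinf : ∀ P : CurvePoint ℂ S.FunctionField, P.ord u < 0 →
      P.ord (linearForm u v (1 - X ^ 3) 0) = -(6 : ℕ) := by
    intro P hP
    rw [H'.ord_linearForm_of_lt hP (by rintro h; simp [h] at hdeg) (by simp), hdeg]
    norm_num
  have hfac : (1 - X ^ 3 : ℂ[X]) = -((X - C 1) * ((X - C w) * (X - C (w ^ 2)))) := by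
    have h1 : C w ^ 2 + C w + 1 = 0 := by
      rw [← C_pow, ← C_add, ← C_1, ← C_add, hw, C_0]
    have h2 : C w ^ 3 = 1 := by rw [← C_pow, hw3, C_1]
    rw [C_1, C_pow]
    linear_combination (X - X ^ 2) * h1 + (X - 1) * h2
  refine IsBelyiMap.inv_and_hasPassport_inv ⟨H'.isBelyiMap_linearForm (by norm_num) hinf ?_,
    ?_, ?_, H'.hasZeroOrders_inv_linearForm (by norm_num) hinf⟩
  · intro a b hb hab
    simp at hb hab ⊢
    rcases hab with (h | rfl) | rfl
    · norm_num at h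
    · right; norm_num
    · have h1 : a * (a ^ 2 + a + 1) = 0 := by linear_combination -hb
      rcases mul_eq_zero.mp h1 with rfl | h2
      · right; norm_num
      · left; linear_combination (1 - a) * h2
  -- Over `u = 1` one has `v² = 3`, hence the two points `±r`.
  · have := H'.hasZeroOrders_linearForm_sub (by norm_num) hinf 0 (A := ![w, w ^ 2, 1, 1])
      (B := ![0, 0, r, -r]) (k := ![2, 2, 1, 1]) ?_ ?_ ?_ ?_ ?_
    · rw [map_zero, sub_zero] at this
      exact this
    · intro i
      fin_cases i <;> simp
      · linear_combination -w * hw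
      · linear_combination (-w ^ 2 * (w ^ 2 - w + 1)) * hw
      · rw [hr]; norm_num
      · rw [hr]; norm_num
    · intro i j hij
      have hr' : r ≠ -r := fun h => hr0 (by linear_combination h / 2)
      fin_cases i <;> fin_cases j <;> simp_all
    · intro i
      fin_cases i <;> norm_num
    · intro i P hC
      fin_cases i
      all_goals simp only [C_0, sub_zero]
      · rw [hC.ord_linearForm_zero_right H'.toIsDoubleCover (k := 1)
            (M := -((X - C 1) * (X - C (w ^ 2)))) ?_ ?_,
          hC.ord_sub_eq_two H'.toIsDoubleCover (H'.isSmoothPoint ?_) rfl]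
        · rfl
        · simp; linear_combination -w * hw
        · rw [hfac]; simp; ring
        · simp [sub_eq_zero, hw1, hw2]
      · rw [hC.ord_linearForm_zero_right H'.toIsDoubleCover (k := 1)
            (M := -((X - C 1) * (X - C w))) ?_ ?_,
          hC.ord_sub_eq_two H'.toIsDoubleCover (H'.isSmoothPoint ?_) rfl]
        · rfl
        · simp; linear_combination (-w ^ 2 * (w ^ 2 - w + 1)) * hw
        · rw [hfac]; simp; ring
        · simp [sub_eq_zero, hw2', hw2.symm]
      · rw [hC.ord_linearForm_zero_right H'.toIsDoubleCover (k := 1)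
            (M := -((X - C w) * (X - C (w ^ 2)))) ?_ ?_,
          hC.ord_sub_eq_one H'.toIsDoubleCover (H'.isSmoothPoint ?_) hr0]
        · rfl
        · simp [hr]; norm_num
        · rw [hfac]; simp
        · simp [sub_eq_zero, hw1.symm, hw2'.symm]
      · rw [hC.ord_linearForm_zero_right H'.toIsDoubleCover (k := 1)
            (M := -((X - C w) * (X - C (w ^ 2)))) ?_ ?_,
          hC.ord_sub_eq_one H'.toIsDoubleCover (H'.isSmoothPoint ?_) (neg_ne_zero.mpr hr0)]
        · rfl
        · simp [hr]; norm_num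
        · rw [hfac]; simp
        · simp [sub_eq_zero, hw1.symm, hw2'.symm]
    · intro a b hb hab
      rw [hfac] at hab
      simp at hb hab
      rcases hab with h | h | h
      · have ha : a = 1 := sub_eq_zero.mp h
        subst ha
        have h1 : (b - r) * (b + r) = 0 := by linear_combination hb - hr
        rcases mul_eq_zero.mp h1 with h2 | h2
        · exact ⟨2, rfl, sub_eq_zero.mp h2⟩
        · exact ⟨3, rfl, eq_neg_of_add_eq_zero_left h2⟩
      · have ha : a = w := sub_eq_zero.mp h
        subst ha
        refine ⟨0, rfl, pow_eq_zero_iff two_ne_zero |>.mp ?_⟩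
        rw [hb]
        linear_combination a * hw
      · have ha : a = w ^ 2 := sub_eq_zero.mp h
        subst ha
        refine ⟨1, rfl, pow_eq_zero_iff two_ne_zero |>.mp ?_⟩
        rw [hb]
        linear_combination (w ^ 2 * (w ^ 2 - w + 1)) * hw
  · have := H'.hasZeroOrders_linearForm_sub (by norm_num) hinf 1 (A := ![0]) (B := ![0])
      (k := ![6]) ?_ (Function.injective_of_subsingleton _) ?_ ?_ ?_
    · simpa using this
    · intro i
      simp
    · intro i
      simp
    · refine Fin.forall_fin_one.mpr fun P hC => ?_
      rw [hC.ord_linearForm_zero_right H'.toIsDoubleCover (k := 3) (M := -1) ?_ ?_,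
          hC.ord_sub_eq_two H'.toIsDoubleCover (H'.isSmoothPoint ?_) rfl]
      · rfl
      · simp
      · simp
      · simp
    · intro a b hb hab
      simp at hb hab
      subst hab
      exact ⟨0, rfl, by simpa using hb⟩

/-! ### Even degree: two points at infinity, distinguished by the value `ε = ±1` of `v / u^(g+1)`.
-/

section EvenCover

variable {K : Type*} [Field K] [Algebra ℂ K]

/-- The functions `u` and `v` generate `K` over `ℂ`, and the only relation between them is
`v² = h(u)`, where `h` is monic of degree `2g + 2` and has no multiple roots. -/
structure IsEvenCover (g : ℕ) (u v : K) (h : ℂ[X]) : Prop extends IsDoubleCover u v h where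
  squarefree : Squarefree h
  monic : h.Monic
  natDegree_eq : h.natDegree = 2 * (g + 1)

namespace IsEvenCover

variable {g : ℕ} {u v : K} {h : ℂ[X]} (H : IsEvenCover g u v h)
include H

theorem isDoubleCover_inv : IsDoubleCover u⁻¹ (v / u ^ (g + 1)) (reflect (2 * (g + 1)) h) :=
  H.toIsDoubleCover.inv H.natDegree_eq.le

theorem coeff_eq_one : h.coeff (2 * (g + 1)) = 1 := by
  rw [← H.natDegree_eq]
  exact H.monic

theorem isSmoothPoint_inv {ε : ℂ} (hε : ε ^ 2 = 1) :
    IsSmoothPoint (reflect (2 * (g + 1)) h) 0 ε := by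
  constructor
  · rw [← coeff_zero_eq_eval_zero, coeff_reflect, revAt_zero, H.coeff_eq_one, hε]
  · left
    rintro rfl
    norm_num at hε

theorem exists_point_inv {ε : ℂ} (hε : ε ^ 2 = 1) :
    ∃ P : CurvePoint ℂ K, IsCenteredAt P.localRing u⁻¹ (v / u ^ (g + 1)) 0 ε :=
  H.isDoubleCover_inv.exists_point (H.isSmoothPoint_inv hε)

theorem exists_isCenteredAt_inv {P : CurvePoint ℂ K} (hP : P.ord u < 0) :
    ∃ ε : ℂ, ε ^ 2 = 1 ∧ IsCenteredAt P.localRing u⁻¹ (v / u ^ (g + 1)) 0 ε := by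
  obtain ⟨ε, hε, hC⟩ := H.exists_isCenteredAt_of_ord_neg hP (n := g + 1) H.natDegree_eq.le
  exact ⟨ε, hε.trans H.coeff_eq_one, hC⟩

variable {P : CurvePoint ℂ K} {ε : ℂ} (hε : ε ^ 2 = 1)
  (hC : IsCenteredAt P.localRing u⁻¹ (v / u ^ (g + 1)) 0 ε)
include hε hC

theorem ord_fst : P.ord u = -1 := by
  have hε0 : ε ≠ 0 := by
    rintro rfl
    norm_num at hε
  have h1 := hC.ord_sub_eq_one H.isDoubleCover_inv (H.isSmoothPoint_inv hε) hε0
  rw [map_zero, sub_zero, P.ord_inv] at h1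
  omega

/-- In the chart at infinity `(p + qv) / u^(n+g+1)` takes the value `p_(n+g+1) + q_n ε`. When this
is nonzero the pole has the full order, and `u` has a simple pole. -/
theorem ord_linearForm {p q : ℂ[X]} {n : ℕ} (hp : p.natDegree ≤ n + (g + 1))
    (hq : q.natDegree ≤ n) (hpq : p.coeff (n + (g + 1)) + q.coeff n * ε ≠ 0) :
    P.ord (linearForm u v p q) = -(n + (g + 1) : ℕ) := by
  have hu := H.fst_ne_zero
  have h1 : linearForm u⁻¹ (v / u ^ (g + 1)) (reflect (n + (g + 1)) p) (reflect n q) =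
      linearForm u v p q / u ^ (n + (g + 1)) := by
    rw [linearForm, linearForm, IsDoubleCover.aeval_inv_reflect hu hp,
      IsDoubleCover.aeval_inv_reflect hu hq, pow_add]
    field_simp
  have h2 : (reflect (n + (g + 1)) p).eval 0 + (reflect n q).eval 0 * ε ≠ 0 := by
    rwa [← coeff_zero_eq_eval_zero, ← coeff_zero_eq_eval_zero, coeff_reflect, coeff_reflect,
      revAt_zero, revAt_zero]
  have h3 := hC.ord_linearForm_eq_zero h2
  have h4 : linearForm u v p q ≠ 0 := H.linearForm_ne_zero (by
    by_contra! h0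
    simp [h0.1, h0.2] at hpq)
  rw [h1, P.ord_div h4 (pow_ne_zero _ hu), P.ord_pow, H.ord_fst hε hC] at h3
  linarith

end IsEvenCover

end EvenCover

/-- The cubic has the root `1/2`. With `s = x - 1/2`, `u = y/s` and `v = s + 3/(16s)` the curve
becomes the quartic `v² = u⁴ - 3u² + 3`, the poles of `β` become its two points at infinity, and `β
= (1 + uv)/2`. Both fibres have norm `-(u² - 1)³/4`. -/
theorem belyiPair_33_33_33 :
    IsBelyiPairOfGenus 1 (X ^ 3 - C (15 / 16) * X + C (11 / 32))
      (fun S => 1 / 2 * (1 + (S.x ^ 2 - S.x + 7 / 16) / (S.x - 1 / 2) ^ 2 * S.y))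
      {3, 3} {3, 3} {3, 3} := by
  have hs : Squarefree (X ^ 3 - C (15 / 16) * X + C (11 / 32) : ℂ[X]) := by
    have := squarefree_cubic (a := -(15 / 16)) (b := 11 / 32) (by norm_num)
    rwa [C_neg, neg_mul, ← sub_eq_add_neg] at this
  refine .intro hs (by compute_degree!) fun S H => ?_
  have hy := H.sq
  simp only [map_sub, map_add, map_mul, map_pow, aeval_X, aeval_C, map_div₀, map_ofNat] at hy
  have hs' : Squarefree (X ^ 4 - 3 * X ^ 2 + 3 : ℂ[X]) := by
    refine squarefree_of_forall_isRoot fun t ht ht' => ?_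
    norm_num at ht ht'
    have h1 : t * (2 * t ^ 2 - 3) = 0 := by linear_combination ht' / 2
    rcases mul_eq_zero.mp h1 with h2 | h2
    · rw [h2] at ht
      norm_num at ht
    · have : (3 : ℂ) = 0 := by linear_combination 4 * ht - (2 * t ^ 2 - 3) * h2
      norm_num at this
  have hd : (X ^ 4 - 3 * X ^ 2 + 3 : ℂ[X]).natDegree = 4 := by compute_degree!
  have hm : (X ^ 4 - 3 * X ^ 2 + 3 : ℂ[X]).Monic := by monicity!
  set s := S.x - 1 / 2 with hs_def
  have hs0 : s ≠ 0 := by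
    have := H.sub_algebraMap_ne_zero (1 / 2)
    rwa [map_div₀, map_one, map_ofNat] at this
  have hx : S.x = s + 1 / 2 := by rw [hs_def]; ring
  have hy' : S.y ^ 2 = s ^ 3 + 3 / 2 * s ^ 2 - 3 / 16 * s := by
    rw [hy, hx]
    ring
  have hsq : (s + 3 / (16 * s)) ^ 2 = aeval (S.y / s) (X ^ 4 - 3 * X ^ 2 + 3 : ℂ[X]) := by
    have h4 : S.y ^ 4 = (s ^ 3 + 3 / 2 * s ^ 2 - 3 / 16 * s) ^ 2 := by rw [← hy']; ring
    simp only [map_add, map_sub, map_mul, map_pow, aeval_X, map_ofNat, div_pow, h4, hy']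
    field_simp
    ring
  have hL : ∀ L : IntermediateField ℂ S.FunctionField, S.y / s ∈ L → s + 3 / (16 * s) ∈ L →
      S.x ∈ L ∧ S.y ∈ L := by
    intro L hu hv
    have h1 : s = (s + 3 / (16 * s) + (S.y / s) ^ 2 - 3 / 2) / 2 := by
      rw [div_pow, hy']
      field_simp
      ring
    have hsL : s ∈ L := by
      rw [h1]
      exact div_mem (sub_mem (add_mem hv (pow_mem hu 2)) (div_mem (ofNat_mem _ _) (ofNat_mem _ _)))
        (ofNat_mem _ _)
    constructor
    · rw [hx]
      exact add_mem hsL (div_mem (one_mem _) (ofNat_mem _ _))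
    · have := mul_mem hu hsL
      rwa [div_mul_cancel₀ _ hs0] at this
  have H' : IsEvenCover 1 (S.y / s) (s + 3 / (16 * s)) (X ^ 4 - 3 * X ^ 2 + 3) :=
    { IsDoubleCover.of_forall_eq_top hsq
        (transcendental_of_forall_intermediateField H.transcendental hsq
          fun L h1 h2 => (hL L h1 h2).1)
        (IsDoubleCover.not_square_of_squarefree hs' (by omega))
        fun L h1 h2 => H.eq_top_of_mem (hL L h1 h2).1 (hL L h1 h2).2 with
      squarefree := hs'
      monic := hm
      natDegree_eq := hd }
  have e : 1 / 2 * (1 + (S.x ^ 2 - S.x + 7 / 16) / s ^ 2 * S.y) =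
      linearForm (S.y / s) (s + 3 / (16 * s)) (C (1 / 2)) (C (1 / 2) * X) := by
    simp only [linearForm, map_mul, aeval_C, aeval_X, map_div₀, map_one, map_ofNat]
    rw [hx]
    field_simp
    ring
  change S.IsBelyiPair (1 / 2 * (1 + (S.x ^ 2 - S.x + 7 / 16) / s ^ 2 * S.y)) _ _ _
  rw [e]
  generalize S.y / s = u at H' ⊢
  generalize s + 3 / (16 * s) = v at H' ⊢
  have hord : ∀ (P : CurvePoint ℂ S.FunctionField) (ε : ℂ), ε ^ 2 = 1 →
      IsCenteredAt P.localRing u⁻¹ (v / u ^ 2) 0 ε →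
      P.ord (linearForm u v (C (1 / 2)) (C (1 / 2) * X)) = -3 := by
    intro P ε hε hC
    refine H'.ord_linearForm hε hC (n := 1) (by simp) (by compute_degree) ?_
    rw [coeff_C_of_ne_zero (by norm_num), coeff_C_mul, coeff_X_one]
    rintro h
    have : ε = 0 := by linear_combination 2 * h
    rw [this] at hε
    norm_num at hε
  have hinf : ∀ P : CurvePoint ℂ S.FunctionField, P.ord u < 0 → ∀ c : ℂ,
      P.ord (linearForm u v (C (1 / 2)) (C (1 / 2) * X) - algebraMap ℂ _ c) ≤ 0 := by
    intro P hP c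
    obtain ⟨ε, hε, hC⟩ := H'.exists_isCenteredAt_inv hP
    have h1 := hord P ε hε hC
    rw [P.ord_sub_algebraMap_of_neg c (by omega)]
    omega
  have hfib : ∀ c : ℂ, c ^ 2 = c → HasZeroOrders
      (linearForm u v (C (1 / 2)) (C (1 / 2) * X) - algebraMap ℂ S.FunctionField c) {3, 3} := by
    intro c hc
    refine H'.hasZeroOrders_linearForm_sub_of_norm H'.squarefree c (-1 / 4)
      (fun P hP => hinf P hP c) (by norm_num) (A := ![1, -1]) (k := ![3, 3])
      (injective_pair (by norm_num)) ?_ ?_ ?_ ?_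
    · intro i
      fin_cases i <;> norm_num
    · intro t
      simp
      linear_combination hc
    · intro i h
      rw [eval_C] at h
      rw [← h] at hc
      norm_num at hc
    · intro i
      fin_cases i <;> simp
  refine ⟨H'.isBelyiMap_linearForm H'.squarefree (fun c h => ?_)
    (fun P hP c _ _ => (hinf P hP c).trans zero_le_one) ?_, ?_, ?_, ?_⟩
  · rw [← sub_eq_zero, linearForm_sub_algebraMap] at h
    exact H'.linearForm_ne_zero (Or.inr (by simp)) h
  · intro a b hb hab
    simp at hb hab ⊢
    have h1 : (a ^ 2 - 1) ^ 2 = 0 := by linear_combination hab / 3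
    have h2 : (2⁻¹ + 2⁻¹ * a * b) * (2⁻¹ + 2⁻¹ * a * b - 1) = 0 := by
      linear_combination 1 / 4 * a ^ 2 * hb + (a ^ 2 - 1) / 4 * h1
    rcases mul_eq_zero.mp h2 with h | h
    · exact Or.inl h
    · exact Or.inr (sub_eq_zero.mp h)
  · simpa using hfib 0 (by norm_num)
  · simpa using hfib 1 (by norm_num)
  · have hε : ∀ i, (![1, -1] : Fin 2 → ℂ) i ^ 2 = 1 := by
      intro i
      fin_cases i <;> simp
    choose P hC using fun i => H'.exists_point_inv (hε i)
    refine hasZeroOrders_of_points (P := P) (k := ![3, 3]) (fun i j hij => ?_) ?_ (fun i => ?_)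
      fun Q hQ => ?_
    · exact injective_pair (by norm_num) ((hC i).eq_and_eq (hij ▸ hC j)).2
    · intro i
      fin_cases i <;> norm_num
    · rw [(P i).ord_inv, hord _ _ (hε i) (hC i)]
      fin_cases i <;> rfl
    · rw [Q.ord_inv] at hQ
      have hu : Q.ord u < 0 := by
        by_contra! h0
        obtain ⟨a, b, -, hQC⟩ := H'.exists_isCenteredAt_of_ord h0
        have := hQC.ord_linearForm_nonneg (C (1 / 2)) (C (1 / 2) * X)
        omega
      obtain ⟨ε, hε', hQC⟩ := H'.exists_isCenteredAt_inv hu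
      have h1 : (ε - 1) * (ε + 1) = 0 := by linear_combination hε'
      have h2 : ∃ i, ε = ![1, -1] i := by
        rcases mul_eq_zero.mp h1 with h | h
        · exact ⟨0, sub_eq_zero.mp h⟩
        · exact ⟨1, eq_neg_of_add_eq_zero_left h⟩
      obtain ⟨i, rfl⟩ := h2
      exact ⟨i, hQC.point_eq H'.isDoubleCover_inv (H'.isSmoothPoint_inv hε') (hC i)⟩

/-- `1/β` has norm `-8x³`, and `1/β - 1` has norm `4x⁶`. The sixfold pole of `1/β` is the point at
infinity with `ε = 1`; its zeros are `(0, 1/2)` and the other point at infinity. -/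
theorem belyiPair_6_6_33 :
    IsBelyiPairOfGenus 2 (X ^ 6 + 3 * X ^ 3 + C (1 / 4))
      (fun S => 1 / (1 + 1 / 2 * (-1 - 8 * S.x ^ 3 - 4 * S.x ^ 6) - (1 + 2 * S.x ^ 3) * S.y))
      {6} {6} {3, 3} := by
  have hs : Squarefree (X ^ 6 + 3 * X ^ 3 + C (1 / 4) : ℂ[X]) := by
    refine squarefree_of_forall_isRoot fun t ht ht' => ?_
    norm_num at ht ht'
    have h1 : t ^ 2 * (2 * t ^ 3 + 3) = 0 := by linear_combination ht' / 3
    rcases mul_eq_zero.mp h1 with h2 | h2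
    · have h3 : t = 0 := pow_eq_zero_iff two_ne_zero |>.mp h2
      rw [h3] at ht
      norm_num at ht
    · have : (2 : ℂ) = 0 := by linear_combination -ht + (t ^ 3 / 2 + 3 / 4) * h2
      norm_num at this
  have hd : (X ^ 6 + 3 * X ^ 3 + C (1 / 4) : ℂ[X]).natDegree = 6 := by compute_degree!
  refine ⟨⟨_, hs, Or.inr hd⟩, rfl, ?_⟩
  generalize hS : (⟨_, hs, Or.inr hd⟩ : HyperellipticCurve 2) = S
  have hf : S.f = X ^ 6 + 3 * X ^ 3 + C (1 / 4) := by rw [← hS]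
  have H : IsEvenCover 2 S.x S.y (X ^ 6 + 3 * X ^ 3 + C (1 / 4)) :=
    { hf ▸ S.isDoubleCover with
      squarefree := hs
      monic := by monicity!
      natDegree_eq := hd }
  have e : 1 / (1 + 1 / 2 * (-1 - 8 * S.x ^ 3 - 4 * S.x ^ 6) - (1 + 2 * S.x ^ 3) * S.y) =
      (linearForm S.x S.y (C (1 / 2) - 4 * X ^ 3 - 2 * X ^ 6) (-1 - 2 * X ^ 3))⁻¹ := by
    rw [one_div]
    congr 1
    simp only [linearForm, map_sub, map_mul, map_pow, map_neg, aeval_X, aeval_C, map_div₀, map_one,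
      map_ofNat]
    ring
  beta_reduce
  rw [e]
  set p : ℂ[X] := C (1 / 2) - 4 * X ^ 3 - 2 * X ^ 6 with hp
  set q : ℂ[X] := -1 - 2 * X ^ 3 with hq
  generalize S.x = u at H ⊢
  generalize S.y = v at H ⊢
  have hq0 : q ≠ 0 := by
    intro h
    have := congrArg (eval 0) h
    simp [hq] at this
  have hpd : p.natDegree ≤ 3 + (2 + 1) := by rw [hp]; compute_degree
  have hqd : q.natDegree ≤ 3 := by rw [hq]; compute_degree
  have hpc : p.coeff (3 + (2 + 1)) = -2 := by
    simp [hp, coeff_X_pow, coeff_ofNat_mul]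
  have hqc : q.coeff 3 = -2 := by
    simp [hq, coeff_one, coeff_X_pow, coeff_ofNat_mul]
  have hpos : ∀ P : CurvePoint ℂ S.FunctionField, IsCenteredAt P.localRing u⁻¹ (v / u ^ 3) 0 1 →
      P.ord (linearForm u v p q) = -6 := by
    intro P hC
    refine H.ord_linearForm (by norm_num) hC hpd hqd ?_
    rw [hpc, hqc]
    norm_num
  -- Here the leading terms of `p` and `qv` cancel. The order is found from the norm, of order `-3`,
  -- and from the conjugate, of order `-6`.
  have hneg : ∀ P : CurvePoint ℂ S.FunctionField,
      IsCenteredAt P.localRing u⁻¹ (v / u ^ 3) 0 (-1) → P.ord (linearForm u v p q) = 3 := by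
    intro P hC
    have h1 : P.ord (linearForm u v p (-q)) = -6 := by
      refine H.ord_linearForm (by norm_num) hC hpd (by rwa [natDegree_neg]) ?_
      rw [hpc, coeff_neg, hqc]
      norm_num
    have h2 := H.linearForm_mul_conj p q
    have h3 : p ^ 2 - q ^ 2 * (X ^ 6 + 3 * X ^ 3 + C (1 / 4)) = C (-8) * X ^ 3 := by
      refine Polynomial.funext fun t => ?_
      simp [hp, hq]
      ring
    rw [h3, map_mul, map_pow, aeval_X, aeval_C] at h2
    have h4 := congrArg P.ord h2
    rw [P.ord_mul (H.linearForm_ne_zero (Or.inr hq0))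
      (H.linearForm_ne_zero (Or.inr (neg_ne_zero.mpr hq0))), h1,
      P.ord_mul (by simp) (pow_ne_zero 3 H.fst_ne_zero), P.ord_algebraMap, P.ord_pow,
      H.ord_fst (by norm_num) hC] at h4
    push_cast at h4
    linarith
  have hcases : ∀ P : CurvePoint ℂ S.FunctionField, P.ord u < 0 →
      IsCenteredAt P.localRing u⁻¹ (v / u ^ 3) 0 1 ∨
        IsCenteredAt P.localRing u⁻¹ (v / u ^ 3) 0 (-1) := by
    intro P hP
    obtain ⟨ε, hε, hC⟩ := H.exists_isCenteredAt_inv hP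
    have h1 : (ε - 1) * (ε + 1) = 0 := by linear_combination hε
    rcases mul_eq_zero.mp h1 with h | h
    · rw [sub_eq_zero.mp h] at hC
      exact Or.inl hC
    · rw [eq_neg_of_add_eq_zero_left h] at hC
      exact Or.inr hC
  have hinf : ∀ P : CurvePoint ℂ S.FunctionField, P.ord u < 0 → ∀ c : ℂ, c ≠ 0 →
      P.ord (linearForm u v p q - algebraMap ℂ _ c) ≤ 0 := by
    intro P hP c hc
    rcases hcases P hP with hC | hC
    · have h1 := hpos P hC
      rw [P.ord_sub_algebraMap_of_neg c (by omega)]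
      omega
    · have h1 := hneg P hC
      exact (P.ord_sub_pos_of (z := linearForm u v p q) hc.symm
        (by rw [map_zero, sub_zero]; omega)).le
  have hzero : ∀ P : CurvePoint ℂ S.FunctionField, IsCenteredAt P.localRing u v 0 (1 / 2) →
      P.ord (linearForm u v p q) = 3 := by
    intro P hC
    refine hC.ord_linearForm_of_norm H.toIsDoubleCover (.of_squarefree hs ?_) (M := C (-8)) ?_ ?_
      ?_ ?_
    · norm_num
    · norm_num
    · refine Polynomial.funext fun t => ?_
      simp [hp, hq]
      ring
    · norm_num
    · simp [hp, hq]
  refine IsBelyiMap.inv_and_hasPassport_inv ⟨H.isBelyiMap_linearForm hs (fun c h => ?_)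
    (fun P hP c hc _ => (hinf P hP c hc).trans zero_le_one) ?_, ?_, ?_, ?_⟩
  · rw [← sub_eq_zero, linearForm_sub_algebraMap] at h
    exact H.linearForm_ne_zero (Or.inr hq0) h
  · intro a b hb hab
    simp [hp, hq] at hb hab ⊢
    -- The norm of the second factor is `-4a³`, so every finite critical point lies over `0`.
    have h1 : a ^ 2 * (2 * a ^ 6 + 5 * a ^ 3 + 1 + 2 * (1 + a ^ 3) * b) = 0 := by
      linear_combination -hab / 12
    have ha : a = 0 := by
      rcases mul_eq_zero.mp h1 with h2 | h2
      · exact pow_eq_zero_iff two_ne_zero |>.mp h2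
      · refine pow_eq_zero_iff three_ne_zero |>.mp ?_
        linear_combination (2 * (1 + a ^ 3) * b - (2 * a ^ 6 + 5 * a ^ 3 + 1)) / 4 * h2
          - (1 + a ^ 3) ^ 2 * hb
    subst ha
    have h3 : (b - 1 / 2) * (b + 1 / 2) = 0 := by linear_combination hb
    rcases mul_eq_zero.mp h3 with h | h
    · left; linear_combination -h
    · right; linear_combination -h
  · obtain ⟨P, hP⟩ := H.exists_point (.of_squarefree hs (a := 0) (b := 1 / 2) (by norm_num))
    obtain ⟨Q, hQ⟩ := H.exists_point_inv (ε := -1) (by norm_num)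
    have hQu := H.ord_fst (by norm_num) hQ
    refine hasZeroOrders_of_points (P := ![P, Q]) (k := ![3, 3]) (injective_pair ?_) ?_ ?_
      fun R hR => ?_
    · rintro rfl
      have := P.ord_nonneg hP.fst_mem
      omega
    · intro i
      fin_cases i <;> norm_num
    · exact Fin.forall_fin_two.mpr ⟨hzero P hP, hneg Q hQ⟩
    · rcases lt_or_ge (R.ord u) 0 with hu | hu
      · rcases hcases R hu with hC | hC
        · have := hpos R hC
          omega
        · exact ⟨1, hC.point_eq H.isDoubleCover_inv (H.isSmoothPoint_inv (by norm_num)) hQ⟩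
      · obtain ⟨a, b, hb, hC⟩ := H.exists_isCenteredAt_of_ord hu
        have h0 := hC.eval_eq_zero_of_ord_pos hR
        have h1 : a ^ 3 = 0 := by
          have h2 : p.eval a ^ 2 - q.eval a ^ 2 * b ^ 2 = 0 := by
            linear_combination (p.eval a - q.eval a * b) * h0
          simp [hp, hq] at hb h2
          rw [hb] at h2
          linear_combination -h2 / 8
        have h2 : a = 0 := pow_eq_zero_iff three_ne_zero |>.mp h1
        subst h2
        simp [hp, hq] at h0
        have h3 : b = 1 / 2 := by linear_combination -h0
        subst h3
        exact ⟨0, hC.point_eq H.toIsDoubleCover (.of_squarefree hs hb) hP⟩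
  · have := H.hasZeroOrders_linearForm_sub_of_norm hs 1 4
      (fun P hP => hinf P hP 1 one_ne_zero) (by norm_num) (A := ![0]) (k := ![6])
      (Function.injective_of_subsingleton _) ?_ ?_ ?_ ?_
    · simpa using this
    · intro i
      simp
    · intro t
      simp [hp, hq]
      ring
    · intro i
      simp [hp]
    · intro i
      simp [hq]
  · obtain ⟨P, hP⟩ := H.exists_point_inv (ε := 1) (by norm_num)
    refine hasZeroOrders_of_points (ι := Unit) (P := fun _ => P) (k := fun _ => 6)
      (fun _ _ _ => rfl) (fun _ => by norm_num)
      (fun _ => by rw [P.ord_inv, hpos P hP]; rfl) fun Q hQ => ⟨(), ?_⟩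
    rw [Q.ord_inv] at hQ
    have hu : Q.ord u < 0 := by
      by_contra! h0
      obtain ⟨a, b, -, hQC⟩ := H.exists_isCenteredAt_of_ord h0
      have := hQC.ord_linearForm_nonneg p q
      omega
    rcases hcases Q hu with hC | hC
    · exact hC.point_eq H.isDoubleCover_inv (H.isSmoothPoint_inv (by norm_num)) hP
    · have := hneg Q hC
      omega

/-! ### Translation on a cubic curve, and the two pairs that need it. -/

section Translation

/-- Addition of a point on a cubic curve in Weierstrass form. -/
theorem chord_sq {F : Type*} [Field F] {x y a b x₀ y₀ l u : F} (hx : x - x₀ ≠ 0)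
    (hy : y ^ 2 = x ^ 3 + a * x + b) (hy₀ : y₀ ^ 2 = x₀ ^ 3 + a * x₀ + b)
    (hl : l * (x - x₀) = y + y₀) (hu : u = l ^ 2 - x - x₀) :
    (l * (x₀ - u) + y₀) ^ 2 = u ^ 3 + a * u + b := by
  refine mul_left_cancel₀ hx ?_
  subst hu
  linear_combination (l ^ 2 - x - 2 * x₀) * (l * (x - x₀) - y₀ + y) * hl
    + (l ^ 2 - x - 2 * x₀) * hy + (2 * x + x₀ - l ^ 2) * hy₀

variable {K : Type*} [Field K] [Algebra ℂ K]

/-- `(u, v)` is `(x, y) - (x₀, y₀)` in the group law: `l` is the slope of the chord through `(x, y)`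
and `(x₀, -y₀)`. The equation is preserved and `(x₀, y₀)` goes to infinity, so a function with its
only pole there becomes a polynomial in the new coordinates. -/
theorem IsOddCover.translate {x y : K} {a b x₀ y₀ : ℂ}
    (H : IsOddCover 1 x y (X ^ 3 + C a * X + C b)) (hy₀ : y₀ ^ 2 = x₀ ^ 3 + a * x₀ + b)
    (hne : y₀ ≠ 0) {l u v : K}
    (hl : l = (y + algebraMap ℂ K y₀) / (x - algebraMap ℂ K x₀))
    (hu : u = l ^ 2 - x - algebraMap ℂ K x₀)
    (hv : v = l * (algebraMap ℂ K x₀ - u) + algebraMap ℂ K y₀) :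
    IsOddCover 1 u v (X ^ 3 + C a * X + C b) := by
  have hx := H.sub_algebraMap_ne_zero x₀
  have hy : y ^ 2 = x ^ 3 + algebraMap ℂ K a * x + algebraMap ℂ K b := by simpa using H.sq
  have hl' : l * (x - algebraMap ℂ K x₀) = y + algebraMap ℂ K y₀ := by
    rw [hl, div_mul_cancel₀ _ hx]
  have hy₀' := congrArg (algebraMap ℂ K) hy₀
  simp only [map_add, map_mul, map_pow] at hy₀'
  refine H.of_mem H.squarefree H.natDegree_eq ?_ fun L hu' hv' => ?_
  · rw [hv]
    simpa using chord_sq hx hy hy₀' hl' hu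
  · have hu0 : u - algebraMap ℂ K x₀ ≠ 0 := by
      intro h0
      have h1 : linearForm x y (X ^ 3 + C a * X + C b + C (y₀ ^ 2) - (X - C x₀) ^ 2 * (X + C (2 * x₀)))
          (C (2 * y₀)) = 0 := by
        have h2 : l ^ 2 = x + 2 * algebraMap ℂ K x₀ := by linear_combination h0 - hu
        have h3 : (y + algebraMap ℂ K y₀) ^ 2 =
            (x + 2 * algebraMap ℂ K x₀) * (x - algebraMap ℂ K x₀) ^ 2 := by
          rw [← hl', mul_pow, h2]
        simp only [linearForm, map_add, map_mul, map_sub, map_pow, aeval_X, aeval_C, map_ofNat]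
        linear_combination h3 - hy
      exact H.linearForm_ne_zero (Or.inr (by simpa using hne)) h1
    have hlL : l ∈ L := by
      have h1 : l = (algebraMap ℂ K y₀ - v) / (u - algebraMap ℂ K x₀) := by
        rw [eq_div_iff hu0, hv]
        ring
      rw [h1]
      exact div_mem (sub_mem (L.algebraMap_mem _) hv') (sub_mem hu' (L.algebraMap_mem _))
    have hxL : x ∈ L := by
      have h1 : x = l ^ 2 - u - algebraMap ℂ K x₀ := by rw [hu]; ring
      rw [h1]
      exact sub_mem (sub_mem (pow_mem hlL 2) hu') (L.algebraMap_mem _)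
    refine ⟨hxL, ?_⟩
    have h1 : y = l * (x - algebraMap ℂ K x₀) - algebraMap ℂ K y₀ := by rw [hl']; ring
    rw [h1]
    exact sub_mem (mul_mem hlL (sub_mem hxL (L.algebraMap_mem _))) (L.algebraMap_mem _)

end Translation

/-- `β` in the translated coordinates, where it is `1/2 + q(u)v` with linear `q` and a fivefold pole
at infinity. The critical polynomial `2q'h + qh'` is a constant times `(u - ξ²/5)³`, matching the
root of multiplicity four of the norm. -/
theorem IsOddCover.isBelyi_41_41_5 {K : Type*} [Field K] [Algebra ℂ K] {ξ : ℂ} (hξ : ξ ^ 4 - 45 = 0)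
    {u v : K} (H : IsOddCover 1 u v (X ^ 3 + C 9 * X + C (18 / 5 * ξ ^ 2))) :
    IsBelyiMap (linearForm u v (C (1 / 2)) (C (5 / 864 * ξ ^ 3) + C (-5 / 864 * ξ) * X)) ∧
        HasPassport (linearForm u v (C (1 / 2)) (C (5 / 864 * ξ ^ 3) + C (-5 / 864 * ξ) * X))
        {4, 1} {4, 1} {5} := by
  have hd : -5 / 864 * ξ ≠ 0 := ne_of_mul_sub_eq_one (z := -96 / 25 * ξ ^ 3) (by
      linear_combination (1 / 45) * hξ)
  have he : -25 / 746496 * ξ ^ 2 ≠ 0 := ne_of_mul_sub_eq_one (z := -82944 / 125 * ξ ^ 2) (by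
      linear_combination (1 / 45) * hξ)
  have hr : 1 / 5 * ξ ^ 2 ≠ 6 / 5 * ξ ^ 2 := ne_of_mul_sub_eq_one (z := -1 / 45 * ξ ^ 2)
    (by linear_combination (1 / 45) * hξ)
  have hq0 : (5 / 864 * ξ ^ 3) + (-5 / 864 * ξ) * (1 / 5 * ξ ^ 2) ≠ 0 :=
      ne_of_mul_sub_eq_one (z := 24 / 5 * ξ)
    (by linear_combination (1 / 45) * hξ)
  have hq1 : (5 / 864 * ξ ^ 3) + (-5 / 864 * ξ) * (6 / 5 * ξ ^ 2) ≠ 0 :=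
      ne_of_mul_sub_eq_one (z := -96 / 5 * ξ)
    (by linear_combination (1 / 45) * hξ)
  refine H.isBelyi_half_add (A := ![1 / 5 * ξ ^ 2, 6 / 5 * ξ ^ 2]) (k := ![4, 1]) (d := -25
      / 746496 * ξ ^ 2) ?_ (fun s hs => ?_) he (injective_pair hr) ?_ (fun s => ?_) ?_
  · rw [natDegree_linear_of_ne hd]
  · simp only [eval_cubic, eval_derivative_cubic, eval_linear, eval_derivative_linear] at hs ⊢
    have h0 : (s - (1 / 5 * ξ ^ 2)) ^ 3 = 0 := by
      linear_combination (-96 / 125 * ξ ^ 3) * hs + (1 / 75 * ξ ^ 2 * s ^ 2 - 1 / 45 * s ^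
          3) * hξ
    have h1 := pow_eq_zero_iff (by norm_num) |>.mp h0
    linear_combination (1 / 291600 * ξ ^ 10 + 1 / 58320 * ξ ^ 8 * s + 1 / 11664 * ξ ^ 6 * s
        ^ 2 - 1 / 10368 * ξ ^ 6 - 5 / 20736 * ξ ^ 4 * s ^ 3 - 35 / 20736 * ξ ^ 4 * s + 25 /
        186624 * ξ ^ 2 * s ^ 4 + 25 / 20736 * ξ ^ 2 * s ^ 2) * h1 + (1 / 1458000 * ξ ^ 8 + 1 /
        2025 * ξ ^ 4 + 1 / 45) * hξ
  · exact Fin.forall_fin_two.mpr ⟨by norm_num, by norm_num⟩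
  · rw [Fin.prod_univ_two, eval_cubic, eval_linear]
    change _ = (-25 / 746496 * ξ ^ 2) * ((s - (1 / 5 * ξ ^ 2)) ^ 4 * (s - (6 / 5 * ξ ^ 2)) ^
        1)
    linear_combination (-1 / 15552000 * ξ ^ 8 + 1 / 746496 * ξ ^ 6 * s - 1 / 93312 * ξ ^ 4 *
        s ^ 2 - 1 / 8100 * ξ ^ 4 + 5 / 746496 * ξ ^ 2 * s ^ 3 - 1 / 180) * hξ
  · simp only [eval_linear]
    exact Fin.forall_fin_two.mpr ⟨hq0, hq1⟩

/-- Compares the two expressions for `β`. The denominator is `(x - 9ξ²/5)⁵` modulo `ξ⁴ = 45`; once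
it is cleared, the chord formulas for `u` and `v` and the equation of the curve give a polynomial
identity. -/
theorem belyiPair_41_41_5_aux {F : Type*} [Field F] [CharZero F] {t x y l u v : F} (ht : t ^ 4 - 45 = 0)
    (hy : y ^ 2 = 18 / 5 * t ^ 2 + x ^ 3 + 9 * x) (hx : x - (9 / 5 * t ^ 2) ≠ 0)
    (hl : l = (y + (84 / 5 * t)) / (x - (9 / 5 * t ^ 2))) (hu : u = l ^ 2 - x - (9 / 5 * t ^
        2))
    (hv : v = l * (9 / 5 * t ^ 2 - u) + 84 / 5 * t) :
    (16 / 3 * t ^ 3 * x ^ 3 + 1680 * t * x ^ 2 + 9216 / 25 * t ^ 3 * x - 29376 / 5 * t) / (x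
        ^ 5 - 9 * t ^ 2 * x ^ 4 + 1458 * x ^ 3 - 13122 / 5 * t ^ 2 * x ^ 2 + 531441 / 5 * x -
        4782969 / 125 * t ^ 2) * y + (4 * x ^ 5 + 132 * t ^ 2 * x ^ 4 + 10620 * x ^ 3 - 2484 * t
        ^ 2 * x ^ 2 + 603936 / 5 * x - 3158352 / 125 * t ^ 2) / (x ^ 5 - 9 * t ^ 2 * x ^ 4 +
        1458 * x ^ 3 - 13122 / 5 * t ^ 2 * x ^ 2 + 531441 / 5 * x - 4782969 / 125 * t ^ 2) = 1 /
        2 + (5 / 864 * t ^ 3 + (-5 / 864 * t) * u) * v := by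
  have hl' : l * (x - (9 / 5 * t ^ 2)) = y + (84 / 5 * t) := by rw [hl, div_mul_cancel₀ _
      hx]
  have hQ : x ^ 5 - 9 * t ^ 2 * x ^ 4 + 1458 * x ^ 3 - 13122 / 5 * t ^ 2 * x ^ 2 + 531441 /
      5 * x - 4782969 / 125 * t ^ 2 = (x - (9 / 5 * t ^ 2)) ^ 5 := by
    linear_combination (59049 / 3125 * t ^ 6 - 6561 / 125 * t ^ 4 * x + 1458 / 25 * t ^ 2 *
        x ^ 2 + 531441 / 625 * t ^ 2 - 162 / 5 * x ^ 3 - 59049 / 25 * x) * ht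
  have hU : u * (x - (9 / 5 * t ^ 2)) ^ 2 = (y + (84 / 5 * t)) ^ 2 - (x + (9 / 5 * t ^ 2)) *
      (x - (9 / 5 * t ^ 2)) ^ 2 := by
    rw [hu, ← hl']
    ring
  have hV : v * (x - (9 / 5 * t ^ 2)) ^ 3 = (y + (84 / 5 * t)) * ((9 / 5 * t ^ 2) * (x - (9
      / 5 * t ^ 2)) ^ 2 - ((y + (84 / 5 * t)) ^ 2 - (x + (9 / 5 * t ^ 2)) * (x - (9 / 5 * t ^
      2)) ^ 2)) + (84 / 5 * t) * (x - (9 / 5 * t ^ 2)) ^ 3 := by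
    rw [hv, ← hU, ← hl']
    ring
  rw [hQ, div_mul_eq_mul_div, ← add_div, div_eq_iff (pow_ne_zero 5 hx)]
  linear_combination (5481 / 1000 * t ^ 8 + 3 / 25 * t ^ 7 * y - 777 / 200 * t ^ 6 * x - 23
      / 240 * t ^ 5 * x * y - 91 / 120 * t ^ 4 * x ^ 2 - 5523 / 20 * t ^ 4 - 1 / 216 * t ^ 3 * x
      ^ 2 * y - 785 / 48 * t ^ 3 * y + 7 / 36 * t ^ 2 * x ^ 3 - 35 / 8 * t ^ 2 * x - 35 / 72 * t
      ^ 2 * y ^ 2 + 5 / 864 * t * x ^ 3 * y - 5 / 96 * t * x * y - 5 / 864 * t * y ^ 3) * hy +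
      (-321489 / 62500 * t ^ 10 - 15309 / 25000 * t ^ 9 * y + 96957 / 25000 * t ^ 8 * x + 243 /
      250 * t ^ 7 * x * y + 13041 / 2500 * t ^ 6 * x ^ 2 + 1291707 / 6250 * t ^ 6 - 1323 / 4000
      * t ^ 5 * x ^ 2 * y + 55431 / 1000 * t ^ 5 * y - 441 / 1000 * t ^ 4 * x ^ 3 - 1017 / 250 *
      t ^ 4 * x - 9 / 200 * t ^ 3 * x ^ 3 * y - 4917 / 1000 * t ^ 3 * x * y - 119 / 40 * t ^ 2 *
      x ^ 4 + 2243 / 40 * t ^ 2 * x ^ 2 + 350928 / 625 * t ^ 2 - 3583 / 96 * t * x ^ 2 * y +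
      3264 / 25 * t * y - 7 / 90 * x ^ 5 - 236 * x ^ 3 - 67104 / 25 * x) * ht - (5 / 864 * t ^
      3) * (x - (9 / 5 * t ^ 2)) ^ 2 * hV - (-5 / 864 * t) * (u * (x - (9 / 5 * t ^ 2)) ^ 2 * hV
      + ((y + (84 / 5 * t)) * ((9 / 5 * t ^ 2) * (x - (9 / 5 * t ^ 2)) ^ 2 - ((y + (84 / 5 * t))
      ^ 2 - (x + (9 / 5 * t ^ 2)) * (x - (9 / 5 * t ^ 2)) ^ 2)) + (84 / 5 * t) * (x - (9 / 5 * t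
      ^ 2)) ^ 3) * hU)

theorem belyiPair_41_41_5 {ξ : ℂ} (hξ : ξ ^ 4 - 45 = 0) :
    IsQuarticBelyiPairOfGenus 1 ξ
        (X ^ 3 + 9 * X + C (18 / 5 * ξ ^ 2))
        (fun S =>
          ((16 / 3 * ξ ^ 3) • S.x ^ 3 + (1680 * ξ) • S.x ^ 2 + (9216 / 25 * ξ ^ 3) • S.x
              - algebraMap ℂ _ (29376 / 5 * ξ))
            / (S.x ^ 5 - (9 * ξ ^ 2) • S.x ^ 4 + 1458 * S.x ^ 3 - (13122 / 5 * ξ ^ 2) • S.x ^ 2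
              + 531441 / 5 * S.x - algebraMap ℂ _ (4782969 / 125 * ξ ^ 2)) * S.y
          + (4 * S.x ^ 5 + (132 * ξ ^ 2) • S.x ^ 4 + 10620 * S.x ^ 3 - (2484 * ξ ^ 2) • S.x ^ 2
              + 603936 / 5 * S.x - algebraMap ℂ _ (3158352 / 125 * ξ ^ 2))
            / (S.x ^ 5 - (9 * ξ ^ 2) • S.x ^ 4 + 1458 * S.x ^ 3 - (13122 / 5 * ξ ^ 2) • S.x ^ 2
              + 531441 / 5 * S.x - algebraMap ℂ _ (4782969 / 125 * ξ ^ 2)))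
        {4, 1} {4, 1} {5} := by
  refine .intro (finrank_adjoin_of_sub_forty_five hξ) rfl (a := 9) (b := 18 / 5 * ξ ^ 2)
    (ne_of_mul_sub_eq_one (z := 5 / 93312)
      (by linear_combination (3 / 160) * hξ))
    ?_ ?_ (fun S H => ?_) (fun S F hx hy hc => ?_)
  · exact ofNat_mem _ _
  · exact mul_mem (div_mem (ofNat_mem _ _) (ofNat_mem _ _))
      (pow_mem (mem_adjoin_simple_self ℚ ξ) 2)
  · obtain ⟨l, hl⟩ : ∃ l, l = (S.y + algebraMap ℂ S.FunctionField (84 / 5 * ξ)) / (S.x -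
      algebraMap ℂ S.FunctionField (9 / 5 * ξ ^ 2)) := ⟨_, rfl⟩
    obtain ⟨u, hu⟩ : ∃ u, u = l ^ 2 - S.x - algebraMap ℂ S.FunctionField (9 / 5 * ξ ^ 2) :=
        ⟨_, rfl⟩
    obtain ⟨v, hv⟩ : ∃ v, v = l * (algebraMap ℂ S.FunctionField (9 / 5 * ξ ^ 2) - u) +
        algebraMap ℂ S.FunctionField (84 / 5 * ξ) := ⟨_, rfl⟩
    -- The point `(9ξ²/5, 84ξ/5)` is the pole of `β`.
    have H' := H.translate (x₀ := 9 / 5 * ξ ^ 2) (y₀ := 84 / 5 * ξ) (by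
        linear_combination (-729 / 125 * ξ ^ 2) * hξ)
      (ne_of_mul_sub_eq_one (z := 1 / 756 * ξ ^ 3) (by linear_combination (1 / 45) * hξ)) hl
          hu hv
    have hβ := IsOddCover.isBelyi_41_41_5 hξ H'
    have hy := H.sq
    have ht := congrArg (algebraMap ℂ S.FunctionField) hξ
    have hx := H.sub_algebraMap_ne_zero (9 / 5 * ξ ^ 2)
    simp only [linearForm, map_add, map_sub, map_mul, map_pow, map_div₀, map_neg, map_ofNat, map_one,
      map_zero, aeval_X, aeval_C] at hy ht hx hl hu hv hβ
    have e := belyiPair_41_41_5_aux ht (hy.trans (by ring)) hx hl hu hv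
    simp only [Algebra.smul_def, map_mul, map_pow, map_div₀, map_ofNat]
    rw [e]
    exact hβ
  · simp only [Algebra.smul_def]
    repeat' with_reducible_and_instances (first
        | exact hx | exact hy | exact ofNat_mem _ _ | exact mem_adjoin_simple_self ℚ ξ
        | apply add_mem | apply sub_mem | apply div_mem | apply mul_mem | apply pow_mem | apply hc)

/-- As for the previous passport; the norm now has a triple root `-ξ²/10` and a double root
`11ξ²/40`, so the critical polynomial has both as roots, with multiplicities two and one. -/
theorem IsOddCover.isBelyi_32_32_5 {K : Type*} [Field K] [Algebra ℂ K] {ξ : ℂ} (hξ : ξ ^ 4 + 40 = 0)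
    {u v : K} (H : IsOddCover 1 u v (X ^ 3 + C 3 * X + C (37 / 80 * ξ ^ 2))) :
    IsBelyiMap (linearForm u v (C (1 / 2)) (C (5 / 324 * ξ ^ 3) + C (-10 / 81 * ξ) * X)) ∧
        HasPassport (linearForm u v (C (1 / 2)) (C (5 / 324 * ξ ^ 3) + C (-10 / 81 * ξ) * X))
        {3, 2} {3, 2} {5} := by
  have hd : -10 / 81 * ξ ≠ 0 := ne_of_mul_sub_eq_one (z := 81 / 400 * ξ ^ 3) (by
      linear_combination (-1 / 40) * hξ)
  have he : -100 / 6561 * ξ ^ 2 ≠ 0 := ne_of_mul_sub_eq_one (z := 6561 / 4000 * ξ ^ 2) (by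
      linear_combination (-1 / 40) * hξ)
  have hr : -1 / 10 * ξ ^ 2 ≠ 11 / 40 * ξ ^ 2 := ne_of_mul_sub_eq_one (z := 1 / 15 * ξ ^ 2)
    (by linear_combination (-1 / 40) * hξ)
  have hq0 : (5 / 324 * ξ ^ 3) + (-10 / 81 * ξ) * (-1 / 10 * ξ ^ 2) ≠ 0 :=
      ne_of_mul_sub_eq_one (z := -9 / 10 * ξ)
    (by linear_combination (-1 / 40) * hξ)
  have hq1 : (5 / 324 * ξ ^ 3) + (-10 / 81 * ξ) * (11 / 40 * ξ ^ 2) ≠ 0 :=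
      ne_of_mul_sub_eq_one (z := 27 / 20 * ξ)
    (by linear_combination (-1 / 40) * hξ)
  refine H.isBelyi_half_add (A := ![-1 / 10 * ξ ^ 2, 11 / 40 * ξ ^ 2]) (k := ![3, 2]) (d :=
      -100 / 6561 * ξ ^ 2) ?_ (fun s hs => ?_) he (injective_pair hr) ?_ (fun s => ?_) ?_
  · rw [natDegree_linear_of_ne hd]
  · simp only [eval_cubic, eval_derivative_cubic, eval_linear, eval_derivative_linear] at hs ⊢
    have h0 : (s - (-1 / 10 * ξ ^ 2)) ^ 2 * (s - (11 / 40 * ξ ^ 2)) ^ 1 = 0 := by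
      linear_combination (81 / 2000 * ξ ^ 3) * hs + (-3 / 1600 * ξ ^ 2 * s ^ 2 + 1 / 40 * s
          ^ 3) * hξ
    rcases mul_eq_zero.mp h0 with h | h
    · have h1 := pow_eq_zero_iff (by norm_num) |>.mp h
      linear_combination (1 / 32400 * ξ ^ 10 - 1 / 3240 * ξ ^ 8 * s + 1 / 324 * ξ ^ 6 * s ^
          2 - 4 / 6561 * ξ ^ 6 - 140 / 6561 * ξ ^ 4 * s ^ 3 - 235 / 6561 * ξ ^ 4 * s + 400 /
          6561 * ξ ^ 2 * s ^ 4 + 400 / 2187 * ξ ^ 2 * s ^ 2) * h1 + (-1 / 324000 * ξ ^ 8 + 1 /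
          1600 * ξ ^ 4 - 1 / 40) * hξ
    · have h1 := pow_eq_zero_iff (by norm_num) |>.mp h
      linear_combination (121 / 1166400 * ξ ^ 10 + 11 / 29160 * ξ ^ 8 * s + 1 / 729 * ξ ^ 6
          * s ^ 2 + 253 / 52488 * ξ ^ 6 + 10 / 6561 * ξ ^ 4 * s ^ 3 + 215 / 6561 * ξ ^ 4 * s +
          400 / 6561 * ξ ^ 2 * s ^ 4 + 400 / 2187 * ξ ^ 2 * s ^ 2) * h1 + (1331 / 46656000 * ξ ^
          8 + 1 / 1600 * ξ ^ 4 - 1 / 40) * hξ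
  · exact Fin.forall_fin_two.mpr ⟨by norm_num, by norm_num⟩
  · rw [Fin.prod_univ_two, eval_cubic, eval_linear]
    change _ = (-100 / 6561 * ξ ^ 2) * ((s - (-1 / 10 * ξ ^ 2)) ^ 3 * (s - (11 / 40 * ξ ^
        2)) ^ 2)
    linear_combination (121 / 104976000 * ξ ^ 8 + 11 / 419904 * ξ ^ 6 * s + 23 / 209952 * ξ
        ^ 4 * s ^ 2 - 1 / 6400 * ξ ^ 4 - 5 / 4374 * ξ ^ 2 * s ^ 3 + 1 / 160) * hξ
  · simp only [eval_linear]
    exact Fin.forall_fin_two.mpr ⟨hq0, hq1⟩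

theorem belyiPair_32_32_5_aux {F : Type*} [Field F] [CharZero F] {t x y l u v : F} (ht : t ^ 4 + 40 = 0)
    (hy : y ^ 2 = 37 / 80 * t ^ 2 + x ^ 3 + 3 * x) (hx : x - (-2 / 5 * t ^ 2) ≠ 0)
    (hl : l = (y + (27 / 20 * t)) / (x - (-2 / 5 * t ^ 2))) (hu : u = l ^ 2 - x - (-2 / 5 *
        t ^ 2))
    (hv : v = l * (-2 / 5 * t ^ 2 - u) + 27 / 20 * t) :
    (3 / 2 * t ^ 3 * x ^ 3 + 45 / 2 * t * x ^ 2 + 153 / 50 * t ^ 3 * x - 69 / 5 * t) / (x ^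
        5 + 2 * t ^ 2 * x ^ 4 - 64 * x ^ 3 - 128 / 5 * t ^ 2 * x ^ 2 + 1024 / 5 * x + 2048 / 125
        * t ^ 2) * y + (4 * x ^ 5 - 17 / 2 * t ^ 2 * x ^ 4 - 10 * x ^ 3 - 173 / 8 * t ^ 2 * x ^
        2 + 679 / 5 * x + 461 / 500 * t ^ 2) / (x ^ 5 + 2 * t ^ 2 * x ^ 4 - 64 * x ^ 3 - 128 / 5
        * t ^ 2 * x ^ 2 + 1024 / 5 * x + 2048 / 125 * t ^ 2) = 1 / 2 + (5 / 324 * t ^ 3 + (-10 /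
        81 * t) * u) * v := by
  have hl' : l * (x - (-2 / 5 * t ^ 2)) = y + (27 / 20 * t) := by rw [hl, div_mul_cancel₀ _
      hx]
  have hQ : x ^ 5 + 2 * t ^ 2 * x ^ 4 - 64 * x ^ 3 - 128 / 5 * t ^ 2 * x ^ 2 + 1024 / 5 * x
      + 2048 / 125 * t ^ 2 = (x - (-2 / 5 * t ^ 2)) ^ 5 := by
    linear_combination (-32 / 3125 * t ^ 6 - 16 / 125 * t ^ 4 * x - 16 / 25 * t ^ 2 * x ^ 2
        + 256 / 625 * t ^ 2 - 8 / 5 * x ^ 3 + 128 / 25 * x) * ht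
  have hU : u * (x - (-2 / 5 * t ^ 2)) ^ 2 = (y + (27 / 20 * t)) ^ 2 - (x + (-2 / 5 * t ^
      2)) * (x - (-2 / 5 * t ^ 2)) ^ 2 := by
    rw [hu, ← hl']
    ring
  have hV : v * (x - (-2 / 5 * t ^ 2)) ^ 3 = (y + (27 / 20 * t)) * ((-2 / 5 * t ^ 2) * (x -
      (-2 / 5 * t ^ 2)) ^ 2 - ((y + (27 / 20 * t)) ^ 2 - (x + (-2 / 5 * t ^ 2)) * (x - (-2 / 5 *
      t ^ 2)) ^ 2)) + (27 / 20 * t) * (x - (-2 / 5 * t ^ 2)) ^ 3 := by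
    rw [hv, ← hU, ← hl']
    ring
  rw [hQ, div_mul_eq_mul_div, ← add_div, div_eq_iff (pow_ne_zero 5 hx)]
  linear_combination (-113 / 1500 * t ^ 8 - 43 / 2025 * t ^ 7 * y - 19 / 100 * t ^ 6 * x - 1
      / 15 * t ^ 5 * x * y + 37 / 80 * t ^ 4 * x ^ 2 - 1643 / 480 * t ^ 4 + 7 / 108 * t ^ 3 * x
      ^ 2 * y - 1495 / 648 * t ^ 3 * y + 1 / 3 * t ^ 2 * x ^ 3 - 5 / 2 * t ^ 2 * x - 5 / 6 * t ^
      2 * y ^ 2 + 10 / 81 * t * x ^ 3 * y - 10 / 27 * t * x * y - 10 / 81 * t * y ^ 3) * hy +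
      (-22 / 46875 * t ^ 10 - 176 / 253125 * t ^ 9 * y - 2 / 3125 * t ^ 8 * x - 4 / 1125 * t ^ 7
      * x * y + 9 / 625 * t ^ 6 * x ^ 2 - 8099 / 150000 * t ^ 6 + 16 / 3375 * t ^ 5 * x ^ 2 * y
      - 2807 / 40500 * t ^ 5 * y - 19 / 500 * t ^ 4 * x ^ 3 - 741 / 2000 * t ^ 4 * x + 7 / 225 *
      t ^ 3 * x ^ 3 * y - 1361 / 13500 * t ^ 3 * x * y - 11 / 40 * t ^ 2 * x ^ 4 - 233 / 320 * t
      ^ 2 * x ^ 2 + 461 / 20000 * t ^ 2 + 77 / 144 * t * x ^ 2 * y - 69 / 200 * t * y + 7 / 80 *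
      x ^ 5 - 1 / 4 * x ^ 3 + 679 / 200 * x) * ht - (5 / 324 * t ^ 3) * (x - (-2 / 5 * t ^ 2)) ^
      2 * hV - (-10 / 81 * t) * (u * (x - (-2 / 5 * t ^ 2)) ^ 2 * hV + ((y + (27 / 20 * t)) *
      ((-2 / 5 * t ^ 2) * (x - (-2 / 5 * t ^ 2)) ^ 2 - ((y + (27 / 20 * t)) ^ 2 - (x + (-2 / 5 *
      t ^ 2)) * (x - (-2 / 5 * t ^ 2)) ^ 2)) + (27 / 20 * t) * (x - (-2 / 5 * t ^ 2)) ^ 3) * hU)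

theorem belyiPair_32_32_5 {ξ : ℂ} (hξ : ξ ^ 4 + 40 = 0) :
    IsQuarticBelyiPairOfGenus 1 ξ
        (X ^ 3 + 3 * X + C (37 / 80 * ξ ^ 2))
        (fun S =>
          ((3 / 2 * ξ ^ 3) • S.x ^ 3 + (45 / 2 * ξ) • S.x ^ 2 + (153 / 50 * ξ ^ 3) • S.x
              - algebraMap ℂ _ (69 / 5 * ξ))
            / (S.x ^ 5 + (2 * ξ ^ 2) • S.x ^ 4 - 64 * S.x ^ 3 - (128 / 5 * ξ ^ 2) • S.x ^ 2
              + 1024 / 5 * S.x + algebraMap ℂ _ (2048 / 125 * ξ ^ 2)) * S.y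
          + (4 * S.x ^ 5 - (17 / 2 * ξ ^ 2) • S.x ^ 4 - 10 * S.x ^ 3 - (173 / 8 * ξ ^ 2) • S.x ^ 2
              + 679 / 5 * S.x + algebraMap ℂ _ (461 / 500 * ξ ^ 2))
            / (S.x ^ 5 + (2 * ξ ^ 2) • S.x ^ 4 - 64 * S.x ^ 3 - (128 / 5 * ξ ^ 2) • S.x ^ 2
              + 1024 / 5 * S.x + algebraMap ℂ _ (2048 / 125 * ξ ^ 2)))
        {3, 2} {3, 2} {5} := by
  refine .intro (finrank_adjoin_of_add_forty hξ) rfl (a := 3) (b := 37 / 80 * ξ ^ 2)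
    (ne_of_mul_sub_eq_one (z := -160 / 19683)
      (by linear_combination (-1369 / 29160) * hξ))
    ?_ ?_ (fun S H => ?_) (fun S F hx hy hc => ?_)
  · exact ofNat_mem _ _
  · exact mul_mem (div_mem (ofNat_mem _ _) (ofNat_mem _ _))
      (pow_mem (mem_adjoin_simple_self ℚ ξ) 2)
  · obtain ⟨l, hl⟩ : ∃ l, l = (S.y + algebraMap ℂ S.FunctionField (27 / 20 * ξ)) / (S.x -
      algebraMap ℂ S.FunctionField (-2 / 5 * ξ ^ 2)) := ⟨_, rfl⟩
    obtain ⟨u, hu⟩ : ∃ u, u = l ^ 2 - S.x - algebraMap ℂ S.FunctionField (-2 / 5 * ξ ^ 2) :=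
        ⟨_, rfl⟩
    obtain ⟨v, hv⟩ : ∃ v, v = l * (algebraMap ℂ S.FunctionField (-2 / 5 * ξ ^ 2) - u) +
        algebraMap ℂ S.FunctionField (27 / 20 * ξ) := ⟨_, rfl⟩
    -- The point `(-2ξ²/5, 27ξ/20)` is the pole of `β`.
    have H' := H.translate (x₀ := -2 / 5 * ξ ^ 2) (y₀ := 27 / 20 * ξ) (by
        linear_combination (8 / 125 * ξ ^ 2) * hξ)
      (ne_of_mul_sub_eq_one (z := -1 / 54 * ξ ^ 3) (by linear_combination (-1 / 40) * hξ))
          hl hu hv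
    have hβ := IsOddCover.isBelyi_32_32_5 hξ H'
    have hy := H.sq
    have ht := congrArg (algebraMap ℂ S.FunctionField) hξ
    have hx := H.sub_algebraMap_ne_zero (-2 / 5 * ξ ^ 2)
    simp only [linearForm, map_add, map_mul, map_pow, map_div₀, map_neg, map_ofNat, map_one,
      map_zero, aeval_X, aeval_C] at hy ht hx hl hu hv hβ
    have e := belyiPair_32_32_5_aux ht (hy.trans (by ring)) hx hl hu hv
    simp only [Algebra.smul_def, map_mul, map_pow, map_div₀, map_ofNat]
    rw [e]
    exact hβ
  · simp only [Algebra.smul_def]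
    repeat' with_reducible_and_instances (first
        | exact hx | exact hy | exact ofNat_mem _ _ | exact mem_adjoin_simple_self ℚ ξ
        | apply add_mem | apply sub_mem | apply div_mem | apply mul_mem | apply pow_mem | apply hc)

theorem mainTheorem4 :
    -- genus 1
    IsBelyiPairOfGenus 1 (X ^ 3 + 1) (fun S => 1 / 2 * (1 + S.y)) {3} {3} {3} ∧
    (∀ ξ : ℂ, ξ ^ 4 - 2 = 0 →
      IsQuarticBelyiPairOfGenus 1 ξ
        (X ^ 3 + C (47 / 1944) * X + C (2359 / 314928 * ξ ^ 2))
        (fun S => 1 / (467 / 972 + (ξ ^ 2 / 9) • S.x - 6 * S.x ^ 2 - (4 * ξ) • S.y))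
        {4} {4} {3, 1}) ∧
    IsBelyiPairOfGenus 1 (X ^ 3 - X) (fun S => (S.x + 1) ^ 2 / (4 * S.x)) {4} {4} {2, 2} ∧
    (∀ ξ : ℂ, ξ ^ 4 - 2 * ξ ^ 3 - 6 * ξ ^ 2 - 8 * ξ + 16 = 0 →
      IsQuarticBelyiPairOfGenus 1 ξ
        (X ^ 3 + C (25 / 324) * X
          + C (1 / 839808 * (-1975 * ξ ^ 3 + 3950 * ξ ^ 2 + 19750 * ξ + 7900)))
        (fun S => -24300 /
          (25 * (-424 + 3888 * S.x ^ 2 + (9 * (2 + ξ) * (-2 + (-4 + ξ) * ξ)) • S.x)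
            + 108 * S.y * (algebraMap ℂ _ (50 * (-8 + ξ * (-2 + (-2 + ξ) * ξ)))
              + (9 * (-32 + ξ * (-18 + ξ * (6 + ξ)))) • S.x)))
        {5} {5} {3, 1, 1}) ∧
    (∀ ξ : ℂ, ξ ^ 4 + 10 = 0 →
      IsQuarticBelyiPairOfGenus 1 ξ
        (X ^ 3 - C (5275 / 6144) * X + C (77675 / 1769472 * ξ ^ 2))
        (fun S => 1 / (17969 / 18432 - (ξ ^ 2 / 96) • S.x - S.x ^ 2
          - (algebraMap ℂ _ (-(ξ / 24)) - (4 * ξ ^ 3 / 25) • S.x) * S.y))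
        {5} {5} {2, 2, 1}) ∧
    (∀ ξ : ℂ, ξ ^ 4 - 45 = 0 →
      IsQuarticBelyiPairOfGenus 1 ξ
        (X ^ 3 + 9 * X + C (18 / 5 * ξ ^ 2))
        (fun S =>
          ((16 / 3 * ξ ^ 3) • S.x ^ 3 + (1680 * ξ) • S.x ^ 2 + (9216 / 25 * ξ ^ 3) • S.x
              - algebraMap ℂ _ (29376 / 5 * ξ))
            / (S.x ^ 5 - (9 * ξ ^ 2) • S.x ^ 4 + 1458 * S.x ^ 3 - (13122 / 5 * ξ ^ 2) • S.x ^ 2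
              + 531441 / 5 * S.x - algebraMap ℂ _ (4782969 / 125 * ξ ^ 2)) * S.y
          + (4 * S.x ^ 5 + (132 * ξ ^ 2) • S.x ^ 4 + 10620 * S.x ^ 3 - (2484 * ξ ^ 2) • S.x ^ 2
              + 603936 / 5 * S.x - algebraMap ℂ _ (3158352 / 125 * ξ ^ 2))
            / (S.x ^ 5 - (9 * ξ ^ 2) • S.x ^ 4 + 1458 * S.x ^ 3 - (13122 / 5 * ξ ^ 2) • S.x ^ 2
              + 531441 / 5 * S.x - algebraMap ℂ _ (4782969 / 125 * ξ ^ 2)))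
        {4, 1} {4, 1} {5}) ∧
    (∀ ξ : ℂ, ξ ^ 4 + 40 = 0 →
      IsQuarticBelyiPairOfGenus 1 ξ
        (X ^ 3 + 3 * X + C (37 / 80 * ξ ^ 2))
        (fun S =>
          ((3 / 2 * ξ ^ 3) • S.x ^ 3 + (45 / 2 * ξ) • S.x ^ 2 + (153 / 50 * ξ ^ 3) • S.x
              - algebraMap ℂ _ (69 / 5 * ξ))
            / (S.x ^ 5 + (2 * ξ ^ 2) • S.x ^ 4 - 64 * S.x ^ 3 - (128 / 5 * ξ ^ 2) • S.x ^ 2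
              + 1024 / 5 * S.x + algebraMap ℂ _ (2048 / 125 * ξ ^ 2)) * S.y
          + (4 * S.x ^ 5 - (17 / 2 * ξ ^ 2) • S.x ^ 4 - 10 * S.x ^ 3 - (173 / 8 * ξ ^ 2) • S.x ^ 2
              + 679 / 5 * S.x + algebraMap ℂ _ (461 / 500 * ξ ^ 2))
            / (S.x ^ 5 + (2 * ξ ^ 2) • S.x ^ 4 - 64 * S.x ^ 3 - (128 / 5 * ξ ^ 2) • S.x ^ 2
              + 1024 / 5 * S.x + algebraMap ℂ _ (2048 / 125 * ξ ^ 2)))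
        {3, 2} {3, 2} {5}) ∧
    IsBelyiPairOfGenus 1 (X ^ 3 + 1)
      (fun S => 1 / (1 - (8 + 8 * S.x ^ 3 + S.x ^ 6) / S.x ^ 6
        - (-8 - 4 * S.x ^ 3) / S.x ^ 6 * S.y))
      {6} {6} {3, 1, 1, 1} ∧
    IsBelyiPairOfGenus 1 (X ^ 3 + C (2 / 3) * X - C (7 / 27))
      (fun S => 1 / (1 + 1 / 27 * (1 - 9 * S.x + 27 * S.x ^ 2 - 27 * S.x ^ 3)))
      {6} {6} {2, 2, 1, 1} ∧
    IsBelyiPairOfGenus 1 (X ^ 3 - C (15 / 16) * X + C (11 / 32))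
      (fun S => 1 / 2 * (1 + (S.x ^ 2 - S.x + 7 / 16) / (S.x - 1 / 2) ^ 2 * S.y))
      {3, 3} {3, 3} {3, 3} ∧
    (∀ (S : HyperellipticCurve 1) (β : S.FunctionField),
      ¬ S.IsBelyiPair β {3, 3} {3, 3} {4, 2}) ∧
    -- genus 2
    IsBelyiPairOfGenus 2 (X ^ 5 + 1) (fun S => (S.y + 1) / 2) {5} {5} {5} ∧
    IsBelyiPairOfGenus 2 (X ^ 6 + 3 * X ^ 3 + C (1 / 4))
      (fun S => 1 / (1 + 1 / 2 * (-1 - 8 * S.x ^ 3 - 4 * S.x ^ 6) - (1 + 2 * S.x ^ 3) * S.y))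
      {6} {6} {3, 3} :=
  ⟨belyiPair_3_3_3, fun _ hξ => belyiPair_4_4_31 hξ, belyiPair_4_4_22,
    fun _ hξ => belyiPair_5_5_311 hξ, fun _ hξ => belyiPair_5_5_221 hξ,
    fun _ hξ => belyiPair_41_41_5 hξ, fun _ hξ => belyiPair_32_32_5 hξ, belyiPair_6_6_3111,
    belyiPair_6_6_2211, belyiPair_33_33_33, fun S β => S.not_isBelyiPair_33_33_42 β,
    belyiPair_5_5_5, belyiPair_6_6_33⟩
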